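/- \textbf{Model.} A base station (BS) with $N$ antennas serves a single-antenna user terminal (UT). The channel is $\mathbf h\sim\mathcal{CN}(\mathbf 0,\mathbf R_N)$ with $\mathbf R_N\succeq 0$. In the uplink a deterministic pilot $d=d_N\in\mathbb C$ with power $p^{UT}=|d|^2$ is sent, and the BS receives $$\mathbf z=\mathbf h(d+\eta_t^{UT})+\boldsymbol\nu+\boldsymbol\eta_r^{BS},$$ where $\eta_t^{UT}\sim\mathcal{CN}(0,\kappa_t^{UT}p^{UT})$ and $\boldsymbol\nu\sim\mathcal{CN}(\mathbf 0,\mathbf S_N)$ with $\mathbf S_N\succ0$ and, given $\mathbf h$, $\boldsymbol\eta_r^{BS}\sim\mathcal{CN}(\mathbf 0,\kappa_r^{BS}p^{UT}\,\mathrm{diag}(|h_1|^2,\dots,|h_N|^2))$. These quantities are independent, apart from the stated dependence of the variance of $\boldsymbol\eta_r^{BS}$ on $\mathbf h$. The LMMSE estimate of the channel is $$\hat{\mathbf h}=d^*\mathbf R_N\big(p^{UT}(1+\kappa_t^{UT})\mathbf R_N+p^{UT}\kappa_r^{BS}\mathrm{diag}(r_{11},\dots,r_{NN})+\mathbf S_N\big)^{-1}\mathbf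 z .$$ In the downlink the BS sends a data signal $s$ with a beamforming vector $\mathbf w=\mathbf w(\hat{\mathbf h})$, $\|\mathbf w\|=1$, and the UT receives $$y=\mathbf h^T(\mathbf w s+\boldsymbol\eta_t^{BS})+n+\eta_r^{UT},$$ where $n\sim\mathcal{CN}(0,\sigma_{UT}^2)$ with $\sigma_{UT}^2>0$ and, given $\mathbf h,\hat{\mathbf h}$, $\boldsymbol\eta_t^{BS}\sim\mathcal{CN}(\mathbf 0,\kappa_t^{BS}p^{BS}\mathrm{diag}(|w_1|^2,\dots,|w_N|^2))$ and $\eta_r^{UT}\sim\mathcal{CN}(0,\kappa_r^{UT}p^{BS}|\mathbf h^T\mathbf w|^2)$; the signal $s$ is independent of $(\mathbf h,\hat{\mathbf h})$, and the noises are independent of each other and of $s$. The impairment levels $\kappa_t^{BS},\kappa_r^{BS},\kappa_t^{UT},\kappa_r^{UT}\ge0$ and $\sigma_{UT}^2$ do not depend on $N$. The UT has arbitrary side information about $(\mathbf h,\hat{\mathbf h})$ in each data block (anything from none to perfect knowledge; it may depend on $N$ and on the strategy $\mathbf w(\cdot)$). The capacity, in bits per channel use, is $$C=\sup_{\mathbf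 w(\cdot):\,\|\mathbf w\|=1}\ \sup_{f:\,\mathbb E|s|^2\le p^{BS}}\ \mathbb E\{\mathcal I(s;y)\},$$ over the measurable functions $\mathbf w(\hat{\mathbf h})$ and the laws $f$ of $s$, where $\mathcal I(s;y)$ is the mutual information given the UT's side information in the block, and $\mathbb E$ averages over that side information. (If the suprema are taken inside the expectation, $C$ can only become larger, so the conclusions hold a fortiori.) The energy efficiency is $EE=C/(p^{BS}+\alpha_1p^{BS}+\alpha_2p^{UT})$ with constants $\alpha_1,\alpha_2\ge0$. For maximum ratio transmission (MRT), $\mathbf v=\hat{\mathbf h}^*/\|\hat{\mathbf h}\|$, let $C_{lower}=\log_2(1+\widetilde{SINR})$ with $$\widetilde{SINR}=\frac{|\mathbb E\{\mathbf h^T\mathbf v\}|^2}{(1+\kappa_r^{UT})\mathbb E\{|\mathbf h^T\mathbf v|^2\}-|\mathbb E\{\mathbf h^T\mathbf v\}|^2+\kappa_t^{BS}\sum_{i=1}^N\mathbb E\{|h_i|^2|v_i|^2\}+\sigma_{UT}^2/p^{BS}} .$$ \textbf{Assumptions.} The spectral norms of $\mathbf R_N$, $\mathbf S_N$ and $\mathbf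 S_N^{-1}$ are bounded uniformly in $N$, and $\liminf_{N\to\infty}\frac1N\mathrm{tr}(\mathbf R_N)>0$. \textbf{Corollary.} Let $p^{BS}=c_{BS}/N^{t_{BS}}$ and $p^{UT}=c_{UT}/N^{t_{UT}}$ with constants $c_{BS},c_{UT}>0$ and exponents $t_{BS}\ge0$, $0<t_{UT}<\frac12$, $t_{BS}+t_{UT}<1$. Then $C\ge C_{lower}$ for every $N\ge1$, $$\lim_{N\to\infty}C_{lower}=\log_2\Big(1+\frac1{\kappa_r^{UT}+\kappa_t^{UT}+\kappa_r^{UT}\kappa_t^{UT}}\Big),$$ and hence $$\liminf_{N\to\infty}C\ \ge\ \log_2\Big(1+\frac1{\kappa_r^{UT}+\kappa_t^{UT}+\kappa_r^{UT}\kappa_t^{UT}}\Big),$$ where the right-hand side is $+\infty$ if $\kappa_r^{UT}=\kappa_t^{UT}=0$. If moreover $t_{BS}>0$, then $EE\to\infty$ as $N\to\infty$ for all $\alpha_1,\alpha_2\ge0$. -/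

import Mathlib

open MeasureTheory ProbabilityTheory Filter Topology
open scoped ENNReal Matrix Matrix.Norms.L2Operator MatrixOrder ComplexOrder

noncomputable section

namespace MISO

/-! ### Circularly-symmetric complex Gaussian laws -/

/-- The law `CN(0, 1)`: independent real and imaginary parts, each `N(0, 1/2)`. -/
def stdCN : Measure ℂ :=
  ((gaussianReal 0 (1 / 2)).prod (gaussianReal 0 (1 / 2))).map (fun x : ℝ × ℝ => (⟨x.1, x.2⟩ : ℂ))

/-- The law `CN(0, v)` on `ℂ`, for a variance `v ≥ 0`. -/
def scalarCN (v : ℝ) : Measure ℂ := stdCN.map (fun z => (Real.sqrt v : ℂ) * z)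

/-- The law `CN(0, I)` on `ℂᴺ`: independent `CN(0, 1)` coordinates. -/
def whiteCN (N : ℕ) : Measure (Fin N → ℂ) := Measure.pi fun _ => stdCN

/-- The law `CN(0, Q)` on `ℂᴺ`, for a positive semidefinite covariance matrix `Q`: the law of
`Q^{1/2} g` with `g ∼ CN(0, I)`. -/
def vectorCN {N : ℕ} (Q : Matrix (Fin N) (Fin N) ℂ) : Measure (Fin N → ℂ) :=
  (whiteCN N).map (fun g => CFC.sqrt Q *ᵥ g)

/-- The Euclidean norm on `ℂᴺ` (the type `Fin N → ℂ` itself carries the sup norm). -/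
def l2norm {N : ℕ} (x : Fin N → ℂ) : ℝ := ‖(WithLp.toLp 2 x : EuclideanSpace ℂ (Fin N))‖

/-! ### Parameters of the link -/

/-- The parameters of a link between an `N`-antenna base station (BS) and a single-antenna user
terminal (UT). -/
structure Link (N : ℕ) where
  /-- channel covariance matrix -/
  R : Matrix (Fin N) (Fin N) ℂ
  /-- uplink noise covariance matrix -/
  S : Matrix (Fin N) (Fin N) ℂ
  /-- deterministic uplink pilot symbol -/
  d : ℂ
  /-- downlink signal power -/
  pBS : ℝ
  /-- noise variance at the terminal -/
  noiseUT : ℝ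
  /-- impairment level of the BS transmitter (downlink) -/
  κtBS : ℝ
  /-- impairment level of the BS receiver (uplink) -/
  κrBS : ℝ
  /-- impairment level of the UT transmitter (uplink) -/
  κtUT : ℝ
  /-- impairment level of the UT receiver (downlink) -/
  κrUT : ℝ

variable {N : ℕ}

/-- The uplink pilot power `|d|²`. -/
def Link.pUT (L : Link N) : ℝ := ‖L.d‖ ^ 2

/-! ### Uplink: pilot transmission and channel estimation -/

/-- The independent primitive random quantities of the uplink: the channel `h ∼ CN(0, R)`, the UT
distortion `η_t ∼ CN(0, κ_t^UT p^UT)`, the noise `ν ∼ CN(0, S)`, and a normalized `e ∼ CN(0, I)`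
out of which the BS receiver distortion is formed. -/
def Link.uplink (L : Link N) :
    Measure ((Fin N → ℂ) × ℂ × (Fin N → ℂ) × (Fin N → ℂ)) :=
  (vectorCN L.R).prod ((scalarCN (L.κtUT * L.pUT)).prod ((vectorCN L.S).prod (whiteCN N)))

/-- The received pilot signal `z = h (d + η_t) + ν + η_r`. Given `h`, the `i`-th coordinate of
`η_r` is `√(κ_r^BS p^UT) |h_i| e_i`, so `η_r ∼ CN(0, κ_r^BS p^UT diag(|h_1|², …, |h_N|²))`. -/
def Link.received (L : Link N) (u : (Fin N → ℂ) × ℂ × (Fin N → ℂ) × (Fin N → ℂ)) :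
    Fin N → ℂ := fun i =>
  u.1 i * (L.d + u.2.1) + u.2.2.1 i
    + ((Real.sqrt (L.κrBS * L.pUT) * ‖u.1 i‖ : ℝ) : ℂ) * u.2.2.2 i

/-- The matrix `A = d* R (p^UT (1 + κ_t^UT) R + p^UT κ_r^BS R_diag + S)⁻¹` of the LMMSE
estimator. -/
def Link.lmmse (L : Link N) : Matrix (Fin N) (Fin N) ℂ :=
  (star L.d) • (L.R *
    (((L.pUT * (1 + L.κtUT) : ℝ) : ℂ) • L.R
      + ((L.pUT * L.κrBS : ℝ) : ℂ) • Matrix.diagonal (fun i => L.R i i) + L.S)⁻¹)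

/-- The LMMSE estimate `ĥ = A z`. -/
def Link.estimate (L : Link N) (u : (Fin N → ℂ) × ℂ × (Fin N → ℂ) × (Fin N → ℂ)) :
    Fin N → ℂ := L.lmmse *ᵥ L.received u

/-- The joint law of the pair `(h, ĥ)`. -/
def Link.channelLaw (L : Link N) : Measure ((Fin N → ℂ) × (Fin N → ℂ)) :=
  L.uplink.map (fun u => (u.1, L.estimate u))

/-! ### Downlink: data transmission -/

/-- A beamforming strategy: a (measurable) deterministic function `ĥ ↦ w(ĥ)` with unit-norm
values. -/
structure Beamformer (N : ℕ) where
  toFun : (Fin N → ℂ) → (Fin N → ℂ)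
  measurable_toFun : Measurable toFun
  unit_norm : ∀ x, l2norm (toFun x) = 1

/-- The effective channel `hᵀ w`. -/
def effective (h w : Fin N → ℂ) : ℂ := ∑ i, h i * w i

/-- The normalized primitive noises of the downlink, all `CN(0, 1)` and independent:
one for each BS antenna, one for the receiver noise, one for the UT receiver distortion. -/
def downlinkNoise (N : ℕ) : Measure ((Fin N → ℂ) × ℂ × ℂ) :=
  (whiteCN N).prod (stdCN.prod stdCN)

/-- The received downlink signal `y = hᵀ (w s + η_t) + n + η_r` for a beamforming vector `w`.
Given `h` and `w`, it has `η_t ∼ CN(0, κ_t^BS p^BS diag(|w_1|², …, |w_N|²))`, `n ∼ CN(0, σ²)` and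
`η_r ∼ CN(0, κ_r^UT p^BS |hᵀ w|²)`. -/
def Link.downlinkSignal (L : Link N) (h w : Fin N → ℂ) (s : ℂ) (e : (Fin N → ℂ) × ℂ × ℂ) : ℂ :=
  (∑ i, h i * (w i * s + ((Real.sqrt (L.κtBS * L.pBS) * ‖w i‖ : ℝ) : ℂ) * e.1 i))
    + (Real.sqrt L.noiseUT : ℂ) * e.2.1
    + ((Real.sqrt (L.κrUT * L.pBS) * ‖effective h w‖ : ℝ) : ℂ) * e.2.2

/-- The joint law of `(s, y)` when the data signal `s` has law `f`, the pair `(h, ĥ)` has law `ρ`,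
the beamforming vector is `w(ĥ)`, and `s`, `(h, ĥ)` and the noises are independent. -/
def Link.signalLaw (L : Link N) (w : Beamformer N) (f : Measure ℂ)
    (ρ : Measure ((Fin N → ℂ) × (Fin N → ℂ))) : Measure (ℂ × ℂ) :=
  (f.prod (ρ.prod (downlinkNoise N))).map
    (fun x => (x.1, L.downlinkSignal x.2.1.1 (w.toFun x.2.1.2) x.1 x.2.2))

/-- The mutual information, in bits, of the two coordinates under the joint law `P`. -/
def mutualInfo (P : Measure (ℂ × ℂ)) : ℝ≥0∞ :=
  InformationTheory.klDiv P (P.fst.prod P.snd) / ENNReal.ofReal (Real.log 2)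

/-- The channel state information (CSI) of the terminal in a data block. The information takes
values in `𝒢` with law `law`, and `posterior g` is the conditional law of `(h, ĥ)` when the
information is `g`; it averages to the law `ρ` of `(h, ĥ)`. The two extremes are the
one-point `𝒢` with `posterior = ρ` (only long-term statistics, no downlink pilots) and
`law = ρ`, `posterior g = δ_g` (perfect CSI). -/
structure TerminalCSI (𝒢 : Type*) [MeasurableSpace 𝒢]
    (ρ : Measure ((Fin N → ℂ) × (Fin N → ℂ))) where
  law : Measure 𝒢
  isProbability : IsProbabilityMeasure law
  posterior : Kernel 𝒢 ((Fin N → ℂ) × (Fin N → ℂ))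
  isMarkov : IsMarkovKernel posterior
  average : posterior ∘ₘ law = ρ

/-- The mutual information `𝔼{I(s; y)}` averaged over the data blocks, where in each block
`I(s; y)` is the mutual information given the terminal's CSI in this block. -/
def Link.rate (L : Link N) {𝒢 : Type*} [MeasurableSpace 𝒢]
    (csi : TerminalCSI 𝒢 L.channelLaw) (w : Beamformer N) (f : Measure ℂ) : ℝ≥0∞ :=
  ∫⁻ g, mutualInfo (L.signalLaw w f (csi.posterior g)) ∂csi.law

/-- The signal laws `f` on `ℂ` with `𝔼{|s|²} ≤ p`. -/
def signalLaws (p : ℝ) : Set (Measure ℂ) :=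
  {f | IsProbabilityMeasure f ∧ ∫⁻ s, ‖s‖ₑ ^ 2 ∂f ≤ ENNReal.ofReal p}

/-- The downlink capacity in bits per channel use: the supremum of `𝔼{I(s; y)}` over the
beamforming strategies `w(ĥ)` and the signal laws `f` of power at most `p^BS`. What the terminal
knows may depend on the strategy `w` (downlink pilots may be sent through `w`). The base station
adapts to `ĥ` alone; letting it also adapt `w` and `f` to the block, with the suprema inside the
expectation, only gives a larger value, see `Link.capacity_le_blockwise`. -/
def Link.capacity (L : Link N) {𝒢 : Type*} [MeasurableSpace 𝒢]
    (csi : Beamformer N → TerminalCSI 𝒢 L.channelLaw) : ℝ≥0∞ :=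
  ⨆ w : Beamformer N, ⨆ f ∈ signalLaws L.pBS, L.rate (csi w) w f

theorem Link.capacity_le_blockwise (L : Link N) {𝒢 : Type*} [MeasurableSpace 𝒢]
    (csi : TerminalCSI 𝒢 L.channelLaw) :
    L.capacity (fun _ => csi) ≤
      ∫⁻ g, (⨆ w : Beamformer N, ⨆ f ∈ signalLaws L.pBS,
        mutualInfo (L.signalLaw w f (csi.posterior g))) ∂csi.law := by
  refine iSup_le fun w => iSup₂_le fun f hf => lintegral_mono fun g => ?_
  exact le_iSup_of_le w (le_iSup₂_of_le f hf le_rfl)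

/-! ### The lower bound for maximum ratio transmission -/

/-- The maximum ratio transmission (MRT) vector `v = ĥ* / ‖ĥ‖`. -/
def mrt (x : Fin N → ℂ) : Fin N → ℂ := fun i => star (x i) / (l2norm x : ℂ)

/-- The effective channel `hᵀ v` under MRT, as a function of the uplink random quantities. -/
def Link.mrtGain (L : Link N) (u : (Fin N → ℂ) × ℂ × (Fin N → ℂ) × (Fin N → ℂ)) : ℂ :=
  effective u.1 (mrt (L.estimate u))

/-- The effective SINR of MRT for a terminal that knows only the statistics of `hᵀ v`. -/
def Link.mrtSINR (L : Link N) : ℝ :=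
  ‖∫ u, L.mrtGain u ∂L.uplink‖ ^ 2 /
    ((1 + L.κrUT) * (∫ u, ‖L.mrtGain u‖ ^ 2 ∂L.uplink)
      - ‖∫ u, L.mrtGain u ∂L.uplink‖ ^ 2
      + L.κtBS * (∑ i, ∫ u, ‖u.1 i‖ ^ 2 * ‖mrt (L.estimate u) i‖ ^ 2 ∂L.uplink)
      + L.noiseUT / L.pBS)

/-- The MRT lower bound `log₂(1 + SINR)` on the capacity. -/
def Link.mrtLower (L : Link N) : ℝ≥0∞ := ENNReal.ofReal (Real.logb 2 (1 + L.mrtSINR))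

/-! ### Energy efficiency -/

/-- The energy efficiency: capacity per radiated power, `C / (p^BS + α₁ p^BS + α₂ p^UT)`. -/
def Link.energyEfficiency (L : Link N) {𝒢 : Type*} [MeasurableSpace 𝒢]
    (csi : Beamformer N → TerminalCSI 𝒢 L.channelLaw) (α₁ α₂ : ℝ) : ℝ≥0∞ :=
  L.capacity csi / ENNReal.ofReal (L.pBS + α₁ * L.pBS + α₂ * L.pUT)

/-- The value `log₂(1 + 1/κ)` for `κ ≥ 0`, which is infinite for `κ = 0`. -/
def ceiling (κ : ℝ) : ℝ≥0∞ :=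
  if κ = 0 then ⊤ else ENNReal.ofReal (Real.logb 2 (1 + 1 / κ))

end MISO

end

/-! The proof has two independent halves: an information inequality valid for every `N`, and a law
of large numbers for the matched filter.

Information inequality. Let `s` be Gaussian of power `p`. The divergence that defines `I(s; y)` is
bounded below by testing it against the log-likelihood ratio of `CN(a y, p t)` to `CN(0, p)`. Its
exponential integrates to one in `s` for every fixed `y`, hence under the product of the marginals,
whatever the law of `y`. This yields `I(s; y) ≥ log(1/t) - mse/t + 1` in nats, where `mse` is the
mean square error of the linear receiver `y ↦ a y` relative to `p` (`ofReal_integral_le_klDiv`,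
`Link.le_mutualInfo`). The right side is affine in the law of `(h, ĥ)`. With the same `a` and `t` in
all blocks, and `t` the overall error, it therefore averages to `log(1/t)` for every kind of
terminal information (`Link.le_rate`). The optimal `a` makes `1/t` equal to `1 + SINR`
(`Link.Admissible.mrtLower_le_capacity`).

Law of large numbers. Write `q` for the pilot power, `B = R gram⁻¹` and `T = tr(R gram⁻¹ R)`. Up to
a scalar, the estimate is `B z`. Its inner product with `h` concentrates around `T` times the
distorted pilot. Since `q → 0`, thermal noise dominates its squared norm, which concentrates around
`tr(B S Bᴴ) = T + O(qN)`. So the MRT gain is close to `√(qT) · amp`, where `amp` is one plus the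
relative pilot distortion. That distortion is a scalar shared by all antennas and does not average
out: `𝔼 amp = 1` and `𝔼|amp|² = 1 + κ_t^UT`. The mean square error of this approximation, in units
of `qT`, is `O(1/N + 1/(qN) + q)` (`WhiteUplink.exists_integral_norm_sq_normalizedGain_sub_amp_le`),
and `T` grows at least linearly in `N` (`Link.Admissible.le_gainTrace`).

After division by `qT`, numerator and denominator of the SINR tend to `1` and `(1 + κ_r^UT)(1 +
κ_t^UT) - 1`, provided that the remaining terms vanish. The BS distortion is `O(√N)` and the noise
is of order `N^tBS`, against `qT` of order at least `N^(1 - tUT)`; this is where `tUT < 1/2` and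
`tBS + tUT < 1` enter. The energy efficiency diverges because the rate bound has a nonzero limit
while the total power tends to zero. -/

noncomputable section

namespace MISO

section

/-! ### Measurable functions of polynomial growth -/

/-- A measurable map whose norm is bounded by a polynomial in the norm of its argument. -/
@[fun_prop]
structure Tame {E F : Type*} [NormedAddCommGroup E] [MeasurableSpace E]
    [NormedAddCommGroup F] [MeasurableSpace F] (f : E → F) : Prop where
  measurable : Measurable f
  growth : ∃ (C : ℝ) (k : ℕ), 0 ≤ C ∧ ∀ x, ‖f x‖ ≤ C * (1 + ‖x‖) ^ k

section Tame

variable {E F G : Type*} [NormedAddCommGroup E] [MeasurableSpace E]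
  [NormedAddCommGroup F] [MeasurableSpace F] [NormedAddCommGroup G] [MeasurableSpace G]

theorem Tame.of_le {f : E → F} (hf : Measurable f) (C : ℝ) (k : ℕ)
    (h : ∀ x, ‖f x‖ ≤ C * (1 + ‖x‖) ^ k) : Tame f := by
  refine ⟨hf, |C|, k, abs_nonneg _, fun x => (h x).trans ?_⟩
  gcongr
  exact le_abs_self C

/-- Meant for maps outside the closure rules, such as square roots and quotients, where domination
by a tame map replaces a growth estimate. -/
theorem Tame.of_norm_le {f : E → F} {g : E → G} (hf : Measurable f) (hg : Tame g)
    (h : ∀ x, ‖f x‖ ≤ ‖g x‖) : Tame f := by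
  obtain ⟨C, k, -, hC⟩ := hg.growth
  exact Tame.of_le hf C k fun x => (h x).trans (hC x)

@[fun_prop]
theorem tame_id : Tame (fun x : E => x) :=
  Tame.of_le measurable_id 1 1 fun x => by simp

@[fun_prop]
theorem tame_const (c : F) : Tame (fun _ : E => c) :=
  Tame.of_le measurable_const ‖c‖ 0 fun x => by simp

@[fun_prop]
theorem Tame.comp {f : F → G} {g : E → F} (hf : Tame f) (hg : Tame g) :
    Tame (fun x => f (g x)) := by
  obtain ⟨C, k, hC, h1⟩ := hf.growth
  obtain ⟨D, l, hD, h2⟩ := hg.growth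
  refine Tame.of_le (hf.measurable.comp hg.measurable) (C * (1 + D) ^ k) (l * k) fun x => ?_
  have h3 : (1 : ℝ) ≤ (1 + ‖x‖) ^ l := one_le_pow₀ (by linarith [norm_nonneg x])
  calc ‖f (g x)‖ ≤ C * (1 + ‖g x‖) ^ k := h1 _
    _ ≤ C * ((1 + D) * (1 + ‖x‖) ^ l) ^ k := by
        gcongr
        nlinarith [h2 x]
    _ = C * (1 + D) ^ k * (1 + ‖x‖) ^ (l * k) := by rw [mul_pow, pow_mul]; ring

@[fun_prop]
theorem tame_apply {ι : Type*} [Fintype ι] (i : ι) : Tame (fun x : ι → F => x i) :=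
  Tame.of_le (measurable_pi_apply i) 1 1 fun x => by
    simpa using (norm_le_pi_norm x i).trans (by linarith)

@[fun_prop]
theorem tame_pi {ι : Type*} [Fintype ι] {f : E → ι → F} (hf : ∀ i, Tame (fun x => f x i)) :
    Tame f := by
  choose C k hC h using fun i => (hf i).growth
  refine Tame.of_le (measurable_pi_lambda _ fun i => (hf i).measurable) (∑ i, C i) (∑ i, k i)
    fun x => ?_
  have h1 : (1 : ℝ) ≤ 1 + ‖x‖ := by linarith [norm_nonneg x]
  have hs : 0 ≤ ∑ i, C i := Finset.sum_nonneg fun i _ => hC i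
  refine (pi_norm_le_iff_of_nonneg (by positivity)).2 fun i => (h i x).trans ?_
  have h3 : C i ≤ ∑ i, C i := Finset.single_le_sum (fun i _ => hC i) (Finset.mem_univ i)
  have h4 : k i ≤ ∑ i, k i := Finset.single_le_sum (fun i _ => Nat.zero_le _) (Finset.mem_univ i)
  gcongr

@[fun_prop]
theorem tame_fst : Tame (fun x : E × F => x.1) :=
  Tame.of_le measurable_fst 1 1 fun x => by simpa using (norm_fst_le x).trans (by linarith)

@[fun_prop]
theorem tame_snd : Tame (fun x : E × F => x.2) :=
  Tame.of_le measurable_snd 1 1 fun x => by simpa using (norm_snd_le x).trans (by linarith)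

@[fun_prop]
theorem Tame.prodMk {f : E → F} {g : E → G} (hf : Tame f) (hg : Tame g) :
    Tame (fun x => (f x, g x)) := by
  obtain ⟨C, k, hC, h1⟩ := hf.growth
  obtain ⟨D, l, hD, h2⟩ := hg.growth
  refine Tame.of_le (hf.measurable.prodMk hg.measurable) (C + D) (k + l) fun x => ?_
  have h : (1 : ℝ) ≤ 1 + ‖x‖ := by linarith [norm_nonneg x]
  refine max_le ((h1 x).trans ?_) ((h2 x).trans ?_)
  · gcongr
    · linarith
    · omega
  · gcongr
    · linarith
    · omega

@[fun_prop]
theorem Tame.add [BorelSpace F] [SecondCountableTopology F] {f g : E → F} (hf : Tame f)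
    (hg : Tame g) : Tame (fun x => f x + g x) := by
  have : Tame (fun p : F × F => p.1 + p.2) := by
    refine Tame.of_le (measurable_fst.add measurable_snd) 2 1 fun p => (norm_add_le _ _).trans ?_
    linarith [norm_fst_le p, norm_snd_le p]
  exact this.comp (hf.prodMk hg)

@[fun_prop]
theorem Tame.sub [BorelSpace F] [SecondCountableTopology F] {f g : E → F} (hf : Tame f)
    (hg : Tame g) : Tame (fun x => f x - g x) := by
  have : Tame (fun p : F × F => p.1 - p.2) := by
    refine Tame.of_le (measurable_fst.sub measurable_snd) 2 1 fun p => (norm_sub_le _ _).trans ?_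
    linarith [norm_fst_le p, norm_snd_le p]
  exact this.comp (hf.prodMk hg)

@[fun_prop]
theorem Tame.mul {𝕜 : Type*} [NormedField 𝕜] [MeasurableSpace 𝕜] [BorelSpace 𝕜]
    [SecondCountableTopology 𝕜] {f g : E → 𝕜} (hf : Tame f)
    (hg : Tame g) : Tame (fun x => f x * g x) := by
  have : Tame (fun p : 𝕜 × 𝕜 => p.1 * p.2) := by
    refine Tame.of_le (measurable_fst.mul measurable_snd) 1 2 fun p => ?_
    rw [norm_mul]
    nlinarith [norm_fst_le p, norm_snd_le p, norm_nonneg p.1, norm_nonneg p.2]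
  exact this.comp (hf.prodMk hg)

@[fun_prop]
theorem Tame.pow {𝕜 : Type*} [NormedField 𝕜] [MeasurableSpace 𝕜] [BorelSpace 𝕜]
    [SecondCountableTopology 𝕜] {f : E → 𝕜} (hf : Tame f) (n : ℕ) :
    Tame (fun x => f x ^ n) := by
  induction n with
  | zero => simp only [pow_zero]; fun_prop
  | succ n ih => simp only [pow_succ]; fun_prop

@[fun_prop]
theorem Tame.sum {ι : Type*} [BorelSpace F] [SecondCountableTopology F] (s : Finset ι)
    {f : ι → E → F} (hf : ∀ i, Tame (f i)) : Tame (fun x => ∑ i ∈ s, f i x) := by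
  classical
  induction s using Finset.induction_on with
  | empty => simp only [Finset.sum_empty]; fun_prop
  | insert a s ha ih => simp only [Finset.sum_insert ha]; fun_prop

@[fun_prop]
theorem Tame.norm [OpensMeasurableSpace F] {f : E → F} (hf : Tame f) : Tame (fun x => ‖f x‖) := by
  have : Tame (fun x : F => ‖x‖) := Tame.of_le measurable_norm 1 1 fun x => by simp
  exact this.comp hf

@[fun_prop]
theorem Tame.star {f : E → ℂ} (hf : Tame f) : Tame (fun x => Star.star (f x)) :=
  Tame.of_norm_le (continuous_star.measurable.comp hf.measurable) hf fun x => by simp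

@[fun_prop]
theorem Tame.ofReal {f : E → ℝ} (hf : Tame f) : Tame (fun x => (f x : ℂ)) :=
  Tame.of_norm_le (Complex.measurable_ofReal.comp hf.measurable) hf fun x => by simp

@[fun_prop]
theorem Tame.re {f : E → ℂ} (hf : Tame f) : Tame (fun x => (f x).re) :=
  Tame.of_norm_le (Complex.measurable_re.comp hf.measurable) hf fun x => by
    simpa using Complex.abs_re_le_norm (f x)

@[fun_prop]
theorem Tame.mulVec {N : ℕ} (M : Matrix (Fin N) (Fin N) ℂ) {f : E → Fin N → ℂ} (hf : Tame f) :
    Tame (fun x => M *ᵥ f x) := by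
  refine tame_pi fun i => ?_
  simp only [Matrix.mulVec, dotProduct]
  fun_prop

end Tame

/-! ### Measures with finite moments -/

/-- All absolute moments are finite. -/
class HasMoments {E : Type*} [NormedAddCommGroup E] [MeasurableSpace E] (μ : Measure E) :
    Prop where
  isProb : IsProbabilityMeasure μ
  integrable_pow : ∀ k : ℕ, Integrable (fun x => ‖x‖ ^ k) μ

attribute [instance] HasMoments.isProb

/-- Convexity gives `(1 + r)^k ≤ 2^k (1 + r^k)`, and the moments are finite. This is the reason for
the class `Tame`: `fun_prop` proves tameness structurally, so that integrability side conditions are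
settled by `Tame.integrable (by fun_prop)`. -/
theorem Tame.integrable {E F : Type*} [NormedAddCommGroup E] [MeasurableSpace E]
    [BorelSpace E]
    [NormedAddCommGroup F] [MeasurableSpace F] [BorelSpace F] [SecondCountableTopology F]
    {μ : Measure E} [HasMoments μ]
    {f : E → F} (hf : Tame f) : Integrable f μ := by
  obtain ⟨C, k, hC, h⟩ := hf.growth
  have h1 : Integrable (fun x => C * (2 ^ k * (1 + ‖x‖ ^ k))) μ :=
    (((integrable_const 1).add (HasMoments.integrable_pow k)).const_mul _).const_mul _
  refine h1.mono' hf.measurable.aestronglyMeasurable (.of_forall fun x => (h x).trans ?_)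
  refine mul_le_mul_of_nonneg_left ?_ hC
  have := add_pow_le (zero_le_one (α := ℝ)) (norm_nonneg x) k
  refine this.trans ?_
  rw [one_pow]
  gcongr
  · norm_num
  · omega

instance HasMoments.prod {E F : Type*} [NormedAddCommGroup E] [MeasurableSpace E]
    [NormedAddCommGroup F] [MeasurableSpace F] [BorelSpace E] [BorelSpace F]
    [SecondCountableTopology E] [SecondCountableTopology F]
    {μ : Measure E} {ν : Measure F} [HasMoments μ] [HasMoments ν] :
    HasMoments (μ.prod ν) where
  isProb := inferInstance
  integrable_pow k := by
    have h1 := (HasMoments.integrable_pow (μ := μ) k).comp_fst ν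
    have h2 := (HasMoments.integrable_pow (μ := ν) k).comp_snd μ
    refine (h1.add h2).mono' (by fun_prop) (.of_forall fun x => ?_)
    rw [norm_pow, norm_norm, Prod.norm_def]
    rcases max_choice ‖x.1‖ ‖x.2‖ with h | h <;> rw [h] <;>
      simp only [Pi.add_apply] <;> nlinarith [pow_nonneg (norm_nonneg x.1) k,
        pow_nonneg (norm_nonneg x.2) k]

theorem exists_norm_apply_eq {E ι : Type*} [Fintype ι] [Nonempty ι] [NormedAddCommGroup E]
    (x : ι → E) : ∃ i, ‖x i‖ = ‖x‖ := by
  obtain ⟨i, hi⟩ := Finite.exists_max (fun i => ‖x i‖)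
  exact ⟨i, le_antisymm (norm_le_pi_norm x i) ((pi_norm_le_iff_of_nonneg (norm_nonneg _)).2 hi)⟩

instance {E ι : Type*} [Fintype ι] [NormedAddCommGroup E] [MeasurableSpace E] [BorelSpace E]
    [SecondCountableTopology E] {μ : ι → Measure E} [∀ i, HasMoments (μ i)] :
    HasMoments (Measure.pi μ) where
  isProb := inferInstance
  integrable_pow k := by
    have h1 : Integrable (fun x : ι → E => 1 + ∑ i, ‖x i‖ ^ k) (Measure.pi μ) := by
      refine (integrable_const 1).add (integrable_finsetSum _ fun i _ => ?_)
      exact integrable_comp_eval (μ := μ) (i := i) (f := fun x : E => ‖x‖ ^ k)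
        (HasMoments.integrable_pow (μ := μ i) k)
    refine h1.mono' (by fun_prop) (.of_forall fun x => ?_)
    rw [norm_pow, norm_norm]
    have hs : 0 ≤ ∑ i, ‖x i‖ ^ k := Finset.sum_nonneg fun i _ => by positivity
    rcases isEmpty_or_nonempty ι with hι | hι
    · have : ‖x‖ = 0 := by rw [Subsingleton.elim x 0, norm_zero]
      rw [this]
      exact (pow_le_one₀ le_rfl zero_le_one).trans (by linarith)
    · obtain ⟨i, hi⟩ := exists_norm_apply_eq x
      rw [← hi]
      have := Finset.single_le_sum (f := fun i => ‖x i‖ ^ k) (fun i _ => by positivity)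
        (Finset.mem_univ i)
      linarith

theorem HasMoments.map {E F : Type*} [NormedAddCommGroup E] [MeasurableSpace E] [BorelSpace E]
    [NormedAddCommGroup F] [MeasurableSpace F] [BorelSpace F] [SecondCountableTopology F]
    {μ : Measure E} [HasMoments μ] {f : E → F} (hf : Tame f) : HasMoments (μ.map f) where
  isProb := Measure.isProbabilityMeasure_map hf.measurable.aemeasurable
  integrable_pow k := by
    rw [integrable_map_measure (by fun_prop) hf.measurable.aemeasurable]
    exact Tame.integrable (f := fun x => ‖f x‖ ^ k) (by fun_prop)

instance (m : ℝ) (v : NNReal) : HasMoments (gaussianReal m v) where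
  isProb := inferInstance
  integrable_pow k := by
    simpa using (memLp_id_gaussianReal' (μ := m) (v := v) (k : ℝ≥0∞) (by simp)).integrable_norm_pow'

end

/-! ### Moments of white complex Gaussian vectors -/

theorem tame_complexMk : Tame (fun x : ℝ × ℝ => (⟨x.1, x.2⟩ : ℂ)) := by
  have : (fun x : ℝ × ℝ => (⟨x.1, x.2⟩ : ℂ)) = fun x => (x.1 : ℂ) + (x.2 : ℂ) * Complex.I := by
    ext x
    exact Complex.mk_eq_add_mul_I _ _
  rw [this]
  fun_prop

instance : HasMoments stdCN := HasMoments.map tame_complexMk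

instance (N : ℕ) : HasMoments (whiteCN N) := by unfold whiteCN; infer_instance

instance : IsProbabilityMeasure stdCN := HasMoments.isProb

instance (N : ℕ) : IsProbabilityMeasure (whiteCN N) := HasMoments.isProb

theorem integral_stdCN {f : ℂ → ℂ} (hf : Tame f) :
    ∫ z, f z ∂stdCN = ∫ x : ℝ × ℝ, f ⟨x.1, x.2⟩
      ∂(gaussianReal 0 (1 / 2)).prod (gaussianReal 0 (1 / 2)) :=
  integral_map tame_complexMk.measurable.aemeasurable hf.measurable.aestronglyMeasurable

theorem integral_gaussian_id : ∫ x : ℝ, (x : ℂ) ∂gaussianReal 0 (1 / 2) = 0 := by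
  rw [integral_complex_ofReal]
  simp [integral_id_gaussianReal]

theorem integral_gaussian_sq : ∫ x : ℝ, (x : ℂ) ^ 2 ∂gaussianReal 0 (1 / 2) = 1 / 2 := by
  have h := variance_id_gaussianReal (μ := 0) (v := 1 / 2)
  rw [variance_eq_integral (by fun_prop)] at h
  simp only [id_eq, integral_id_gaussianReal, sub_zero] at h
  have h2 : ∫ x : ℝ, (x : ℂ) ^ 2 ∂gaussianReal 0 (1 / 2)
      = ((∫ x : ℝ, x ^ 2 ∂gaussianReal 0 (1 / 2) : ℝ) : ℂ) := by
    rw [← integral_complex_ofReal]; simp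
  rw [h2, h]; simp

theorem integral_stdCN_id : ∫ z, z ∂stdCN = 0 := by
  rw [integral_stdCN (by fun_prop)]
  have h (x : ℝ × ℝ) : (⟨x.1, x.2⟩ : ℂ) = (x.1 : ℂ) * 1 + Complex.I * (x.2 : ℂ) := by
    rw [Complex.mk_eq_add_mul_I]; ring
  simp_rw [h]
  rw [integral_add (Tame.integrable (by fun_prop)) (Tame.integrable (by fun_prop)),
    integral_prod_mul (fun x : ℝ => (x : ℂ)) (fun _ => 1),
    integral_prod_mul (fun _ : ℝ => Complex.I) (fun x : ℝ => (x : ℂ)), integral_gaussian_id]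
  simp

theorem integral_stdCN_sq : ∫ z, z ^ 2 ∂stdCN = 0 := by
  rw [integral_stdCN (by fun_prop)]
  have h (x : ℝ × ℝ) : (⟨x.1, x.2⟩ : ℂ) ^ 2
      = (x.1 : ℂ) ^ 2 * 1 + (2 * Complex.I * x.1) * (x.2 : ℂ) - 1 * (x.2 : ℂ) ^ 2 := by
    rw [Complex.mk_eq_add_mul_I]
    linear_combination (x.2 : ℂ) ^ 2 * Complex.I_sq
  simp_rw [h]
  rw [integral_sub (Tame.integrable (by fun_prop)) (Tame.integrable (by fun_prop)),
    integral_add (Tame.integrable (by fun_prop)) (Tame.integrable (by fun_prop)),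
    integral_prod_mul (fun x : ℝ => (x : ℂ) ^ 2) (fun _ => 1),
    integral_prod_mul (fun x : ℝ => 2 * Complex.I * (x : ℂ)) (fun x : ℝ => (x : ℂ)),
    integral_prod_mul (fun _ : ℝ => (1 : ℂ)) (fun x : ℝ => (x : ℂ) ^ 2),
    integral_gaussian_id, integral_gaussian_sq]
  simp

theorem integral_stdCN_star_mul : ∫ z, star z * z ∂stdCN = 1 := by
  rw [integral_stdCN (by fun_prop)]
  have h (x : ℝ × ℝ) : star (⟨x.1, x.2⟩ : ℂ) * ⟨x.1, x.2⟩
      = (x.1 : ℂ) ^ 2 * 1 + 1 * (x.2 : ℂ) ^ 2 := by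
    apply Complex.ext <;> simp [← Complex.ofReal_pow] <;> ring
  simp_rw [h]
  rw [integral_add (Tame.integrable (by fun_prop)) (Tame.integrable (by fun_prop)),
    integral_prod_mul (fun x : ℝ => (x : ℂ) ^ 2) (fun _ => 1),
    integral_prod_mul (fun _ : ℝ => (1 : ℂ)) (fun x : ℝ => (x : ℂ) ^ 2), integral_gaussian_sq]
  norm_num

theorem integral_stdCN_star : ∫ z, star z ∂stdCN = 0 := by
  have := integral_conj (f := fun z : ℂ => z) (μ := stdCN)
  rw [integral_stdCN_id] at this
  simpa using this

theorem integral_stdCN_star_sq : ∫ z, star z ^ 2 ∂stdCN = 0 := by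
  have := integral_conj (f := fun z : ℂ => z ^ 2) (μ := stdCN)
  rw [integral_stdCN_sq] at this
  simpa using this

theorem integral_stdCN_norm_sq : ∫ z, ‖z‖ ^ 2 ∂stdCN = 1 := by
  have h : ∫ z, star z * z ∂stdCN = ((∫ z, ‖z‖ ^ 2 ∂stdCN : ℝ) : ℂ) := by
    rw [← integral_complex_ofReal]
    refine integral_congr_ae (.of_forall fun z => ?_)
    simp only [Complex.star_def, Complex.ofReal_pow]
    rw [mul_comm, Complex.mul_conj, Complex.normSq_eq_norm_sq]; simp
  rw [integral_stdCN_star_mul] at h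
  exact_mod_cast h.symm

/-- The absolute moment `𝔼|z|ᵏ` of `CN(0, 1)`. -/
def stdMoment (k : ℕ) : ℝ := ∫ z, ‖z‖ ^ k ∂stdCN

theorem stdMoment_nonneg (k : ℕ) : 0 ≤ stdMoment k := integral_nonneg fun _ => by positivity

/-- Wick's formula for the fourth-order moments of a white vector, up to the value of `𝔼|z|⁴`. -/
theorem integral_whiteCN_four {N : ℕ} (i j k l : Fin N) :
    ∫ g, (star (g i) * g j) * (g k * star (g l)) ∂whiteCN N =
      if i = j then (if k = l then (if i = k then (stdMoment 4 : ℂ) else 1) else 0)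
      else (if i = k ∧ j = l then 1 else 0) := by
  -- `F m` collects those of the four factors whose index is `m`. The integrand becomes a product
  -- over coordinates, and independence reduces the moment to a product of one-dimensional
  -- integrals.
  let F : Fin N → ℂ → ℂ := fun m z => (if m = i then star z else 1) * (if m = j then z else 1) *
    ((if m = k then z else 1) * (if m = l then star z else 1))
  have hF (g : Fin N → ℂ) :
      (star (g i) * g j) * (g k * star (g l)) = ∏ m, F m (g m) := by
    simp only [F, Finset.prod_mul_distrib, Finset.prod_ite_eq', Finset.mem_univ, if_true]
  have hone (m : Fin N) (h1 : m ≠ i) (h2 : m ≠ j) (h3 : m ≠ k) (h4 : m ≠ l) :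
      ∫ z, F m z ∂stdCN = 1 := by
    simp [F, h1, h2, h3, h4]
  have hzero (m : Fin N) (hm : ∫ z, F m z ∂stdCN = 0) :
      ∏ m, ∫ z, F m z ∂stdCN = 0 := Finset.prod_eq_zero (Finset.mem_univ m) hm
  simp_rw [hF]
  rw [whiteCN, integral_fintype_prod_eq_prod]
  by_cases hij : i = j
  · subst hij
    rw [if_pos rfl]
    by_cases hkl : k = l
    · subst hkl
      rw [if_pos rfl]
      by_cases hik : i = k
      · subst hik
        rw [if_pos rfl, Finset.prod_eq_single i (fun m _ hm => hone m hm hm hm hm) (by simp)]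
        simp only [F, if_true]
        rw [stdMoment, ← integral_complex_ofReal]
        refine integral_congr_ae (.of_forall fun z => ?_)
        simp only [Complex.star_def, Complex.ofReal_pow]
        rw [mul_comm ((starRingEnd ℂ) z), Complex.mul_conj, Complex.normSq_eq_norm_sq]
        push_cast; ring
      · rw [if_neg hik]
        refine Finset.prod_eq_one fun m _ => ?_
        by_cases h1 : m = i
        · subst h1
          simpa [F, hik] using integral_stdCN_star_mul
        · by_cases h2 : m = k
          · subst h2
            simpa [F, h1, mul_comm] using integral_stdCN_star_mul
          · exact hone m h1 h1 h2 h2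
    · rw [if_neg hkl]
      by_cases hik : i = k
      · subst hik
        exact hzero l (by simpa [F, Ne.symm hkl] using integral_stdCN_star)
      · exact hzero k (by simpa [F, Ne.symm hik, hkl] using integral_stdCN_id)
  · rw [if_neg hij]
    by_cases hik : i = k
    · subst hik
      by_cases hjl : j = l
      · subst hjl
        rw [if_pos ⟨rfl, rfl⟩]
        refine Finset.prod_eq_one fun m _ => ?_
        by_cases h1 : m = i
        · subst h1
          simpa [F, hij] using integral_stdCN_star_mul
        · by_cases h2 : m = j
          · subst h2
            simpa [F, h1, mul_comm] using integral_stdCN_star_mul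
          · exact hone m h1 h2 h1 h2
      · rw [if_neg (by simp [hjl])]
        exact hzero j (by simpa [F, Ne.symm hij, hjl] using integral_stdCN_id)
    · rw [if_neg (by simp [hik])]
      -- If `i = l`, two conjugated factors meet at the coordinate `i`, and circular symmetry, `𝔼
      -- conj(z)² = 0`, kills the moment. Otherwise a single centred factor sits there.
      by_cases hil : i = l
      · subst hil
        refine hzero i ?_
        simpa [F, hij, hik, sq] using integral_stdCN_star_sq
      · exact hzero i (by simpa [F, hij, hik, hil] using integral_stdCN_star)

theorem integral_whiteCN_eval {N : ℕ} {f : ℂ → ℂ} (hf : Tame f) (i : Fin N) :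
    ∫ g, f (g i) ∂whiteCN N = ∫ z, f z ∂stdCN :=
  integral_comp_eval (μ := fun _ : Fin N => stdCN) (i := i) hf.measurable.aestronglyMeasurable

theorem integral_whiteCN_eval_real {N : ℕ} {f : ℂ → ℝ} (hf : Tame f) (i : Fin N) :
    ∫ g, f (g i) ∂whiteCN N = ∫ z, f z ∂stdCN :=
  integral_comp_eval (μ := fun _ : Fin N => stdCN) (i := i) hf.measurable.aestronglyMeasurable

theorem integral_whiteCN_two {N : ℕ} (i j : Fin N) :
    ∫ g, star (g i) * g j ∂whiteCN N = if i = j then 1 else 0 := by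
  by_cases hij : i = j
  · subst hij
    rw [if_pos rfl]
    exact (integral_whiteCN_eval (f := fun z => star z * z) (by fun_prop) i).trans
      integral_stdCN_star_mul
  · rw [if_neg hij]
    let F : Fin N → ℂ → ℂ := fun m z => (if m = i then star z else 1) * (if m = j then z else 1)
    have hF (g : Fin N → ℂ) : star (g i) * g j = ∏ m, F m (g m) := by
      simp only [F, Finset.prod_mul_distrib, Finset.prod_ite_eq', Finset.mem_univ, if_true]
    simp_rw [hF]
    rw [whiteCN, integral_fintype_prod_eq_prod]
    exact Finset.prod_eq_zero (Finset.mem_univ i) (by simpa [F, hij] using integral_stdCN_star)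

/-- The centred product `conj(g_i) g_j - 𝔼`. -/
def centredPair {N : ℕ} (p : Fin N × Fin N) (g : Fin N → ℂ) : ℂ :=
  star (g p.1) * g p.2 - if p.1 = p.2 then 1 else 0

@[fun_prop]
theorem tame_centredPair {N : ℕ} (p : Fin N × Fin N) : Tame (centredPair p) := by
  unfold centredPair; fun_prop

/-- Wick's formula makes the centred products an orthogonal family in `L²`, so that the variance of
a quadratic form is a weighted Frobenius norm of its matrix. -/
theorem integral_centredPair_mul_star {N : ℕ} (p q : Fin N × Fin N) :
    ∫ g, centredPair p g * star (centredPair q g) ∂whiteCN N =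
      if p = q then (if p.1 = p.2 then (stdMoment 4 : ℂ) - 1 else 1) else 0 := by
  obtain ⟨i, j⟩ := p
  obtain ⟨k, l⟩ := q
  have h (g : Fin N → ℂ) : centredPair (i, j) g * star (centredPair (k, l) g) =
      (star (g i) * g j) * (g k * star (g l)) - (if k = l then 1 else 0) * (star (g i) * g j)
      - (if i = j then 1 else 0) * star (star (g k) * g l)
      + (if i = j then 1 else 0) * (if k = l then 1 else 0) := by
    simp only [centredPair, star_sub, star_mul', star_star]
    split_ifs <;> simp <;> ring
  have hstar : ∫ g, star (star (g k) * g l) ∂whiteCN N = if k = l then 1 else 0 := by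
    have := integral_conj (f := fun g : Fin N → ℂ => star (g k) * g l) (μ := whiteCN N)
    rw [integral_whiteCN_two] at this
    rw [show (fun g : Fin N → ℂ => star (star (g k) * g l))
      = fun g => (starRingEnd ℂ) (star (g k) * g l) from rfl, this]
    split_ifs <;> simp
  simp_rw [h]
  rw [integral_add (Tame.integrable (by fun_prop)) (Tame.integrable (by fun_prop)),
    integral_sub (Tame.integrable (by fun_prop)) (Tame.integrable (by fun_prop)),
    integral_sub (Tame.integrable (by fun_prop)) (Tame.integrable (by fun_prop)),
    integral_const_mul, integral_const_mul, integral_const, hstar, integral_whiteCN_two,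
    integral_whiteCN_four]
  simp only [Prod.mk.injEq, probReal_univ, one_smul]
  by_cases hij : i = j <;> by_cases hkl : k = l <;> by_cases hik : i = k <;>
    by_cases hjl : j = l <;> simp_all

/-! ### Quadratic and linear forms in a white vector -/

/-- The quadratic form `gᴴ M g`. -/
def quadForm {N : ℕ} (M : Matrix (Fin N) (Fin N) ℂ) (g : Fin N → ℂ) : ℂ := star g ⬝ᵥ (M *ᵥ g)

/-- The squared Frobenius norm. -/
def frobSq {N : ℕ} (M : Matrix (Fin N) (Fin N) ℂ) : ℝ := ∑ i, ∑ j, ‖M i j‖ ^ 2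

@[fun_prop]
theorem tame_quadForm {N : ℕ} (M : Matrix (Fin N) (Fin N) ℂ) : Tame (quadForm M) := by
  unfold quadForm dotProduct
  simp only [Pi.star_apply]
  fun_prop

theorem quadForm_sub_trace {N : ℕ} (M : Matrix (Fin N) (Fin N) ℂ) (g : Fin N → ℂ) :
    quadForm M g - M.trace = ∑ p : Fin N × Fin N, M p.1 p.2 * centredPair p g := by
  simp only [quadForm, dotProduct, Matrix.mulVec, centredPair, mul_sub, Finset.sum_sub_distrib,
    Fintype.sum_prod_type, Matrix.trace, Finset.mul_sum, Pi.star_apply, Matrix.diag]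
  congr 1
  · refine Finset.sum_congr rfl fun i _ => Finset.sum_congr rfl fun j _ => by ring
  · simp

/-- By orthogonality of the `centredPair` family only the diagonal of the double sum survives, with
weights at most `1 + 𝔼|z|⁴`. The exact fourth moment is never needed. -/
theorem integral_norm_sq_quadForm_sub_trace_le {N : ℕ} (M : Matrix (Fin N) (Fin N) ℂ) :
    ∫ g, ‖quadForm M g - M.trace‖ ^ 2 ∂whiteCN N ≤ (1 + stdMoment 4) * frobSq M := by
  have h1 (g : Fin N → ℂ) : ((‖quadForm M g - M.trace‖ ^ 2 : ℝ) : ℂ) =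
      ∑ p : Fin N × Fin N, ∑ q : Fin N × Fin N, M p.1 p.2 * star (M q.1 q.2) *
        (centredPair p g * star (centredPair q g)) := by
    rw [← Complex.normSq_eq_norm_sq, ← Complex.mul_conj, quadForm_sub_trace,
      ← Complex.star_def, star_sum, Finset.sum_mul_sum]
    refine Finset.sum_congr rfl fun p _ => Finset.sum_congr rfl fun q _ => ?_
    rw [star_mul']; ring
  have h2 : ((∫ g, ‖quadForm M g - M.trace‖ ^ 2 ∂whiteCN N : ℝ) : ℂ) =
      ((∑ p : Fin N × Fin N, ‖M p.1 p.2‖ ^ 2 * (if p.1 = p.2 then stdMoment 4 - 1 else 1) : ℝ)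
        : ℂ) := by
    rw [← integral_complex_ofReal]
    simp_rw [h1]
    rw [integral_finsetSum _ fun p _ => Tame.integrable (by fun_prop)]
    push_cast
    refine Finset.sum_congr rfl fun p _ => ?_
    rw [integral_finsetSum _ fun q _ => Tame.integrable (by fun_prop)]
    simp_rw [integral_const_mul, integral_centredPair_mul_star]
    simp only [mul_ite, mul_zero, Finset.sum_ite_eq, Finset.mem_univ, if_true]
    rw [Complex.star_def, Complex.mul_conj, Complex.normSq_eq_norm_sq]
    push_cast
    split_ifs <;> simp
  rw [Complex.ofReal_inj.1 h2, frobSq, ← Fintype.sum_prod_type (f := fun p : Fin N × Fin N =>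
    ‖M p.1 p.2‖ ^ 2), Finset.mul_sum]
  refine Finset.sum_le_sum fun p _ => ?_
  rw [mul_comm]
  refine mul_le_mul_of_nonneg_right ?_ (by positivity)
  have := stdMoment_nonneg 4
  split_ifs <;> linarith

theorem integral_quadForm {N : ℕ} (M : Matrix (Fin N) (Fin N) ℂ) :
    ∫ g, quadForm M g ∂whiteCN N = M.trace := by
  simp only [quadForm, dotProduct, Matrix.mulVec, Finset.mul_sum, Pi.star_apply]
  rw [integral_finsetSum _ fun p _ => Tame.integrable (by fun_prop)]
  refine Finset.sum_congr rfl fun i _ => ?_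
  rw [integral_finsetSum _ fun q _ => Tame.integrable (by fun_prop)]
  have (j : Fin N) : ∫ g, star (g i) * (M i j * g j) ∂whiteCN N
      = M i j * if i = j then 1 else 0 := by
    rw [← integral_whiteCN_two, ← integral_const_mul]
    refine integral_congr_ae (.of_forall fun g => ?_)
    simp only; ring
  simp_rw [this]
  simp [Matrix.diag]

/-- The squared Euclidean norm. -/
def nsq {N : ℕ} (x : Fin N → ℂ) : ℝ := ∑ i, ‖x i‖ ^ 2

theorem nsq_nonneg {N : ℕ} (x : Fin N → ℂ) : 0 ≤ nsq x :=
  Finset.sum_nonneg fun _ _ => by positivity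

@[fun_prop]
theorem tame_nsq {N : ℕ} : Tame (nsq : (Fin N → ℂ) → ℝ) := by
  unfold nsq; fun_prop

/-- The rank-one matrix whose quadratic form is `|cᵀg|²`. -/
theorem quadForm_vecMulVec {N : ℕ} (c g : Fin N → ℂ) :
    quadForm (Matrix.vecMulVec (star c) c) g = ((‖c ⬝ᵥ g‖ ^ 2 : ℝ) : ℂ) := by
  rw [quadForm, Matrix.vecMulVec_mulVec, ← Complex.normSq_eq_norm_sq, ← Complex.mul_conj]
  simp only [dotProduct_smul, Matrix.star_dotProduct_star, ← Complex.star_def]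
  rw [op_smul_eq_mul, mul_comm]

theorem trace_vecMulVec_star {N : ℕ} (c : Fin N → ℂ) :
    (Matrix.vecMulVec (star c) c).trace = ((nsq c : ℝ) : ℂ) := by
  simp only [Matrix.trace, Matrix.diag, Matrix.vecMulVec_apply, nsq, Pi.star_apply,
    Complex.ofReal_sum]
  refine Finset.sum_congr rfl fun i _ => ?_
  rw [← Complex.normSq_eq_norm_sq, ← Complex.mul_conj, mul_comm]; rfl

theorem frobSq_vecMulVec_star {N : ℕ} (c : Fin N → ℂ) :
    frobSq (Matrix.vecMulVec (star c) c) = nsq c ^ 2 := by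
  simp only [frobSq, Matrix.vecMulVec_apply, Pi.star_apply, norm_mul, norm_star, mul_pow, nsq]
  rw [sq, Finset.sum_mul_sum]

theorem integral_norm_sq_dotProduct {N : ℕ} (c : Fin N → ℂ) :
    ∫ g, ‖c ⬝ᵥ g‖ ^ 2 ∂whiteCN N = nsq c := by
  have h := integral_quadForm (Matrix.vecMulVec (star c) c)
  simp_rw [quadForm_vecMulVec] at h
  rw [trace_vecMulVec_star, integral_complex_ofReal] at h
  exact_mod_cast h

theorem integral_dotProduct {N : ℕ} (c : Fin N → ℂ) :
    ∫ g, c ⬝ᵥ g ∂whiteCN N = 0 := by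
  simp only [dotProduct]
  rw [integral_finsetSum _ fun p _ => Tame.integrable (by fun_prop)]
  refine Finset.sum_eq_zero fun i _ => ?_
  rw [integral_const_mul, integral_whiteCN_eval (f := fun z => z) (by fun_prop), integral_stdCN_id,
    mul_zero]

theorem tame_dotProduct {N : ℕ} (c : Fin N → ℂ) : Tame (fun g : Fin N → ℂ => c ⬝ᵥ g) := by
  unfold dotProduct; fun_prop

/-- `|cᵀg|²` is the quadratic form of a rank-one matrix whose trace and Frobenius norm both equal
`nsq c`, so the variance bound applies, together with `x² ≤ 2 (x - n)² + 2 n²`. -/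
theorem integral_norm_four_dotProduct_le {N : ℕ} (c : Fin N → ℂ) :
    ∫ g, ‖c ⬝ᵥ g‖ ^ 4 ∂whiteCN N ≤ 2 * (2 + stdMoment 4) * nsq c ^ 2 := by
  have htame := tame_dotProduct c
  have h := integral_norm_sq_quadForm_sub_trace_le (Matrix.vecMulVec (star c) c)
  rw [frobSq_vecMulVec_star] at h
  have hpt (g : Fin N → ℂ) : ‖c ⬝ᵥ g‖ ^ 4 ≤
      2 * ‖quadForm (Matrix.vecMulVec (star c) c) g - (Matrix.vecMulVec (star c) c).trace‖ ^ 2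
        + 2 * nsq c ^ 2 := by
    rw [quadForm_vecMulVec, trace_vecMulVec_star, ← Complex.ofReal_sub, Complex.norm_real,
      Real.norm_eq_abs, sq_abs]
    nlinarith [sq_nonneg (‖c ⬝ᵥ g‖ ^ 2 - 2 * nsq c)]
  calc ∫ g, ‖c ⬝ᵥ g‖ ^ 4 ∂whiteCN N
      ≤ ∫ g, (2 * ‖quadForm (Matrix.vecMulVec (star c) c) g
          - (Matrix.vecMulVec (star c) c).trace‖ ^ 2 + 2 * nsq c ^ 2) ∂whiteCN N :=
        integral_mono (Tame.integrable (by fun_prop)) (Tame.integrable (by fun_prop)) hpt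
    _ ≤ 2 * (2 + stdMoment 4) * nsq c ^ 2 := by
        rw [integral_add (Tame.integrable (by fun_prop)) (Tame.integrable (by fun_prop)),
          integral_const_mul, integral_const]
        simp only [probReal_univ, one_smul]
        linarith

/-- Jensen's inequality for `r ↦ r^(k+1)` over the `N` coordinates. -/
theorem nsq_pow_le {N : ℕ} (x : Fin N → ℂ) (k : ℕ) :
    nsq x ^ (k + 1) ≤ (N : ℝ) ^ k * ∑ i, ‖x i‖ ^ (2 * (k + 1)) := by
  rcases Nat.eq_zero_or_pos N with rfl | hN
  · simp [nsq]
  · have h := pow_sum_div_card_le_sum_pow (s := Finset.univ) (f := fun i => ‖x i‖ ^ 2)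
      (fun i _ => by positivity) k
    rw [div_le_iff₀' (by simpa using pow_pos (Nat.cast_pos.2 hN) k)] at h
    simpa [nsq, pow_mul] using h

theorem integral_nsq_pow_le (N k : ℕ) :
    ∫ g, nsq g ^ (k + 1) ∂whiteCN N ≤ stdMoment (2 * (k + 1)) * (N : ℝ) ^ (k + 1) := by
  calc ∫ g, nsq g ^ (k + 1) ∂whiteCN N
      ≤ ∫ g, (N : ℝ) ^ k * ∑ i, ‖g i‖ ^ (2 * (k + 1)) ∂whiteCN N :=
        integral_mono (Tame.integrable (by fun_prop)) (Tame.integrable (by fun_prop))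
          fun g => nsq_pow_le g k
    _ = stdMoment (2 * (k + 1)) * (N : ℝ) ^ (k + 1) := by
        rw [integral_const_mul, integral_finsetSum _ fun p _ => Tame.integrable (by fun_prop)]
        simp_rw [integral_whiteCN_eval_real (f := fun z => ‖z‖ ^ (2 * (k + 1))) (by fun_prop)]
        simp [stdMoment]; ring

section

/-! ### Euclidean and operator norm bounds -/

variable {N : ℕ}

theorem l2norm_sq (x : Fin N → ℂ) : l2norm x ^ 2 = nsq x := by
  rw [l2norm, EuclideanSpace.norm_sq_eq, nsq]

theorem l2norm_nonneg (x : Fin N → ℂ) : 0 ≤ l2norm x := norm_nonneg _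

theorem l2norm_eq_zero {x : Fin N → ℂ} : l2norm x = 0 ↔ x = 0 := by
  simp [l2norm]

theorem l2norm_mulVec_le (M : Matrix (Fin N) (Fin N) ℂ) (x : Fin N → ℂ) :
    l2norm (M *ᵥ x) ≤ ‖M‖ * l2norm x :=
  Matrix.l2_opNorm_mulVec M (WithLp.toLp 2 x)

theorem nsq_mulVec_le (M : Matrix (Fin N) (Fin N) ℂ) (x : Fin N → ℂ) :
    nsq (M *ᵥ x) ≤ ‖M‖ ^ 2 * nsq x := by
  rw [← l2norm_sq, ← l2norm_sq, ← mul_pow]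
  exact pow_le_pow_left₀ (l2norm_nonneg _) (l2norm_mulVec_le M x) 2

theorem norm_star_dotProduct_le (x y : Fin N → ℂ) : ‖star x ⬝ᵥ y‖ ≤ l2norm x * l2norm y := by
  have := norm_inner_le_norm (𝕜 := ℂ) (WithLp.toLp 2 x) (WithLp.toLp 2 y)
  rwa [EuclideanSpace.inner_toLp_toLp, dotProduct_comm] at this

theorem nsq_star (x : Fin N → ℂ) : nsq (star x) = nsq x := by simp [nsq]

theorem nsq_smul (c : ℂ) (x : Fin N → ℂ) : nsq (c • x) = ‖c‖ ^ 2 * nsq x := by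
  simp [nsq, mul_pow, Finset.mul_sum]

theorem nsq_add (x y : Fin N → ℂ) : nsq (x + y) = nsq x + nsq y + 2 * (star x ⬝ᵥ y).re := by
  simp only [nsq, Pi.add_apply, dotProduct, Complex.re_sum, Finset.mul_sum,
    ← Finset.sum_add_distrib]
  refine Finset.sum_congr rfl fun i _ => ?_
  simp only [← Complex.normSq_eq_norm_sq, Complex.normSq_apply, Pi.star_apply, Complex.star_def,
    Complex.mul_re, Complex.conj_re, Complex.conj_im, Complex.add_re, Complex.add_im]
  ring

theorem nsq_add_le (x y : Fin N → ℂ) : nsq (x + y) ≤ 2 * nsq x + 2 * nsq y := by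
  simp only [nsq, Finset.mul_sum, ← Finset.sum_add_distrib, Pi.add_apply]
  refine Finset.sum_le_sum fun i _ => ?_
  have := norm_add_le (x i) (y i)
  nlinarith [sq_nonneg (‖x i‖ - ‖y i‖), norm_nonneg (x i + y i)]

theorem star_mulVec_dotProduct (M : Matrix (Fin N) (Fin N) ℂ) (x y : Fin N → ℂ) :
    star (M *ᵥ x) ⬝ᵥ y = star x ⬝ᵥ (Mᴴ *ᵥ y) := by
  rw [Matrix.star_mulVec, Matrix.dotProduct_mulVec]

theorem nsq_col_le (M : Matrix (Fin N) (Fin N) ℂ) (j : Fin N) :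
    nsq (fun i => M i j) ≤ ‖M‖ ^ 2 := by
  have h := nsq_mulVec_le M (Pi.single j 1)
  have h1 : nsq (Pi.single j (1 : ℂ) : Fin N → ℂ) = 1 := by
    rw [nsq, Finset.sum_eq_single j] <;> simp +contextual
  rw [h1, mul_one, Matrix.mulVec_single_one] at h
  exact h

theorem nsq_row_le (M : Matrix (Fin N) (Fin N) ℂ) (i : Fin N) : nsq (M i) ≤ ‖M‖ ^ 2 := by
  have h := nsq_col_le Mᴴ i
  rw [← Matrix.star_eq_conjTranspose, norm_star] at h
  simpa [nsq, Matrix.star_eq_conjTranspose] using h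

/-- Each row has squared norm at most `‖M‖²`. The variance of a quadratic form is thus of order `N`,
while its squared mean may be of order `N²`: this is the source of concentration. -/
theorem frobSq_le (M : Matrix (Fin N) (Fin N) ℂ) : frobSq M ≤ N * ‖M‖ ^ 2 := by
  calc frobSq M ≤ ∑ _i : Fin N, ‖M‖ ^ 2 := Finset.sum_le_sum fun i _ => nsq_row_le M i
    _ = N * ‖M‖ ^ 2 := by simp

theorem norm_conjTranspose (M : Matrix (Fin N) (Fin N) ℂ) : ‖Mᴴ‖ = ‖M‖ := by
  rw [← Matrix.star_eq_conjTranspose, norm_star]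

/-- Moving `M` to the other side leaves a linear form in the white vector, so that no dimension
factor appears. -/
theorem integral_norm_sq_star_mulVec_dotProduct_le (M : Matrix (Fin N) (Fin N) ℂ)
    (x : Fin N → ℂ) :
    ∫ g, ‖star (M *ᵥ g) ⬝ᵥ x‖ ^ 2 ∂whiteCN N ≤ ‖M‖ ^ 2 * nsq x := by
  have h (g : Fin N → ℂ) : ‖star (M *ᵥ g) ⬝ᵥ x‖ = ‖star (Mᴴ *ᵥ x) ⬝ᵥ g‖ := by
    rw [star_mulVec_dotProduct, ← norm_star, Matrix.star_dotProduct]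
    simp [dotProduct_comm]
  simp_rw [h]
  rw [integral_norm_sq_dotProduct, nsq_star, ← norm_conjTranspose M]
  exact nsq_mulVec_le _ _

theorem quadForm_gram (M : Matrix (Fin N) (Fin N) ℂ) (g : Fin N → ℂ) :
    quadForm (Mᴴ * M) g = (nsq (M *ᵥ g) : ℂ) := by
  rw [quadForm, ← Matrix.mulVec_mulVec, ← star_mulVec_dotProduct]
  simp only [dotProduct, nsq, Complex.ofReal_sum, Pi.star_apply]
  refine Finset.sum_congr rfl fun i _ => ?_
  rw [← Complex.normSq_eq_norm_sq, ← Complex.mul_conj, mul_comm]; rfl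

theorem integral_nsq_mulVec_pow_le (M : Matrix (Fin N) (Fin N) ℂ) (k : ℕ) :
    ∫ g, nsq (M *ᵥ g) ^ (k + 1) ∂whiteCN N ≤
      (‖M‖ ^ 2) ^ (k + 1) * (stdMoment (2 * (k + 1)) * (N : ℝ) ^ (k + 1)) := by
  calc ∫ g, nsq (M *ᵥ g) ^ (k + 1) ∂whiteCN N
      ≤ ∫ g, (‖M‖ ^ 2) ^ (k + 1) * nsq g ^ (k + 1) ∂whiteCN N := by
        refine integral_mono (Tame.integrable (by fun_prop)) (Tame.integrable (by fun_prop))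
          fun g => ?_
        simp only
        rw [← mul_pow]
        exact pow_le_pow_left₀ (nsq_nonneg _) (nsq_mulVec_le _ _) _
    _ ≤ _ := by
        rw [integral_const_mul]
        exact mul_le_mul_of_nonneg_left (integral_nsq_pow_le N k) (by positivity)

theorem integral_sum_norm_four_mulVec_le (M : Matrix (Fin N) (Fin N) ℂ) :
    ∫ g, ∑ i, ‖(M *ᵥ g) i‖ ^ 4 ∂whiteCN N ≤ N * (2 * (2 + stdMoment 4) * ‖M‖ ^ 4) := by
  rw [integral_finsetSum _ fun p _ => Tame.integrable (by fun_prop)]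
  calc ∑ i, ∫ g, ‖(M *ᵥ g) i‖ ^ 4 ∂whiteCN N
      ≤ ∑ _i : Fin N, 2 * (2 + stdMoment 4) * ‖M‖ ^ 4 := by
        refine Finset.sum_le_sum fun i _ => (integral_norm_four_dotProduct_le (M i)).trans ?_
        have := stdMoment_nonneg 4
        refine mul_le_mul_of_nonneg_left ?_ (by positivity)
        calc nsq (M i) ^ 2 ≤ (‖M‖ ^ 2) ^ 2 := pow_le_pow_left₀ (nsq_nonneg _) (nsq_row_le M i) 2
          _ = ‖M‖ ^ 4 := by ring
    _ = _ := by simp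

/-! ### Integration over one factor of a product -/

section Fubini

variable {E F : Type*} [NormedAddCommGroup E] [MeasurableSpace E] [BorelSpace E]
  [SecondCountableTopology E] [NormedAddCommGroup F] [MeasurableSpace F] [BorelSpace F]
  [SecondCountableTopology F] {μ : Measure E} {ν : Measure F} [HasMoments μ] [HasMoments ν]
  {f g : E × F → ℝ}

/-- The pointwise inequality may fail; it is needed only after one factor has been averaged. The
variants for `white4` below average out one of the four noises while the other three are frozen. -/
theorem integral_prod_mono_right (hf : Tame f) (hg : Tame g)
    (h : ∀ x, ∫ y, f (x, y) ∂ν ≤ ∫ y, g (x, y) ∂ν) :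
    ∫ p, f p ∂μ.prod ν ≤ ∫ p, g p ∂μ.prod ν := by
  rw [integral_prod f hf.integrable, integral_prod g hg.integrable]
  exact integral_mono hf.integrable.integral_prod_left hg.integrable.integral_prod_left h

theorem integral_prod_mono_left (hf : Tame f) (hg : Tame g)
    (h : ∀ y, ∫ x, f (x, y) ∂μ ≤ ∫ x, g (x, y) ∂μ) :
    ∫ p, f p ∂μ.prod ν ≤ ∫ p, g p ∂μ.prod ν := by
  rw [integral_prod_symm f hf.integrable, integral_prod_symm g hg.integrable]
  exact integral_mono hf.integrable.integral_prod_right hg.integrable.integral_prod_right h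

end Fubini

instance : BorelSpace ((Fin N → ℂ) × (Fin N → ℂ)) := Prod.borelSpace

instance : BorelSpace (ℂ × (Fin N → ℂ) × (Fin N → ℂ)) := Prod.borelSpace

instance : BorelSpace ((Fin N → ℂ) × ℂ × (Fin N → ℂ) × (Fin N → ℂ)) := Prod.borelSpace

instance : SecondCountableTopology ((Fin N → ℂ) × (Fin N → ℂ)) := inferInstance

instance : SecondCountableTopology (ℂ × (Fin N → ℂ) × (Fin N → ℂ)) := inferInstance

/-- The law of four independent white quantities: a vector, a scalar and two more vectors. -/
def white4 (N : ℕ) : Measure ((Fin N → ℂ) × ℂ × (Fin N → ℂ) × (Fin N → ℂ)) :=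
  (whiteCN N).prod (stdCN.prod ((whiteCN N).prod (whiteCN N)))

instance : HasMoments ((whiteCN N).prod (whiteCN N)) := HasMoments.prod

instance : HasMoments (stdCN.prod ((whiteCN N).prod (whiteCN N))) := HasMoments.prod

instance : HasMoments (white4 N) :=
  HasMoments.prod (μ := whiteCN N) (ν := stdCN.prod ((whiteCN N).prod (whiteCN N)))

instance : IsProbabilityMeasure (white4 N) := HasMoments.isProb

section White4

variable {f k : (Fin N → ℂ) × ℂ × (Fin N → ℂ) × (Fin N → ℂ) → ℝ}

theorem white4_mono (hf : Tame f) (hk : Tame k) (h : ∀ ω, f ω ≤ k ω) :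
    ∫ ω, f ω ∂white4 N ≤ ∫ ω, k ω ∂white4 N :=
  integral_mono hf.integrable hk.integrable h

theorem white4_mono_scalar (hf : Tame f) (hk : Tame k)
    (h : ∀ g g' e, ∫ z, f (g, z, g', e) ∂stdCN ≤ ∫ z, k (g, z, g', e) ∂stdCN) :
    ∫ ω, f ω ∂white4 N ≤ ∫ ω, k ω ∂white4 N :=
  integral_prod_mono_right hf hk fun g =>
    integral_prod_mono_left (f := fun p => f (g, p)) (g := fun p => k (g, p)) (by fun_prop)
      (by fun_prop) fun p => h g p.1 p.2

theorem white4_mono_third (hf : Tame f) (hk : Tame k)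
    (h : ∀ g z e, ∫ g', f (g, z, g', e) ∂whiteCN N ≤ ∫ g', k (g, z, g', e) ∂whiteCN N) :
    ∫ ω, f ω ∂white4 N ≤ ∫ ω, k ω ∂white4 N :=
  integral_prod_mono_right hf hk fun g =>
    integral_prod_mono_right (f := fun p => f (g, p)) (g := fun p => k (g, p)) (by fun_prop)
      (by fun_prop) fun z =>
    integral_prod_mono_left (f := fun p => f (g, z, p)) (g := fun p => k (g, z, p)) (by fun_prop)
      (by fun_prop) fun e => h g z e

theorem white4_mono_fourth (hf : Tame f) (hk : Tame k)
    (h : ∀ g z g', ∫ e, f (g, z, g', e) ∂whiteCN N ≤ ∫ e, k (g, z, g', e) ∂whiteCN N) :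
    ∫ ω, f ω ∂white4 N ≤ ∫ ω, k ω ∂white4 N :=
  integral_prod_mono_right hf hk fun g =>
    integral_prod_mono_right (f := fun p => f (g, p)) (g := fun p => k (g, p)) (by fun_prop)
      (by fun_prop) fun z =>
    integral_prod_mono_right (f := fun p => f (g, z, p)) (g := fun p => k (g, z, p)) (by fun_prop)
      (by fun_prop) fun g' => h g z g'

theorem integral_white4_fst {G : Type*} [NormedAddCommGroup G] [NormedSpace ℝ G]
    (f : (Fin N → ℂ) → G) :
    ∫ ω, f ω.1 ∂white4 N = ∫ g, f g ∂whiteCN N := by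
  rw [white4, integral_fun_fst]; simp

theorem integral_white4_scalar {G : Type*} [NormedAddCommGroup G] [NormedSpace ℝ G]
    (f : ℂ → G) :
    ∫ ω, f ω.2.1 ∂white4 N = ∫ z, f z ∂stdCN := by
  rw [white4, integral_fun_snd (f := fun p : ℂ × (Fin N → ℂ) × (Fin N → ℂ) => f p.1),
    integral_fun_fst]
  simp

end White4

end

section

/-! ### Concentration of the matched-filter gain -/

section TameVec

variable {E : Type*} [NormedAddCommGroup E] [MeasurableSpace E] {N : ℕ}

@[fun_prop]
theorem Tame.smul_vec {c : E → ℂ} {f : E → Fin N → ℂ} (hc : Tame c) (hf : Tame f) :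
    Tame (fun x => c x • f x) := by
  refine tame_pi fun i => ?_
  simp only [Pi.smul_apply, smul_eq_mul]
  fun_prop

@[fun_prop]
theorem Tame.star_vec {f : E → Fin N → ℂ} (hf : Tame f) : Tame (fun x => Star.star (f x)) := by
  refine tame_pi fun i => ?_
  simp only [Pi.star_apply]
  fun_prop

@[fun_prop]
theorem Tame.dotProduct {f g : E → Fin N → ℂ} (hf : Tame f) (hg : Tame g) :
    Tame (fun x => f x ⬝ᵥ g x) := by
  unfold _root_.dotProduct
  fun_prop

@[fun_prop]
theorem Tame.l2norm {f : E → Fin N → ℂ} (hf : Tame f) : Tame (fun x => MISO.l2norm (f x)) := by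
  have h : (fun x => MISO.l2norm (f x)) = fun x => Real.sqrt (nsq (f x)) := by
    ext x; rw [← l2norm_sq, Real.sqrt_sq (l2norm_nonneg _)]
  rw [h]
  refine Tame.of_norm_le (g := fun x => 1 + nsq (f x)) ?_ (by fun_prop) fun x => ?_
  · exact (Tame.measurable (by fun_prop : Tame fun x => nsq (f x))).sqrt
  · have := nsq_nonneg (f x)
    rw [Real.norm_eq_abs, Real.norm_eq_abs, abs_of_nonneg (Real.sqrt_nonneg _),
      abs_of_nonneg (by positivity)]
    exact Real.sqrt_le_iff.2 ⟨by positivity, by nlinarith⟩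

end TameVec

/-- The data of an uplink driven by white noise: square roots `H`, `K` of the channel and noise
covariances, a linear estimator `B`, the pilot symbol and the impairment levels. -/
structure WhiteUplink (N : ℕ) where
  H : Matrix (Fin N) (Fin N) ℂ
  K : Matrix (Fin N) (Fin N) ℂ
  B : Matrix (Fin N) (Fin N) ℂ
  d : ℂ
  κt : ℝ
  κr : ℝ

namespace WhiteUplink

variable {N : ℕ} (P : WhiteUplink N)

/-- The sample space of the white noises. -/
abbrev Sample (N : ℕ) : Type := (Fin N → ℂ) × ℂ × (Fin N → ℂ) × (Fin N → ℂ)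

/-- The channel vector. -/
def chan (ω : Sample N) : Fin N → ℂ := P.H *ᵥ ω.1

/-- The distorted pilot symbol. -/
def pilot (ω : Sample N) : ℂ := P.d + (Real.sqrt (P.κt * ‖P.d‖ ^ 2) : ℂ) * ω.2.1

/-- The receiver distortion. -/
def dist (ω : Sample N) : Fin N → ℂ := fun i =>
  ((Real.sqrt (P.κr * ‖P.d‖ ^ 2) * ‖P.chan ω i‖ : ℝ) : ℂ) * ω.2.2.2 i

/-- The part of the estimate that does not come from the thermal noise. -/
def sig (ω : Sample N) : Fin N → ℂ := P.pilot ω • (P.B *ᵥ P.chan ω) + P.B *ᵥ P.dist ω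

/-- The estimate, up to the scalar factor `d*`. -/
def est (ω : Sample N) : Fin N → ℂ := P.sig ω + (P.B * P.K) *ᵥ ω.2.2.1

/-- The limit of the normalized gain. -/
def amp (ω : Sample N) : ℂ :=
  1 + P.d * star ((Real.sqrt (P.κt * ‖P.d‖ ^ 2) : ℂ) * ω.2.1) / (‖P.d‖ ^ 2 : ℝ)

/-- The gain of the normalized matched filter. -/
def gain (ω : Sample N) : ℂ :=
  P.d * (star (P.est ω) ⬝ᵥ P.chan ω) / (‖P.d‖ * l2norm (P.est ω) : ℝ)

@[fun_prop]
theorem tame_chan : Tame P.chan := by unfold chan; fun_prop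

@[fun_prop]
theorem tame_pilot : Tame P.pilot := by unfold pilot; fun_prop

@[fun_prop]
theorem tame_dist : Tame P.dist := by unfold dist; fun_prop

@[fun_prop]
theorem tame_sig : Tame P.sig := by unfold sig; fun_prop

@[fun_prop]
theorem tame_est : Tame P.est := by unfold est; fun_prop

@[fun_prop]
theorem tame_amp : Tame P.amp := by unfold amp; simp only [div_eq_mul_inv]; fun_prop

/-- Cauchy–Schwarz. If the estimate vanishes, the quotient is `0` by convention and the bound
persists; tameness of `gain` follows from this domination. -/
theorem norm_gain_le (ω : Sample N) : ‖P.gain ω‖ ≤ l2norm (P.chan ω) := by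
  rw [gain, norm_div, norm_mul, Complex.norm_real, Real.norm_eq_abs,
    abs_of_nonneg (mul_nonneg (norm_nonneg _) (l2norm_nonneg _))]
  refine div_le_of_le_mul₀ (mul_nonneg (norm_nonneg _) (l2norm_nonneg _)) (l2norm_nonneg _) ?_
  calc ‖P.d‖ * ‖star (P.est ω) ⬝ᵥ P.chan ω‖
      ≤ ‖P.d‖ * (l2norm (P.est ω) * l2norm (P.chan ω)) := by
        gcongr
        exact norm_star_dotProduct_le _ _
    _ = _ := by ring

@[fun_prop]
theorem tame_gain : Tame P.gain := by
  refine Tame.of_norm_le (g := fun ω => l2norm (P.chan ω)) ?_ (by fun_prop) fun ω => ?_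
  · have h1 : Tame fun ω => P.d * (star (P.est ω) ⬝ᵥ P.chan ω) := by fun_prop
    have h2 : Tame fun ω => ((‖P.d‖ * l2norm (P.est ω) : ℝ) : ℂ) := by fun_prop
    exact h1.measurable.div h2.measurable
  · rw [Real.norm_eq_abs, abs_of_nonneg (l2norm_nonneg _)]
    exact P.norm_gain_le ω

/-- The matched-filter output splits into a signal part, receiver distortion and thermal noise. The
pilot distortion multiplies the whole signal part, which is why it survives in the limit, inside
`amp`, while the other two parts average out over the antennas. -/
theorem star_est_dotProduct (ω : Sample N) (hd : P.d ≠ 0) :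
    P.d * (star (P.est ω) ⬝ᵥ P.chan ω) =
      (‖P.d‖ ^ 2 : ℝ) * P.amp ω * quadForm (P.Hᴴ * P.Bᴴ * P.H) ω.1
        + P.d * (star (P.B *ᵥ P.dist ω) ⬝ᵥ P.chan ω)
        + P.d * (star ((P.B * P.K) *ᵥ ω.2.2.1) ⬝ᵥ P.chan ω) := by
  have h1 : star (P.B *ᵥ P.chan ω) ⬝ᵥ P.chan ω = quadForm (P.Hᴴ * P.Bᴴ * P.H) ω.1 := by
    rw [quadForm, chan, star_mulVec_dotProduct, star_mulVec_dotProduct, Matrix.mulVec_mulVec,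
      Matrix.mulVec_mulVec, Matrix.mul_assoc]
  have h2 : P.d * star (P.pilot ω) = (‖P.d‖ ^ 2 : ℝ) * P.amp ω := by
    have hq : ((‖P.d‖ ^ 2 : ℝ) : ℂ) ≠ 0 := by simpa using hd
    rw [amp, mul_add, mul_div_cancel₀ _ hq, pilot, star_add, mul_add, mul_one]
    congr 1
    rw [← Complex.normSq_eq_norm_sq, ← Complex.mul_conj]; rfl
  rw [est, sig, star_add, star_add, star_smul, add_dotProduct, add_dotProduct, smul_dotProduct, h1,
    ← h2, smul_eq_mul]
  ring

variable {P}

/-- `amp` has the form `1 + c · conj z` with `z` standard and `|c|² = κt`; the cross term is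
centred. -/
theorem integral_norm_sq_amp (hκt : 0 ≤ P.κt) (hd : P.d ≠ 0) :
    ∫ ω, ‖P.amp ω‖ ^ 2 ∂white4 N = 1 + P.κt := by
  have hs : 0 < ‖P.d‖ := norm_pos_iff.2 hd
  set c : ℂ := P.d * (Real.sqrt (P.κt * ‖P.d‖ ^ 2) : ℂ) / (‖P.d‖ ^ 2 : ℝ) with hc
  have hcn : ‖c‖ ^ 2 = P.κt := by
    rw [hc, norm_div, norm_mul, Complex.norm_real, Complex.norm_real, Real.norm_eq_abs,
      Real.norm_eq_abs, abs_of_nonneg (Real.sqrt_nonneg _), abs_of_nonneg (by positivity), div_pow,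
      mul_pow, Real.sq_sqrt (by positivity)]
    field_simp
  have hamp (ω : Sample N) : ‖P.amp ω‖ ^ 2 = 1 + (2 * c * star ω.2.1).re + ‖c‖ ^ 2 * ‖ω.2.1‖ ^ 2 := by
    have : P.amp ω = 1 + c * star ω.2.1 := by
      rw [amp, star_mul', hc]
      simp only [Complex.star_def, Complex.conj_ofReal]
      ring
    rw [this, ← mul_pow, ← norm_star ω.2.1, ← norm_mul, ← Complex.normSq_eq_norm_sq,
      ← Complex.normSq_eq_norm_sq, mul_assoc 2 c]
    generalize c * star ω.2.1 = w
    simp only [Complex.normSq_apply, Complex.add_re, Complex.add_im, Complex.one_re,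
      Complex.one_im, Complex.mul_re, Complex.re_ofNat, Complex.im_ofNat]
    ring
  have hre : Tame fun z : ℂ => (2 * c * star z).re := Tame.re (by fun_prop)
  simp_rw [hamp]
  rw [integral_white4_scalar (f := fun z : ℂ => 1 + (2 * c * star z).re + ‖c‖ ^ 2 * ‖z‖ ^ 2),
    integral_add ((tame_const _).add hre).integrable (Tame.integrable (by fun_prop)),
    integral_add (Tame.integrable (by fun_prop)) hre.integrable,
    integral_const_mul, integral_stdCN_norm_sq, hcn]
  have h0 : ∫ z, (2 * c * star z).re ∂stdCN = (∫ z, 2 * c * star z ∂stdCN).re :=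
    integral_re (𝕜 := ℂ) (f := fun z => 2 * c * star z) (Tame.integrable (by fun_prop))
  rw [h0, integral_const_mul, integral_stdCN_star]
  simp

theorem integral_amp : ∫ ω, P.amp ω ∂white4 N = 1 := by
  have h (ω : Sample N) : P.amp ω =
      1 + (P.d * (Real.sqrt (P.κt * ‖P.d‖ ^ 2) : ℂ) / (‖P.d‖ ^ 2 : ℝ)) * star ω.2.1 := by
    rw [amp, star_mul']
    simp only [Complex.star_def, Complex.conj_ofReal]
    ring
  simp_rw [h]
  rw [integral_add (Tame.integrable (by fun_prop)) (Tame.integrable (by fun_prop)),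
    integral_const_mul, integral_white4_scalar (f := fun z : ℂ => star z), integral_stdCN_star]
  simp

end WhiteUplink

end

/-! ### Moment bounds for the parts of the matched-filter output -/

section

namespace WhiteUplink

variable {N : ℕ} {P : WhiteUplink N}

/-- Operator norm bounds and sign conditions on the data of an uplink. -/
structure Bounded (P : WhiteUplink N) (b : ℝ) : Prop where
  H_le : ‖P.H‖ ≤ b
  K_le : ‖P.K‖ ≤ b
  B_le : ‖P.B‖ ≤ b
  κt_nonneg : 0 ≤ P.κt
  κr_nonneg : 0 ≤ P.κr

variable {b : ℝ}

theorem Bounded.nonneg (h : P.Bounded b) : 0 ≤ b := (norm_nonneg _).trans h.H_le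

theorem Bounded.BK_le (h : P.Bounded b) : ‖P.B * P.K‖ ≤ b ^ 2 := by
  rw [sq]
  exact (norm_mul_le _ _).trans (mul_le_mul h.B_le h.K_le (norm_nonneg _) h.nonneg)

theorem integral_nsq_chan_pow_le (h : P.Bounded b) (k : ℕ) :
    ∫ ω, nsq (P.chan ω) ^ (k + 1) ∂white4 N ≤
      (b ^ 2) ^ (k + 1) * (stdMoment (2 * (k + 1)) * (N : ℝ) ^ (k + 1)) := by
  have h1 := integral_nsq_mulVec_pow_le P.H k
  rw [← integral_white4_fst (f := fun g : Fin N → ℂ => nsq (P.H *ᵥ g) ^ (k + 1))] at h1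
  refine h1.trans ?_
  have := stdMoment_nonneg (2 * (k + 1))
  have := h.H_le
  gcongr

theorem integral_nsq_chan_le (h : P.Bounded b) :
    ∫ ω, nsq (P.chan ω) ∂white4 N ≤ b ^ 2 * (stdMoment 2 * N) := by
  simpa using integral_nsq_chan_pow_le h 0

theorem integral_sum_norm_four_chan_le (h : P.Bounded b) :
    ∫ ω, ∑ i, ‖P.chan ω i‖ ^ 4 ∂white4 N ≤ N * (2 * (2 + stdMoment 4) * b ^ 4) := by
  have h1 := integral_sum_norm_four_mulVec_le P.H
  rw [← integral_white4_fst (f := fun g : Fin N → ℂ => ∑ i, ‖(P.H *ᵥ g) i‖ ^ 4)] at h1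
  refine h1.trans ?_
  have := stdMoment_nonneg 4
  have := h.H_le
  gcongr

/-- `amp` depends on the scalar noise only and the quadratic form on the channel noise only, so the
two expectations factor. -/
theorem integral_quad_term_le (h : P.Bounded b) (hd : P.d ≠ 0) :
    ∫ ω, ‖P.amp ω‖ ^ 2 * ‖quadForm (P.Hᴴ * P.Bᴴ * P.H) ω.1
        - (P.Hᴴ * P.Bᴴ * P.H).trace‖ ^ 2 ∂white4 N ≤
      (1 + P.κt) * ((1 + stdMoment 4) * (N * b ^ 6)) := by
  set M := P.Hᴴ * P.Bᴴ * P.H with hM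
  have hMn : ‖M‖ ≤ b ^ 3 := by
    have hb := h.nonneg
    calc ‖M‖ ≤ ‖P.Hᴴ * P.Bᴴ‖ * ‖P.H‖ := norm_mul_le _ _
      _ ≤ (‖P.Hᴴ‖ * ‖P.Bᴴ‖) * ‖P.H‖ := by gcongr; exact norm_mul_le _ _
      _ ≤ (b * b) * b := by
        rw [norm_conjTranspose, norm_conjTranspose]
        have := h.H_le; have := h.B_le
        gcongr
      _ = b ^ 3 := by ring
  have h1 : ∫ ω, ‖P.amp ω‖ ^ 2 * ‖quadForm M ω.1 - M.trace‖ ^ 2 ∂white4 N ≤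
      ∫ ω, (1 + P.κt) * ‖quadForm M ω.1 - M.trace‖ ^ 2 ∂white4 N := by
    refine white4_mono_scalar (by fun_prop) (by fun_prop) fun g g' e => ?_
    dsimp only
    rw [integral_mul_const, integral_const]
    simp only [probReal_univ, one_smul]
    refine mul_le_mul_of_nonneg_right (le_of_eq ?_) (by positivity)
    rw [← integral_norm_sq_amp h.κt_nonneg hd]
    exact (integral_white4_scalar (N := N) (f := fun z : ℂ => ‖P.amp (g, z, g', e)‖ ^ 2)).symm
  refine h1.trans ?_
  rw [integral_white4_fst (f := fun g => (1 + P.κt) * ‖quadForm M g - M.trace‖ ^ 2),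
    integral_const_mul]
  have hκ := h.κt_nonneg
  have := stdMoment_nonneg 4
  refine mul_le_mul_of_nonneg_left ((integral_norm_sq_quadForm_sub_trace_le M).trans ?_)
    (by positivity)
  refine mul_le_mul_of_nonneg_left ((frobSq_le M).trans ?_) (by positivity)
  calc (N : ℝ) * ‖M‖ ^ 2 ≤ N * (b ^ 3) ^ 2 := by gcongr
    _ = N * b ^ 6 := by ring

/-- Given the channel, this is a linear form in the thermal noise; the only factor `N` comes from
the mean squared norm of the channel. -/
theorem integral_noise_term_le (h : P.Bounded b) :
    ∫ ω, ‖star ((P.B * P.K) *ᵥ ω.2.2.1) ⬝ᵥ P.chan ω‖ ^ 2 ∂white4 N ≤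
      b ^ 6 * (stdMoment 2 * N) := by
  have h1 : ∫ ω, ‖star ((P.B * P.K) *ᵥ ω.2.2.1) ⬝ᵥ P.chan ω‖ ^ 2 ∂white4 N ≤
      ∫ ω, b ^ 4 * nsq (P.chan ω) ∂white4 N := by
    refine white4_mono_third (by fun_prop) (by fun_prop) fun g z e => ?_
    refine (integral_norm_sq_star_mulVec_dotProduct_le (P.B * P.K) (P.H *ᵥ g)).trans ?_
    simp only [chan, integral_const, probReal_univ, one_smul]
    refine mul_le_mul_of_nonneg_right ?_ (nsq_nonneg _)
    calc ‖P.B * P.K‖ ^ 2 ≤ (b ^ 2) ^ 2 := pow_le_pow_left₀ (norm_nonneg _) h.BK_le 2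
      _ = b ^ 4 := by ring
  refine h1.trans ?_
  rw [integral_const_mul]
  calc b ^ 4 * ∫ ω, nsq (P.chan ω) ∂white4 N ≤ b ^ 4 * (b ^ 2 * (stdMoment 2 * N)) :=
        mul_le_mul_of_nonneg_left (integral_nsq_chan_le h) (by positivity)
    _ = _ := by ring

/-- Given the channel `h`, this is the modulus of a linear form in the fourth noise, with second
moment `κr |d|² ∑ |h i|² |(Bᴴ h) i|²`. The arithmetic–geometric inequality reduces that to fourth
moments of single coordinates, each bounded independently of `N`. -/
theorem integral_dist_term_le (h : P.Bounded b) :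
    ∫ ω, ‖star (P.B *ᵥ P.dist ω) ⬝ᵥ P.chan ω‖ ^ 2 ∂white4 N ≤
      ‖P.d‖ ^ 2 * (P.κr * (N * ((2 + stdMoment 4) * (b ^ 4 + b ^ 8)))) := by
  have hb := h.nonneg
  have hκ := h.κr_nonneg
  have hm := stdMoment_nonneg 4
  set q := ‖P.d‖ ^ 2 with hq
  have hq0 : 0 ≤ q := by positivity
  have hpt (ω : Sample N) : ‖star (P.B *ᵥ P.dist ω) ⬝ᵥ P.chan ω‖ =
      ‖(fun i => ((Real.sqrt (P.κr * q) * ‖P.chan ω i‖ : ℝ) : ℂ) *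
        star ((P.Bᴴ *ᵥ P.chan ω) i)) ⬝ᵥ ω.2.2.2‖ := by
    rw [star_mulVec_dotProduct, ← norm_star, Matrix.star_dotProduct, star_star, dotProduct_comm]
    congr 1
    rw [dotProduct, dotProduct]
    refine Finset.sum_congr rfl fun i _ => ?_
    simp only [dist, ← hq, Pi.star_apply]
    ring
  have h1 : ∫ ω, ‖star (P.B *ᵥ P.dist ω) ⬝ᵥ P.chan ω‖ ^ 2 ∂white4 N ≤
      ∫ ω, (P.κr * q / 2) * (∑ i, ‖(P.H *ᵥ ω.1) i‖ ^ 4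
        + ∑ i, ‖((P.Bᴴ * P.H) *ᵥ ω.1) i‖ ^ 4) ∂white4 N := by
    refine white4_mono_fourth (by fun_prop) (by fun_prop) fun g z g' => ?_
    simp_rw [hpt]
    simp only [chan, integral_const, probReal_univ, one_smul]
    rw [integral_norm_sq_dotProduct, nsq, ← Finset.sum_add_distrib, Finset.mul_sum]
    refine Finset.sum_le_sum fun i _ => ?_
    rw [norm_mul, norm_star, Complex.norm_real, Real.norm_eq_abs, abs_of_nonneg (by positivity),
      mul_pow, mul_pow, Real.sq_sqrt (by positivity), Matrix.mulVec_mulVec]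
    have hκq : 0 ≤ P.κr * q := by positivity
    nlinarith [mul_nonneg hκq (sq_nonneg (‖(P.H *ᵥ g) i‖ ^ 2 - ‖((P.Bᴴ * P.H) *ᵥ g) i‖ ^ 2))]
  refine h1.trans ?_
  rw [integral_white4_fst (f := fun g => (P.κr * q / 2) * (∑ i, ‖(P.H *ᵥ g) i‖ ^ 4
        + ∑ i, ‖((P.Bᴴ * P.H) *ᵥ g) i‖ ^ 4)), integral_const_mul,
    integral_add (Tame.integrable (by fun_prop)) (Tame.integrable (by fun_prop))]
  have h2 := integral_sum_norm_four_mulVec_le P.H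
  have h3 := integral_sum_norm_four_mulVec_le (P.Bᴴ * P.H)
  have hBH : ‖P.Bᴴ * P.H‖ ≤ b ^ 2 := by
    rw [sq]
    refine (norm_mul_le _ _).trans (mul_le_mul ?_ h.H_le (norm_nonneg _) hb)
    rw [norm_conjTranspose]; exact h.B_le
  have h4 : ‖P.Bᴴ * P.H‖ ^ 4 ≤ b ^ 8 :=
    (pow_le_pow_left₀ (norm_nonneg _) hBH 4).trans (le_of_eq (by ring))
  have h5 : ‖P.H‖ ^ 4 ≤ b ^ 4 := pow_le_pow_left₀ (norm_nonneg _) h.H_le 4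
  have h6 : (N : ℝ) * (2 * (2 + stdMoment 4) * ‖P.H‖ ^ 4) ≤
      N * (2 * (2 + stdMoment 4) * b ^ 4) := by gcongr
  have h7 : (N : ℝ) * (2 * (2 + stdMoment 4) * ‖P.Bᴴ * P.H‖ ^ 4) ≤
      N * (2 * (2 + stdMoment 4) * b ^ 8) := by gcongr
  calc _ ≤ P.κr * q / 2 * (N * (2 * (2 + stdMoment 4) * b ^ 4)
        + N * (2 * (2 + stdMoment 4) * b ^ 8)) := by
        refine mul_le_mul_of_nonneg_left ?_ (by positivity)
        linarith
    _ = _ := by ring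

theorem nsq_dist (h : P.Bounded b) (ω : Sample N) :
    nsq (P.dist ω) = P.κr * ‖P.d‖ ^ 2 * ∑ i, ‖P.chan ω i‖ ^ 2 * ‖ω.2.2.2 i‖ ^ 2 := by
  have hκ := h.κr_nonneg
  rw [nsq, Finset.mul_sum]
  refine Finset.sum_congr rfl fun i _ => ?_
  rw [dist, norm_mul, Complex.norm_real, Real.norm_eq_abs, abs_of_nonneg (by positivity),
      mul_pow, mul_pow, Real.sq_sqrt (by positivity)]
  ring

theorem nsq_sig_le (h : P.Bounded b) (ω : Sample N) :
    nsq (P.sig ω) ≤ 2 * b ^ 2 * (‖P.pilot ω‖ ^ 2 * nsq (P.chan ω) + nsq (P.dist ω)) := by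
  have hb := h.nonneg
  have hB : ‖P.B‖ ^ 2 ≤ b ^ 2 := pow_le_pow_left₀ (norm_nonneg _) h.B_le 2
  have h1 : nsq (P.B *ᵥ P.chan ω) ≤ b ^ 2 * nsq (P.chan ω) :=
    (nsq_mulVec_le _ _).trans (mul_le_mul_of_nonneg_right hB (nsq_nonneg _))
  have h2 : nsq (P.B *ᵥ P.dist ω) ≤ b ^ 2 * nsq (P.dist ω) :=
    (nsq_mulVec_le _ _).trans (mul_le_mul_of_nonneg_right hB (nsq_nonneg _))
  have h3 := nsq_add_le (P.pilot ω • (P.B *ᵥ P.chan ω)) (P.B *ᵥ P.dist ω)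
  rw [nsq_smul] at h3
  have h4 := mul_le_mul_of_nonneg_left h1 (sq_nonneg ‖P.pilot ω‖)
  rw [sig]
  linarith

theorem pilot_norm_sq (hd : P.d ≠ 0) (ω : Sample N) :
    ‖P.pilot ω‖ ^ 2 = ‖P.d‖ ^ 2 * ‖P.amp ω‖ ^ 2 := by
  have hs : 0 < ‖P.d‖ := norm_pos_iff.2 hd
  have h2 : P.d * star (P.pilot ω) = (‖P.d‖ ^ 2 : ℝ) * P.amp ω := by
    have hq : ((‖P.d‖ ^ 2 : ℝ) : ℂ) ≠ 0 := by simpa using hd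
    rw [amp, mul_add, mul_div_cancel₀ _ hq, pilot, star_add, mul_add, mul_one]
    congr 1
    rw [← Complex.normSq_eq_norm_sq, ← Complex.mul_conj]; rfl
  have h3 := congrArg norm h2
  rw [norm_mul, norm_mul, norm_star, Complex.norm_real, Real.norm_eq_abs,
    abs_of_nonneg (by positivity)] at h3
  have h4 : ‖P.pilot ω‖ = ‖P.d‖ * ‖P.amp ω‖ := by
    apply mul_left_cancel₀ hs.ne'
    rw [h3]; ring
  rw [h4]; ring

theorem norm_pilot_four_le (h : P.Bounded b) (ω : Sample N) :
    ‖P.pilot ω‖ ^ 4 ≤ 8 * (‖P.d‖ ^ 2) ^ 2 * (1 + P.κt ^ 2 * ‖ω.2.1‖ ^ 4) := by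
  have hκ := h.κt_nonneg
  set y : ℝ := ‖(Real.sqrt (P.κt * ‖P.d‖ ^ 2) : ℂ) * ω.2.1‖ with hy
  have h1 : y ^ 4 = P.κt ^ 2 * (‖P.d‖ ^ 2) ^ 2 * ‖ω.2.1‖ ^ 4 := by
    rw [hy, norm_mul, Complex.norm_real, Real.norm_eq_abs, abs_of_nonneg (Real.sqrt_nonneg _),
      mul_pow, show (4 : ℕ) = 2 * 2 from rfl, pow_mul (Real.sqrt _), Real.sq_sqrt (by positivity)]
    ring
  have h2 : ‖P.pilot ω‖ ≤ ‖P.d‖ + y := norm_add_le _ _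
  have h3 := add_pow_le (norm_nonneg P.d) (norm_nonneg ((Real.sqrt (P.κt * ‖P.d‖ ^ 2) : ℂ) * ω.2.1)) 4
  rw [← hy] at h3
  have h4 := pow_le_pow_left₀ (norm_nonneg _) h2 4
  norm_num at h3
  nlinarith

/-- The fourth noise is averaged out first, with `𝔼|e i|² = 1`, then the scalar one, with `𝔼|amp|² =
1 + κt`. The weight `nsq (P.chan ω)` is there because `norm_gain_le` controls the gain by the norm
of the channel, and that factor multiplies the error made in the norm of the estimate. -/
theorem integral_nsq_chan_mul_nsq_sig_le (h : P.Bounded b) (hd : P.d ≠ 0) :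
    ∫ ω, nsq (P.chan ω) * nsq (P.sig ω) ∂white4 N ≤
      ‖P.d‖ ^ 2 * (2 * b ^ 6 * (1 + P.κt + P.κr) * stdMoment 4 * (N : ℝ) ^ 2) := by
  have hb := h.nonneg
  have hκr := h.κr_nonneg
  have hκt := h.κt_nonneg
  set q := ‖P.d‖ ^ 2 with hq
  have hq0 : 0 ≤ q := by positivity
  have h1 : ∫ ω, nsq (P.chan ω) * nsq (P.sig ω) ∂white4 N ≤
      ∫ ω, 2 * b ^ 2 * q * (‖P.amp ω‖ ^ 2 * nsq (P.chan ω) ^ 2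
        + P.κr * (nsq (P.chan ω) * ∑ i, ‖P.chan ω i‖ ^ 2 * ‖ω.2.2.2 i‖ ^ 2)) ∂white4 N := by
    refine white4_mono (by fun_prop) (by fun_prop) fun ω => ?_
    have h2 := mul_le_mul_of_nonneg_left (nsq_sig_le h ω) (nsq_nonneg (P.chan ω))
    rw [nsq_dist h, pilot_norm_sq hd, ← hq] at h2
    refine h2.trans (le_of_eq ?_)
    ring
  have h2 : ∫ ω, 2 * b ^ 2 * q * (‖P.amp ω‖ ^ 2 * nsq (P.chan ω) ^ 2
        + P.κr * (nsq (P.chan ω) * ∑ i, ‖P.chan ω i‖ ^ 2 * ‖ω.2.2.2 i‖ ^ 2)) ∂white4 N ≤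
      ∫ ω, 2 * b ^ 2 * q * (‖P.amp ω‖ ^ 2 * nsq (P.chan ω) ^ 2
        + P.κr * nsq (P.chan ω) ^ 2) ∂white4 N := by
    refine white4_mono_fourth (by fun_prop) (by fun_prop) fun g z g' => ?_
    simp only [chan, amp]
    rw [integral_const_mul, integral_const_mul,
      integral_add (Tame.integrable (by fun_prop)) (Tame.integrable (by fun_prop)),
      integral_add (Tame.integrable (by fun_prop)) (Tame.integrable (by fun_prop)),
      integral_const_mul, integral_const_mul P.κr, integral_const_mul (nsq (P.H *ᵥ g)),
      integral_finsetSum _ fun p _ => Tame.integrable (by fun_prop)]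
    simp_rw [integral_const_mul,
      integral_whiteCN_eval_real (f := fun z => ‖z‖ ^ 2) (by fun_prop), integral_stdCN_norm_sq]
    simp only [integral_const, probReal_univ, one_smul, mul_one]
    rw [← nsq, ← sq]
  have h3 : ∫ ω, 2 * b ^ 2 * q * (‖P.amp ω‖ ^ 2 * nsq (P.chan ω) ^ 2
        + P.κr * nsq (P.chan ω) ^ 2) ∂white4 N ≤
      ∫ ω, 2 * b ^ 2 * q * (1 + P.κt + P.κr) * nsq (P.chan ω) ^ 2 ∂white4 N := by
    refine white4_mono_scalar (by fun_prop) (by fun_prop) fun g g' e => ?_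
    have ha : ∫ z, ‖P.amp (g, z, g', e)‖ ^ 2 ∂stdCN = 1 + P.κt := by
      rw [← integral_norm_sq_amp hκt hd]
      exact (integral_white4_scalar (N := N) (f := fun z : ℂ => ‖P.amp (g, z, g', e)‖ ^ 2)).symm
    simp only [chan]
    rw [integral_const_mul,
      integral_add (Tame.integrable (by fun_prop)) (Tame.integrable (by fun_prop)),
      integral_mul_const, ha]
    simp only [integral_const, probReal_univ, one_smul]
    apply le_of_eq; ring
  refine (h1.trans (h2.trans h3)).trans ?_
  rw [integral_const_mul]
  have h4 := integral_nsq_chan_pow_le h 1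
  norm_num at h4
  calc _ ≤ 2 * b ^ 2 * q * (1 + P.κt + P.κr) * ((b ^ 2) ^ 2 * (stdMoment 4 * (N : ℝ) ^ 2)) :=
        mul_le_mul_of_nonneg_left h4 (by positivity)
    _ = _ := by ring

/-- Same successive averaging as for the first power, now with fourth moments. The order `q² N³` of
the bound produces the contribution `q` to the final error. -/
theorem integral_nsq_chan_mul_nsq_sig_sq_le (h : P.Bounded b) :
    ∫ ω, nsq (P.chan ω) * nsq (P.sig ω) ^ 2 ∂white4 N ≤
      (‖P.d‖ ^ 2) ^ 2 * (8 * b ^ 10 * (8 * (1 + P.κt ^ 2 * stdMoment 4) + P.κr ^ 2 * stdMoment 4)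
        * (stdMoment 6 * (N : ℝ) ^ 3)) := by
  have hb := h.nonneg
  have hκr := h.κr_nonneg
  have hκt := h.κt_nonneg
  have hm := stdMoment_nonneg 4
  set q := ‖P.d‖ ^ 2 with hq
  have hq0 : 0 ≤ q := by positivity
  have h1 : ∫ ω, nsq (P.chan ω) * nsq (P.sig ω) ^ 2 ∂white4 N ≤
      ∫ ω, 8 * b ^ 4 * q ^ 2 * (8 * (1 + P.κt ^ 2 * ‖ω.2.1‖ ^ 4) * nsq (P.chan ω) ^ 3
        + P.κr ^ 2 * (nsq (P.chan ω) ^ 2 * ∑ i, ‖P.chan ω i‖ ^ 2 * ‖ω.2.2.2 i‖ ^ 4))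
        ∂white4 N := by
    refine white4_mono (by fun_prop) (by fun_prop) fun ω => ?_
    set n := nsq (P.chan ω) with hn
    have hn0 : 0 ≤ n := nsq_nonneg _
    have h2 := pow_le_pow_left₀ (nsq_nonneg _) (nsq_sig_le h ω) 2
    have h3 : nsq (P.dist ω) ^ 2 ≤
        P.κr ^ 2 * q ^ 2 * (n * ∑ i, ‖P.chan ω i‖ ^ 2 * ‖ω.2.2.2 i‖ ^ 4) := by
      rw [nsq_dist h, ← hq, mul_pow, mul_pow]
      refine mul_le_mul_of_nonneg_left ?_ (by positivity)
      -- Cauchy–Schwarz with weights `|h i|²`: the square of the sum is replaced by a sum in which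
      -- each `e i` appears alone, to the fourth power, and can be averaged termwise.
      have := Finset.sum_mul_sq_le_sq_mul_sq Finset.univ (fun i => ‖P.chan ω i‖)
        (fun i => ‖P.chan ω i‖ * ‖ω.2.2.2 i‖ ^ 2)
      refine (le_of_eq ?_).trans (this.trans (le_of_eq ?_))
      · congr 1
        exact Finset.sum_congr rfl fun i _ => by ring
      · rw [hn, nsq]
        congr 1
        exact Finset.sum_congr rfl fun i _ => by ring
    have h4 := mul_le_mul_of_nonneg_right (norm_pilot_four_le h ω) (pow_nonneg hn0 2)
    rw [← hq] at h4
    rw [← hn] at h2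
    have h5 : (2 * b ^ 2 * (‖P.pilot ω‖ ^ 2 * n + nsq (P.dist ω))) ^ 2 ≤
        8 * b ^ 4 * (‖P.pilot ω‖ ^ 4 * n ^ 2 + nsq (P.dist ω) ^ 2) := by
      have hb4 : 0 ≤ b ^ 4 := by positivity
      nlinarith [mul_nonneg hb4 (sq_nonneg (‖P.pilot ω‖ ^ 2 * n - nsq (P.dist ω)))]
    calc n * nsq (P.sig ω) ^ 2
        ≤ n * (8 * b ^ 4 * (‖P.pilot ω‖ ^ 4 * n ^ 2 + nsq (P.dist ω) ^ 2)) :=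
          mul_le_mul_of_nonneg_left (h2.trans h5) hn0
      _ ≤ n * (8 * b ^ 4 * (8 * q ^ 2 * (1 + P.κt ^ 2 * ‖ω.2.1‖ ^ 4) * n ^ 2 +
          P.κr ^ 2 * q ^ 2 * (n * ∑ i, ‖P.chan ω i‖ ^ 2 * ‖ω.2.2.2 i‖ ^ 4))) := by gcongr
      _ = _ := by ring
  have h2 : ∫ ω, 8 * b ^ 4 * q ^ 2 * (8 * (1 + P.κt ^ 2 * ‖ω.2.1‖ ^ 4) * nsq (P.chan ω) ^ 3
        + P.κr ^ 2 * (nsq (P.chan ω) ^ 2 * ∑ i, ‖P.chan ω i‖ ^ 2 * ‖ω.2.2.2 i‖ ^ 4))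
        ∂white4 N ≤
      ∫ ω, 8 * b ^ 4 * q ^ 2 * (8 * (1 + P.κt ^ 2 * ‖ω.2.1‖ ^ 4) * nsq (P.chan ω) ^ 3
        + P.κr ^ 2 * (nsq (P.chan ω) ^ 3 * stdMoment 4)) ∂white4 N := by
    refine white4_mono_fourth (by fun_prop) (by fun_prop) fun g z g' => ?_
    simp only [chan]
    rw [integral_const_mul, integral_const_mul,
      integral_add (Tame.integrable (by fun_prop)) (Tame.integrable (by fun_prop)),
      integral_add (Tame.integrable (by fun_prop)) (Tame.integrable (by fun_prop)),
      integral_const_mul, integral_const_mul (P.κr ^ 2), integral_const_mul (nsq (P.H *ᵥ g) ^ 2),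
      integral_finsetSum _ fun p _ => Tame.integrable (by fun_prop)]
    simp_rw [integral_const_mul,
      integral_whiteCN_eval_real (f := fun z => ‖z‖ ^ 4) (by fun_prop)]
    simp only [integral_const, probReal_univ, one_smul]
    rw [← stdMoment, ← Finset.sum_mul, ← nsq]
    apply le_of_eq; ring
  have h3 : ∫ ω, 8 * b ^ 4 * q ^ 2 * (8 * (1 + P.κt ^ 2 * ‖ω.2.1‖ ^ 4) * nsq (P.chan ω) ^ 3
        + P.κr ^ 2 * (nsq (P.chan ω) ^ 3 * stdMoment 4)) ∂white4 N ≤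
      ∫ ω, 8 * b ^ 4 * q ^ 2 * (8 * (1 + P.κt ^ 2 * stdMoment 4) + P.κr ^ 2 * stdMoment 4)
        * nsq (P.chan ω) ^ 3 ∂white4 N := by
    refine white4_mono_scalar (by fun_prop) (by fun_prop) fun g g' e => ?_
    simp only [chan]
    rw [integral_const_mul,
      integral_add (Tame.integrable (by fun_prop)) (Tame.integrable (by fun_prop)),
      integral_mul_const, integral_const_mul,
      integral_add (Tame.integrable (by fun_prop)) (Tame.integrable (by fun_prop)),
      integral_const_mul, ← stdMoment]
    simp only [integral_const, probReal_univ, one_smul]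
    apply le_of_eq; ring
  refine (h1.trans (h2.trans h3)).trans ?_
  rw [integral_const_mul]
  have h4 := integral_nsq_chan_pow_le h 2
  norm_num at h4
  calc _ ≤ 8 * b ^ 4 * q ^ 2 * (8 * (1 + P.κt ^ 2 * stdMoment 4) + P.κr ^ 2 * stdMoment 4)
        * ((b ^ 2) ^ 3 * (stdMoment 6 * (N : ℝ) ^ 3)) :=
        mul_le_mul_of_nonneg_left h4 (by positivity)
    _ = _ := by ring

end WhiteUplink

end

/-! ### Mean square convergence of the normalized gain -/

section

namespace WhiteUplink

variable {N : ℕ} {P : WhiteUplink N} {b c T : ℝ}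

/-- The traces that govern the gain and the power of the estimate, the latter up to a relative
error of the order of the pilot power. -/
structure Calibrated (P : WhiteUplink N) (T c : ℝ) : Prop where
  trace_gain : (P.Hᴴ * P.Bᴴ * P.H).trace = T
  trace_noise : |((P.B * P.K)ᴴ * (P.B * P.K)).trace.re - T| ≤ ‖P.d‖ ^ 2 * (c * N)

/-- Expanding `‖ν + x‖²` with `ν` the filtered thermal noise and `x` the rest, the deviation from
`T` is a sum of four terms: fluctuation of the noise power, cross term, power of `x`, and the defect
allowed by `Calibrated`. -/
theorem sq_nsq_est_sub_le (hT : P.Calibrated T c) (ω : Sample N) :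
    (nsq (P.est ω) - T) ^ 2 ≤
      4 * (‖quadForm ((P.B * P.K)ᴴ * (P.B * P.K)) ω.2.2.1
          - ((P.B * P.K)ᴴ * (P.B * P.K)).trace‖ ^ 2
        + 4 * ‖star ((P.B * P.K) *ᵥ ω.2.2.1) ⬝ᵥ P.sig ω‖ ^ 2 + nsq (P.sig ω) ^ 2
        + (‖P.d‖ ^ 2 * (c * N)) ^ 2) := by
  set M := P.B * P.K with hM
  set ν := M *ᵥ ω.2.2.1 with hν
  set x := P.sig ω with hx
  have h0 : nsq (P.est ω) = nsq ν + nsq x + 2 * (star ν ⬝ᵥ x).re := by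
    rw [est, add_comm, nsq_add]
  have h1 : (nsq ν - (Mᴴ * M).trace.re) ^ 2 ≤ ‖quadForm (Mᴴ * M) ω.2.2.1 - (Mᴴ * M).trace‖ ^ 2 := by
    have := Complex.abs_re_le_norm (quadForm (Mᴴ * M) ω.2.2.1 - (Mᴴ * M).trace)
    rw [quadForm_gram, Complex.sub_re, Complex.ofReal_re, ← hν] at this
    rw [quadForm_gram, ← hν, ← sq_abs (nsq ν - _)]
    exact pow_le_pow_left₀ (abs_nonneg _) this 2
  have h2 : (star ν ⬝ᵥ x).re ^ 2 ≤ ‖star ν ⬝ᵥ x‖ ^ 2 := by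
    rw [← sq_abs]
    exact pow_le_pow_left₀ (abs_nonneg _) (Complex.abs_re_le_norm _) 2
  have h3 : ((Mᴴ * M).trace.re - T) ^ 2 ≤ (‖P.d‖ ^ 2 * (c * N)) ^ 2 := by
    rw [← sq_abs]
    exact pow_le_pow_left₀ (abs_nonneg _) hT.trace_noise 2
  rw [h0]
  generalize nsq ν = a₁ at *
  generalize (Mᴴ * M).trace.re = t at *
  generalize (star ν ⬝ᵥ x).re = r at *
  generalize nsq x = a₂ at *
  have h4 : (a₁ + a₂ + 2 * r - T) ^ 2 ≤
      4 * ((a₁ - t) ^ 2 + 4 * r ^ 2 + a₂ ^ 2 + (t - T) ^ 2) := by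
    nlinarith [sq_nonneg (a₁ - t - 2 * r), sq_nonneg (a₁ - t - a₂), sq_nonneg (a₁ - t - (t - T)),
      sq_nonneg (2 * r - a₂), sq_nonneg (2 * r - (t - T)), sq_nonneg (a₂ - (t - T))]
  linarith

theorem integral_nsq_chan_mul_quad_le (h : P.Bounded b) :
    ∫ ω, nsq (P.chan ω) * ‖quadForm ((P.B * P.K)ᴴ * (P.B * P.K)) ω.2.2.1
          - ((P.B * P.K)ᴴ * (P.B * P.K)).trace‖ ^ 2 ∂white4 N ≤
      b ^ 10 * ((1 + stdMoment 4) * stdMoment 2 * (N : ℝ) ^ 2) := by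
  set M := (P.B * P.K)ᴴ * (P.B * P.K) with hM
  have hb := h.nonneg
  have hm := stdMoment_nonneg 4
  have hMn : ‖M‖ ≤ b ^ 4 := by
    calc ‖M‖ ≤ ‖(P.B * P.K)ᴴ‖ * ‖P.B * P.K‖ := norm_mul_le _ _
      _ ≤ b ^ 2 * b ^ 2 := by
        rw [norm_conjTranspose]
        exact mul_le_mul h.BK_le h.BK_le (norm_nonneg _) (by positivity)
      _ = b ^ 4 := by ring
  have hv : ∫ g, ‖quadForm M g - M.trace‖ ^ 2 ∂whiteCN N ≤ (1 + stdMoment 4) * (N * b ^ 8) := by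
    refine (integral_norm_sq_quadForm_sub_trace_le M).trans ?_
    refine mul_le_mul_of_nonneg_left ((frobSq_le M).trans ?_) (by positivity)
    calc (N : ℝ) * ‖M‖ ^ 2 ≤ N * (b ^ 4) ^ 2 := by gcongr
      _ = N * b ^ 8 := by ring
  have h1 : ∫ ω, nsq (P.chan ω) * ‖quadForm M ω.2.2.1 - M.trace‖ ^ 2 ∂white4 N ≤
      ∫ ω, nsq (P.chan ω) * ((1 + stdMoment 4) * (N * b ^ 8)) ∂white4 N := by
    refine white4_mono_third (by fun_prop) (by fun_prop) fun g z e => ?_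
    simp only [chan]
    rw [integral_const_mul]
    simp only [integral_const, probReal_univ, one_smul]
    exact mul_le_mul_of_nonneg_left hv (nsq_nonneg _)
  refine h1.trans ?_
  rw [integral_mul_const]
  calc _ ≤ b ^ 2 * (stdMoment 2 * N) * ((1 + stdMoment 4) * (N * b ^ 8)) :=
        mul_le_mul_of_nonneg_right (integral_nsq_chan_le h) (by positivity)
    _ = _ := by ring

theorem integral_nsq_chan_mul_cross_le (h : P.Bounded b) (hd : P.d ≠ 0) :
    ∫ ω, nsq (P.chan ω) * ‖star ((P.B * P.K) *ᵥ ω.2.2.1) ⬝ᵥ P.sig ω‖ ^ 2 ∂white4 N ≤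
      ‖P.d‖ ^ 2 * (2 * b ^ 10 * (1 + P.κt + P.κr) * stdMoment 4 * (N : ℝ) ^ 2) := by
  have h1 : ∫ ω, nsq (P.chan ω) * ‖star ((P.B * P.K) *ᵥ ω.2.2.1) ⬝ᵥ P.sig ω‖ ^ 2 ∂white4 N ≤
      ∫ ω, b ^ 4 * (nsq (P.chan ω) * nsq (P.sig ω)) ∂white4 N := by
    refine white4_mono_third (by fun_prop) (by fun_prop) fun g z e => ?_
    -- `sig` does not depend on the thermal noise, so any value, here `0`, can stand in the third
    -- slot.
    have h2 := integral_norm_sq_star_mulVec_dotProduct_le (P.B * P.K) (P.sig (g, z, 0, e))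
    have h3 : ‖P.B * P.K‖ ^ 2 ≤ b ^ 4 := by
      calc ‖P.B * P.K‖ ^ 2 ≤ (b ^ 2) ^ 2 := pow_le_pow_left₀ (norm_nonneg _) h.BK_le 2
        _ = b ^ 4 := by ring
    have h4 := mul_le_mul_of_nonneg_left
      (h2.trans (mul_le_mul_of_nonneg_right h3 (nsq_nonneg _))) (nsq_nonneg (P.H *ᵥ g))
    rw [← integral_const_mul] at h4
    change _ ≤ ∫ _, b ^ 4 * (nsq (P.H *ᵥ g) * nsq (P.sig (g, z, 0, e))) ∂whiteCN N
    rw [integral_const, probReal_univ, one_smul]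
    exact h4.trans (le_of_eq (by ring))
  refine h1.trans ?_
  rw [integral_const_mul]
  calc _ ≤ b ^ 4 * (‖P.d‖ ^ 2 * (2 * b ^ 6 * (1 + P.κt + P.κr) * stdMoment 4 * (N : ℝ) ^ 2)) :=
        mul_le_mul_of_nonneg_left (integral_nsq_chan_mul_nsq_sig_le h hd) (by positivity)
    _ = _ := by ring

theorem integral_nsq_chan_mul_sq_nsq_est_sub_le (h : P.Bounded b) (hd : P.d ≠ 0)
    (hT : P.Calibrated T c) :
    ∫ ω, nsq (P.chan ω) * (nsq (P.est ω) - T) ^ 2 ∂white4 N ≤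
      4 * (b ^ 10 * ((1 + stdMoment 4) * stdMoment 2 * (N : ℝ) ^ 2)
        + 4 * (‖P.d‖ ^ 2 * (2 * b ^ 10 * (1 + P.κt + P.κr) * stdMoment 4 * (N : ℝ) ^ 2))
        + (‖P.d‖ ^ 2) ^ 2 * (8 * b ^ 10 * (8 * (1 + P.κt ^ 2 * stdMoment 4)
            + P.κr ^ 2 * stdMoment 4) * (stdMoment 6 * (N : ℝ) ^ 3))
        + (‖P.d‖ ^ 2 * (c * N)) ^ 2 * (b ^ 2 * (stdMoment 2 * N))) := by
  have h1 : ∫ ω, nsq (P.chan ω) * (nsq (P.est ω) - T) ^ 2 ∂white4 N ≤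
      ∫ ω, 4 * (nsq (P.chan ω) * ‖quadForm ((P.B * P.K)ᴴ * (P.B * P.K)) ω.2.2.1
          - ((P.B * P.K)ᴴ * (P.B * P.K)).trace‖ ^ 2
        + 4 * (nsq (P.chan ω) * ‖star ((P.B * P.K) *ᵥ ω.2.2.1) ⬝ᵥ P.sig ω‖ ^ 2)
        + nsq (P.chan ω) * nsq (P.sig ω) ^ 2
        + (‖P.d‖ ^ 2 * (c * N)) ^ 2 * nsq (P.chan ω)) ∂white4 N := by
    refine white4_mono (by fun_prop) (by fun_prop) fun ω => ?_
    refine (mul_le_mul_of_nonneg_left (sq_nsq_est_sub_le hT ω) (nsq_nonneg _)).trans (le_of_eq ?_)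
    ring
  refine h1.trans ?_
  rw [integral_const_mul,
    integral_add (Tame.integrable (by fun_prop)) (Tame.integrable (by fun_prop)),
    integral_add (Tame.integrable (by fun_prop)) (Tame.integrable (by fun_prop)),
    integral_add (Tame.integrable (by fun_prop)) (Tame.integrable (by fun_prop)),
    integral_const_mul 4, integral_const_mul]
  have a1 := integral_nsq_chan_mul_quad_le h
  have a2 := integral_nsq_chan_mul_cross_le h hd
  have a3 := integral_nsq_chan_mul_nsq_sig_sq_le h
  have a4 := mul_le_mul_of_nonneg_left (integral_nsq_chan_le h)
    (sq_nonneg (‖P.d‖ ^ 2 * (c * N)))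
  linarith

/-- The gain in units of its typical size. -/
def normalizedGain (P : WhiteUplink N) (T : ℝ) (ω : Sample N) : ℂ :=
  P.gain ω / (‖P.d‖ * Real.sqrt T : ℝ)

/-- The gain with the norm of the estimate replaced by its typical size. -/
def linearGain (P : WhiteUplink N) (T : ℝ) (ω : Sample N) : ℂ :=
  P.d * (star (P.est ω) ⬝ᵥ P.chan ω) / (‖P.d‖ ^ 2 * T : ℝ)

@[fun_prop]
theorem tame_normalizedGain (P : WhiteUplink N) (T : ℝ) : Tame (P.normalizedGain T) := by
  unfold normalizedGain; simp only [div_eq_mul_inv]; fun_prop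

@[fun_prop]
theorem tame_linearGain (P : WhiteUplink N) (T : ℝ) : Tame (P.linearGain T) := by
  unfold linearGain; simp only [div_eq_mul_inv]; fun_prop

theorem linearGain_eq (hd : P.d ≠ 0) (hT : 0 < T) (ω : Sample N) :
    P.linearGain T ω = P.normalizedGain T ω * (l2norm (P.est ω) / Real.sqrt T : ℝ) := by
  have hs : (‖P.d‖ : ℂ) ≠ 0 := by simpa using hd
  have hr : (Real.sqrt T : ℂ) ≠ 0 := by simpa using (Real.sqrt_pos.2 hT).ne'
  have hTT : ((T : ℝ) : ℂ) = (Real.sqrt T : ℂ) ^ 2 := by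
    rw [← Complex.ofReal_pow, Real.sq_sqrt hT.le]
  by_cases hn : l2norm (P.est ω) = 0
  · rw [linearGain, hn, l2norm_eq_zero.1 hn]
    simp
  · have hn' : (l2norm (P.est ω) : ℂ) ≠ 0 := by simpa using hn
    rw [linearGain, normalizedGain, gain]
    push_cast
    rw [hTT]
    field_simp

/-- With `y = ‖est‖ / √T` the difference is the normalized gain times `1 - y`, and `|1 - y| ≤ |1 -
y²|` because `1 + y ≥ 1`. So closeness of `‖est‖²` to `T` in mean square suffices, and no lower
bound on the norm of the estimate is required. -/
theorem norm_sq_normalizedGain_sub_linearGain_le (hd : P.d ≠ 0) (hT : 0 < T) (ω : Sample N) :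
    ‖P.normalizedGain T ω - P.linearGain T ω‖ ^ 2 ≤
      (1 / (‖P.d‖ ^ 2 * T ^ 3)) * (nsq (P.chan ω) * (nsq (P.est ω) - T) ^ 2) := by
  have hs : 0 < ‖P.d‖ := norm_pos_iff.2 hd
  have hr : 0 < Real.sqrt T := Real.sqrt_pos.2 hT
  set y := l2norm (P.est ω) / Real.sqrt T with hy
  have hy0 : 0 ≤ y := div_nonneg (l2norm_nonneg _) hr.le
  have h1 : P.normalizedGain T ω - P.linearGain T ω = P.normalizedGain T ω * ((1 - y : ℝ) : ℂ) := by
    rw [linearGain_eq hd hT, ← hy]; push_cast; ring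
  have h2 : ‖P.normalizedGain T ω‖ ^ 2 ≤ nsq (P.chan ω) / (‖P.d‖ ^ 2 * T) := by
    rw [normalizedGain, norm_div, Complex.norm_real, Real.norm_eq_abs,
      abs_of_nonneg (by positivity), div_pow, mul_pow, Real.sq_sqrt hT.le, ← l2norm_sq]
    gcongr
    exact P.norm_gain_le ω
  have h3 : (1 - y) ^ 2 ≤ (nsq (P.est ω) - T) ^ 2 / T ^ 2 := by
    have hy2 : y ^ 2 = nsq (P.est ω) / T := by
      rw [hy, div_pow, l2norm_sq, Real.sq_sqrt hT.le]
    have : (nsq (P.est ω) - T) ^ 2 / T ^ 2 = (y ^ 2 - 1) ^ 2 := by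
      rw [hy2]; field_simp
    rw [this, show (y ^ 2 - 1) ^ 2 = (1 - y) ^ 2 * (1 + y) ^ 2 by ring]
    exact le_mul_of_one_le_right (sq_nonneg _) (one_le_pow₀ (by linarith))
  rw [h1, norm_mul, Complex.norm_real, mul_pow, Real.norm_eq_abs, sq_abs]
  calc ‖P.normalizedGain T ω‖ ^ 2 * (1 - y) ^ 2
      ≤ nsq (P.chan ω) / (‖P.d‖ ^ 2 * T) * ((nsq (P.est ω) - T) ^ 2 / T ^ 2) := by
        gcongr
        exact div_nonneg (nsq_nonneg _) (by positivity)
    _ = _ := by field_simp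

/-- Here the denominator is deterministic, so the decomposition `star_est_dotProduct` divides term
by term, and `trace_gain` says that subtracting `amp` exactly centres the quadratic form. -/
theorem norm_sq_linearGain_sub_amp_le (hd : P.d ≠ 0) (hT : 0 < T) (hc : P.Calibrated T c)
    (ω : Sample N) :
    ‖P.linearGain T ω - P.amp ω‖ ^ 2 ≤
      3 * (1 / T ^ 2 * (‖P.amp ω‖ ^ 2 * ‖quadForm (P.Hᴴ * P.Bᴴ * P.H) ω.1
          - (P.Hᴴ * P.Bᴴ * P.H).trace‖ ^ 2)
        + 1 / (‖P.d‖ ^ 2 * T ^ 2) * ‖star (P.B *ᵥ P.dist ω) ⬝ᵥ P.chan ω‖ ^ 2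
        + 1 / (‖P.d‖ ^ 2 * T ^ 2)
          * ‖star ((P.B * P.K) *ᵥ ω.2.2.1) ⬝ᵥ P.chan ω‖ ^ 2) := by
  have hs : 0 < ‖P.d‖ := norm_pos_iff.2 hd
  set Q := quadForm (P.Hᴴ * P.Bᴴ * P.H) ω.1
  set y₁ := star (P.B *ᵥ P.dist ω) ⬝ᵥ P.chan ω
  set y₂ := star ((P.B * P.K) *ᵥ ω.2.2.1) ⬝ᵥ P.chan ω
  have hT' : ((T : ℝ) : ℂ) ≠ 0 := by simpa using hT.ne'
  have hs' : (‖P.d‖ : ℂ) ≠ 0 := by simpa using hd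
  have h1 : P.linearGain T ω - P.amp ω =
      P.amp ω * (Q - (P.Hᴴ * P.Bᴴ * P.H).trace) / T
        + P.d * y₁ / (‖P.d‖ ^ 2 * T) + P.d * y₂ / (‖P.d‖ ^ 2 * T) := by
    rw [linearGain, P.star_est_dotProduct ω hd, hc.trace_gain]
    push_cast
    field_simp
    ring
  have hn1 : ‖P.amp ω * (Q - (P.Hᴴ * P.Bᴴ * P.H).trace) / T‖ ^ 2 =
      1 / T ^ 2 * (‖P.amp ω‖ ^ 2 * ‖Q - (P.Hᴴ * P.Bᴴ * P.H).trace‖ ^ 2) := by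
    rw [norm_div, norm_mul, Complex.norm_real, Real.norm_eq_abs, abs_of_pos hT]
    field_simp
  have hn2 (y : ℂ) : ‖P.d * y / (‖P.d‖ ^ 2 * T)‖ ^ 2 = 1 / (‖P.d‖ ^ 2 * T ^ 2) * ‖y‖ ^ 2 := by
    rw [norm_div, norm_mul, norm_mul, norm_pow, Complex.norm_real, Complex.norm_real,
      Real.norm_eq_abs, Real.norm_eq_abs, abs_of_pos hT, abs_of_pos hs]
    field_simp
  rw [h1, ← hn1, ← hn2, ← hn2]
  generalize P.amp ω * (Q - (P.Hᴴ * P.Bᴴ * P.H).trace) / T = w₁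
  generalize P.d * y₁ / (‖P.d‖ ^ 2 * T) = w₂
  generalize P.d * y₂ / (‖P.d‖ ^ 2 * T) = w₃
  have h3 : ‖w₁ + w₂ + w₃‖ ^ 2 ≤ (‖w₁‖ + ‖w₂‖ + ‖w₃‖) ^ 2 :=
    pow_le_pow_left₀ (norm_nonneg _) (norm_add₃_le) 2
  nlinarith [sq_nonneg (‖w₁‖ - ‖w₂‖), sq_nonneg (‖w₁‖ - ‖w₃‖), sq_nonneg (‖w₂‖ - ‖w₃‖)]

theorem integral_norm_sq_linearGain_sub_amp_le (h : P.Bounded b) (hd : P.d ≠ 0) (hT : 0 < T)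
    (hc : P.Calibrated T c) :
    ∫ ω, ‖P.linearGain T ω - P.amp ω‖ ^ 2 ∂white4 N ≤
      3 * (1 / T ^ 2 * ((1 + P.κt) * ((1 + stdMoment 4) * (N * b ^ 6)))
        + 1 / (‖P.d‖ ^ 2 * T ^ 2)
          * (‖P.d‖ ^ 2 * (P.κr * (N * ((2 + stdMoment 4) * (b ^ 4 + b ^ 8)))))
        + 1 / (‖P.d‖ ^ 2 * T ^ 2) * (b ^ 6 * (stdMoment 2 * N))) := by
  refine (white4_mono (by fun_prop) (by fun_prop)
    (norm_sq_linearGain_sub_amp_le hd hT hc)).trans ?_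
  rw [integral_const_mul,
    integral_add (Tame.integrable (by fun_prop)) (Tame.integrable (by fun_prop)),
    integral_add (Tame.integrable (by fun_prop)) (Tame.integrable (by fun_prop)),
    integral_const_mul (1 / T ^ 2), integral_const_mul, integral_const_mul]
  have a1 := mul_le_mul_of_nonneg_left (integral_quad_term_le h hd)
    (by positivity : 0 ≤ 1 / T ^ 2)
  have a2 := mul_le_mul_of_nonneg_left (integral_dist_term_le h)
    (by positivity : 0 ≤ 1 / (‖P.d‖ ^ 2 * T ^ 2))
  have a3 := mul_le_mul_of_nonneg_left (integral_noise_term_le h)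
    (by positivity : 0 ≤ 1 / (‖P.d‖ ^ 2 * T ^ 2))
  linarith

theorem integral_norm_sq_normalizedGain_sub_linearGain_le (h : P.Bounded b) (hd : P.d ≠ 0)
    (hT : 0 < T) (hc : P.Calibrated T c) :
    ∫ ω, ‖P.normalizedGain T ω - P.linearGain T ω‖ ^ 2 ∂white4 N ≤
      1 / (‖P.d‖ ^ 2 * T ^ 3) * (4 * (b ^ 10 * ((1 + stdMoment 4) * stdMoment 2 * (N : ℝ) ^ 2)
        + 4 * (‖P.d‖ ^ 2 * (2 * b ^ 10 * (1 + P.κt + P.κr) * stdMoment 4 * (N : ℝ) ^ 2))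
        + (‖P.d‖ ^ 2) ^ 2 * (8 * b ^ 10 * (8 * (1 + P.κt ^ 2 * stdMoment 4)
            + P.κr ^ 2 * stdMoment 4) * (stdMoment 6 * (N : ℝ) ^ 3))
        + (‖P.d‖ ^ 2 * (c * N)) ^ 2 * (b ^ 2 * (stdMoment 2 * N)))) := by
  refine (white4_mono (by fun_prop) (by fun_prop)
    (norm_sq_normalizedGain_sub_linearGain_le hd hT)).trans ?_
  rw [integral_const_mul]
  exact mul_le_mul_of_nonneg_left (integral_nsq_chan_mul_sq_nsq_est_sub_le h hd hc)
    (by positivity)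

/-- The mean square distance of the normalized gain from its limit is of the order
`1 / N + 1 / (q N) + q`, where `q` is the pilot power. -/
theorem exists_integral_norm_sq_normalizedGain_sub_amp_le (b c τ κt κr : ℝ) (hτ : 0 < τ) :
    ∃ C : ℝ, ∀ (N : ℕ) (P : WhiteUplink N) (T : ℝ), 1 ≤ N → P.Bounded b → P.Calibrated T c →
      P.d ≠ 0 → P.κt = κt → P.κr = κr → τ * N ≤ T →
      ∫ ω, ‖P.normalizedGain T ω - P.amp ω‖ ^ 2 ∂white4 N ≤
        C * (1 / N + 1 / (‖P.d‖ ^ 2 * N) + ‖P.d‖ ^ 2) := by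
  set m₂ := stdMoment 2
  set m₄ := stdMoment 4
  set m₆ := stdMoment 6
  -- `D₁` and `D₂` are the constants of the linearized error at orders `1/N` and `1/(qN)`; `D₃`,
  -- `D₄`, `D₅` are those of the norm replacement at orders `1/(qN)`, `1/N` and `q`. The powers of
  -- `τ` come from `T ≥ τ N`.
  let D₁ := (1 + κt) * ((1 + m₄) * b ^ 6) + κr * ((2 + m₄) * (b ^ 4 + b ^ 8))
  let D₂ := b ^ 6 * m₂
  let D₃ := 4 * (b ^ 10 * ((1 + m₄) * m₂))
  let D₄ := 16 * (2 * b ^ 10 * (1 + κt + κr) * m₄)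
  let D₅ := 4 * (8 * b ^ 10 * (8 * (1 + κt ^ 2 * m₄) + κr ^ 2 * m₄) * m₆ + c ^ 2 * (b ^ 2 * m₂))
  refine ⟨6 * (D₁ + D₂) / τ ^ 2 + 2 * (D₃ + D₄ + D₅) / τ ^ 3, ?_⟩
  rintro N P T hN h hc hd rfl rfl hT
  have hb := h.nonneg
  have hκt := h.κt_nonneg
  have hκr := h.κr_nonneg
  have hm₂ : 0 ≤ m₂ := stdMoment_nonneg 2
  have hm₄ : 0 ≤ m₄ := stdMoment_nonneg 4
  have hm₆ : 0 ≤ m₆ := stdMoment_nonneg 6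
  have hn : (0 : ℝ) < N := by exact_mod_cast hN
  have hT0 : 0 < T := lt_of_lt_of_le (by positivity) hT
  have hs : 0 < ‖P.d‖ := norm_pos_iff.2 hd
  have e1 := integral_norm_sq_linearGain_sub_amp_le h hd hT0 hc
  have e2 := integral_norm_sq_normalizedGain_sub_linearGain_le h hd hT0 hc
  have e3 : ∫ ω, ‖P.normalizedGain T ω - P.amp ω‖ ^ 2 ∂white4 N ≤
      2 * ∫ ω, ‖P.normalizedGain T ω - P.linearGain T ω‖ ^ 2 ∂white4 N
        + 2 * ∫ ω, ‖P.linearGain T ω - P.amp ω‖ ^ 2 ∂white4 N := by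
    rw [← integral_const_mul, ← integral_const_mul,
      ← integral_add (Tame.integrable (by fun_prop)) (Tame.integrable (by fun_prop))]
    refine white4_mono (by fun_prop) (by fun_prop) fun ω => ?_
    have := norm_add_le (P.normalizedGain T ω - P.linearGain T ω) (P.linearGain T ω - P.amp ω)
    rw [sub_add_sub_cancel] at this
    nlinarith [sq_nonneg (‖P.normalizedGain T ω - P.linearGain T ω‖
      - ‖P.linearGain T ω - P.amp ω‖), norm_nonneg (P.normalizedGain T ω - P.amp ω)]
  have hD₁ : 0 ≤ D₁ := by positivity
  have hD₂ : 0 ≤ D₂ := by positivity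
  have hD₃ : 0 ≤ D₃ := by positivity
  have hD₄ : 0 ≤ D₄ := by positivity
  have hD₅ : 0 ≤ D₅ := by positivity
  set q := ‖P.d‖ ^ 2 with hq
  have hq0 : 0 < q := by positivity
  have f1 : 3 * (1 / T ^ 2 * ((1 + P.κt) * ((1 + m₄) * (N * b ^ 6)))
        + 1 / (q * T ^ 2) * (q * (P.κr * (N * ((2 + m₄) * (b ^ 4 + b ^ 8)))))
        + 1 / (q * T ^ 2) * (b ^ 6 * (m₂ * N))) =
      3 * (D₁ * (N / T ^ 2) + D₂ * (1 / q * (N / T ^ 2))) := by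
    simp only [D₁, D₂]; field_simp
  have f2 : 1 / (q * T ^ 3) * (4 * (b ^ 10 * ((1 + m₄) * m₂ * (N : ℝ) ^ 2)
        + 4 * (q * (2 * b ^ 10 * (1 + P.κt + P.κr) * m₄ * (N : ℝ) ^ 2))
        + q ^ 2 * (8 * b ^ 10 * (8 * (1 + P.κt ^ 2 * m₄)
            + P.κr ^ 2 * m₄) * (m₆ * (N : ℝ) ^ 3))
        + (q * (c * N)) ^ 2 * (b ^ 2 * (m₂ * N)))) =
      D₃ * (1 / q * (N ^ 2 / T ^ 3)) + D₄ * (N ^ 2 / T ^ 3) + D₅ * (q * (N ^ 3 / T ^ 3)) := by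
    simp only [D₃, D₄, D₅]; field_simp; ring
  have g1 : N / T ^ 2 ≤ 1 / N * (1 / τ ^ 2) := by
    calc N / T ^ 2 ≤ N / (τ * N) ^ 2 := by gcongr
      _ = _ := by field_simp
  have g2 : N ^ 2 / T ^ 3 ≤ 1 / N * (1 / τ ^ 3) := by
    calc N ^ 2 / T ^ 3 ≤ N ^ 2 / (τ * N) ^ 3 := by gcongr
      _ = _ := by field_simp
  have g3 : N ^ 3 / T ^ 3 ≤ 1 / τ ^ 3 := by
    calc N ^ 3 / T ^ 3 ≤ N ^ 3 / (τ * N) ^ 3 := by gcongr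
      _ = _ := by field_simp
  rw [f1] at e1
  rw [f2] at e2
  set B := 1 / (N : ℝ) + 1 / (q * N) + q with hB
  have k1 : 1 / (N : ℝ) ≤ B := by
    have : 0 ≤ 1 / (q * (N : ℝ)) := by positivity
    linarith
  have k2 : 1 / q * (1 / (N : ℝ)) ≤ B := by
    have : 0 ≤ 1 / (N : ℝ) := by positivity
    have : 1 / q * (1 / (N : ℝ)) = 1 / (q * N) := by field_simp
    linarith
  have k3 : q ≤ B := by
    have : 0 ≤ 1 / (N : ℝ) := by positivity
    have : 0 ≤ 1 / (q * (N : ℝ)) := by positivity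
    linarith
  have e1' : ∫ ω, ‖P.linearGain T ω - P.amp ω‖ ^ 2 ∂white4 N ≤
      3 * (D₁ * (B * (1 / τ ^ 2)) + D₂ * (B * (1 / τ ^ 2))) := by
    refine e1.trans ?_
    have i1 : N / T ^ 2 ≤ B * (1 / τ ^ 2) := g1.trans (by gcongr)
    have i2 : 1 / q * (N / T ^ 2) ≤ B * (1 / τ ^ 2) :=
      calc 1 / q * (N / T ^ 2) ≤ 1 / q * (1 / N * (1 / τ ^ 2)) := by gcongr
        _ = 1 / q * (1 / N) * (1 / τ ^ 2) := by ring
        _ ≤ _ := by gcongr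
    gcongr
  have e2' : ∫ ω, ‖P.normalizedGain T ω - P.linearGain T ω‖ ^ 2 ∂white4 N ≤
      D₃ * (B * (1 / τ ^ 3)) + D₄ * (B * (1 / τ ^ 3)) + D₅ * (B * (1 / τ ^ 3)) := by
    refine e2.trans ?_
    have i1 : N ^ 2 / T ^ 3 ≤ B * (1 / τ ^ 3) := g2.trans (by gcongr)
    have i2 : 1 / q * (N ^ 2 / T ^ 3) ≤ B * (1 / τ ^ 3) :=
      calc 1 / q * (N ^ 2 / T ^ 3) ≤ 1 / q * (1 / N * (1 / τ ^ 3)) := by gcongr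
        _ = 1 / q * (1 / N) * (1 / τ ^ 3) := by ring
        _ ≤ _ := by gcongr
    have i3 : q * (N ^ 3 / T ^ 3) ≤ B * (1 / τ ^ 3) := by gcongr
    gcongr
  calc _ ≤ _ := e3
    _ ≤ 2 * (D₃ * (B * (1 / τ ^ 3)) + D₄ * (B * (1 / τ ^ 3)) + D₅ * (B * (1 / τ ^ 3)))
      + 2 * (3 * (D₁ * (B * (1 / τ ^ 2)) + D₂ * (B * (1 / τ ^ 2)))) := by gcongr
    _ = _ := by field_simp; ring

/-- Weighted arithmetic–geometric inequality, with `∑ |v i|⁴ ≤ ∑ |v i|² ≤ 1`. It needs no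
information on how the beamforming vector depends on the channel. -/
theorem sum_norm_sq_mul_le {a : ℝ} (ha : 0 < a) (x v : Fin N → ℂ) (hv : nsq v ≤ 1) :
    ∑ i, ‖x i‖ ^ 2 * ‖v i‖ ^ 2 ≤ (∑ i, ‖x i‖ ^ 4) / a + a := by
  have h1 : ∑ i, ‖v i‖ ^ 4 ≤ 1 := by
    calc ∑ i, ‖v i‖ ^ 4 ≤ ∑ i, ‖v i‖ ^ 2 := by
          refine Finset.sum_le_sum fun i _ => ?_
          have h2 : ‖v i‖ ^ 2 ≤ 1 :=
            (Finset.single_le_sum (f := fun i => ‖v i‖ ^ 2) (fun i _ => by positivity)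
              (Finset.mem_univ i)).trans hv
          nlinarith [sq_nonneg ‖v i‖]
      _ ≤ 1 := hv
  calc ∑ i, ‖x i‖ ^ 2 * ‖v i‖ ^ 2 ≤ ∑ i, (‖x i‖ ^ 4 / a + a * ‖v i‖ ^ 4) := by
        refine Finset.sum_le_sum fun i _ => ?_
        have h2 : ‖x i‖ ^ 4 / a + a * ‖v i‖ ^ 4 - ‖x i‖ ^ 2 * ‖v i‖ ^ 2 =
            ((‖x i‖ ^ 2 - a * ‖v i‖ ^ 2 / 2) ^ 2 + 3 / 4 * (a * ‖v i‖ ^ 2) ^ 2) / a := by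
          field_simp; ring
        have : 0 ≤ ((‖x i‖ ^ 2 - a * ‖v i‖ ^ 2 / 2) ^ 2 + 3 / 4 * (a * ‖v i‖ ^ 2) ^ 2) / a := by
          positivity
        linarith
    _ = (∑ i, ‖x i‖ ^ 4) / a + a * ∑ i, ‖v i‖ ^ 4 := by
        rw [Finset.sum_add_distrib, Finset.sum_div, Finset.mul_sum]
    _ ≤ (∑ i, ‖x i‖ ^ 4) / a + a := by nlinarith

end WhiteUplink

end

section

variable {N : ℕ}

/-! ### Matrix facts -/

theorem conjTranspose_sqrt (R : Matrix (Fin N) (Fin N) ℂ) : (CFC.sqrt R)ᴴ = CFC.sqrt R :=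
  (IsSelfAdjoint.of_nonneg (CFC.sqrt_nonneg R)).star_eq

theorem sqrt_mul_sqrt {R : Matrix (Fin N) (Fin N) ℂ} (hR : R.PosSemidef) :
    CFC.sqrt R * CFC.sqrt R = R := CFC.sqrt_mul_sqrt_self R hR.nonneg

theorem norm_sqrt_sq {R : Matrix (Fin N) (Fin N) ℂ} (hR : R.PosSemidef) :
    ‖CFC.sqrt R‖ ^ 2 = ‖R‖ := by
  have h := CStarRing.norm_self_mul_star (x := CFC.sqrt R)
  rw [Matrix.star_eq_conjTranspose, conjTranspose_sqrt, sqrt_mul_sqrt hR] at h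
  rw [h, sq]

theorem norm_sqrt_le {R : Matrix (Fin N) (Fin N) ℂ} (hR : R.PosSemidef) :
    ‖CFC.sqrt R‖ ≤ 1 + ‖R‖ := by
  have := norm_sqrt_sq hR
  nlinarith [norm_nonneg (CFC.sqrt R)]

theorem trace_conjTranspose_mul_self (M : Matrix (Fin N) (Fin N) ℂ) :
    (Mᴴ * M).trace = (frobSq M : ℂ) := by
  simp only [Matrix.trace, Matrix.diag, Matrix.mul_apply, Matrix.conjTranspose_apply, frobSq]
  rw [Finset.sum_comm]
  push_cast
  refine Finset.sum_congr rfl fun i _ => Finset.sum_congr rfl fun j _ => ?_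
  rw [mul_comm, Complex.star_def, Complex.mul_conj, Complex.normSq_eq_norm_sq]
  push_cast; rfl

theorem frobSq_mul_le (A M : Matrix (Fin N) (Fin N) ℂ) :
    frobSq (A * M) ≤ ‖A‖ ^ 2 * frobSq M := by
  have h (M : Matrix (Fin N) (Fin N) ℂ) : frobSq M = ∑ j, nsq (fun i => M i j) := by
    rw [frobSq, Finset.sum_comm]; rfl
  rw [h, h, Finset.mul_sum]
  exact Finset.sum_le_sum fun j _ => nsq_mulVec_le A (fun i => M i j)

theorem norm_apply_le (M : Matrix (Fin N) (Fin N) ℂ) (i j : Fin N) : ‖M i j‖ ≤ ‖M‖ := by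
  have h := nsq_row_le M i
  have h1 : ‖M i j‖ ^ 2 ≤ nsq (M i) :=
    Finset.single_le_sum (f := fun j => ‖M i j‖ ^ 2) (fun _ _ => by positivity) (Finset.mem_univ j)
  exact abs_le_of_sq_le_sq' (h1.trans h) (norm_nonneg _) |>.2

theorem norm_trace_le (M : Matrix (Fin N) (Fin N) ℂ) : ‖M.trace‖ ≤ N * ‖M‖ := by
  calc ‖M.trace‖ ≤ ∑ _i : Fin N, ‖M‖ :=
        (norm_sum_le _ _).trans (Finset.sum_le_sum fun i _ => norm_apply_le M i i)
    _ = N * ‖M‖ := by simp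

theorem norm_diagonal_diag_le (M : Matrix (Fin N) (Fin N) ℂ) :
    ‖Matrix.diagonal (fun i => M i i)‖ ≤ ‖M‖ := by
  rw [Matrix.l2_opNorm_diagonal]
  exact (pi_norm_le_iff_of_nonneg (norm_nonneg _)).2 fun i => norm_apply_le M i i

/-- Cauchy–Schwarz on the diagonal; used to pass from a trace of order `N` to a squared Frobenius
norm of order `N`. -/
theorem sq_trace_re_le (M : Matrix (Fin N) (Fin N) ℂ) : M.trace.re ^ 2 ≤ N * frobSq M := by
  have h1 : M.trace.re ^ 2 ≤ (∑ i, ‖M i i‖) ^ 2 := by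
    rw [← sq_abs M.trace.re]
    exact pow_le_pow_left₀ (abs_nonneg _) ((Complex.abs_re_le_norm _).trans (norm_sum_le _ _)) 2
  have h2 := sq_sum_le_card_mul_sum_sq (s := Finset.univ) (f := fun i => ‖M i i‖)
  have h3 : ∑ i, ‖M i i‖ ^ 2 ≤ frobSq M := Finset.sum_le_sum fun i _ =>
    Finset.single_le_sum (f := fun j => ‖M i j‖ ^ 2) (fun _ _ => by positivity) (Finset.mem_univ i)
  simp only [Finset.card_univ, Fintype.card_fin] at h2
  exact h1.trans (h2.trans (mul_le_mul_of_nonneg_left h3 (Nat.cast_nonneg N)))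

/-- Inversion reverses the order on positive definite matrices, and the operator norm is monotone on
positive ones. -/
theorem norm_inv_le_of_le {A B : Matrix (Fin N) (Fin N) ℂ} (hA : A.PosDef) (hAB : (B - A).PosSemidef) :
    ‖B⁻¹‖ ≤ ‖A⁻¹‖ := by
  have hle : A ≤ B := Matrix.le_iff.2 hAB
  have hpos : IsStrictlyPositive A := ⟨hA.posSemidef.nonneg, hA.isUnit⟩
  have h1 := CStarAlgebra.ringInverse_le_ringInverse hle hpos
  rw [← Matrix.nonsing_inv_eq_ringInverse, ← Matrix.nonsing_inv_eq_ringInverse] at h1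
  have hB : B.PosDef := by
    have := Matrix.PosDef.posSemidef_add hAB hA
    simpa using this
  exact CStarAlgebra.norm_le_norm_of_nonneg_of_le hB.inv.posSemidef.nonneg h1

/-! ### The uplink in terms of white noise -/

/-- The standing assumptions on a link. -/
structure Link.Admissible (L : Link N) : Prop where
  R_posSemidef : L.R.PosSemidef
  S_posDef : L.S.PosDef
  d_ne_zero : L.d ≠ 0
  pBS_pos : 0 < L.pBS
  noiseUT_pos : 0 < L.noiseUT
  κtBS_nonneg : 0 ≤ L.κtBS
  κrBS_nonneg : 0 ≤ L.κrBS
  κtUT_nonneg : 0 ≤ L.κtUT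
  κrUT_nonneg : 0 ≤ L.κrUT

/-- The covariance matrix of the received pilot signal. -/
def Link.gram (L : Link N) : Matrix (Fin N) (Fin N) ℂ :=
  ((L.pUT * (1 + L.κtUT) : ℝ) : ℂ) • L.R
    + ((L.pUT * L.κrBS : ℝ) : ℂ) • Matrix.diagonal (fun i => L.R i i) + L.S

/-- The white-noise representation of the uplink. -/
def Link.white (L : Link N) : WhiteUplink N where
  H := CFC.sqrt L.R
  K := CFC.sqrt L.S
  B := L.R * L.gram⁻¹
  d := L.d
  κt := L.κtUT
  κr := L.κrBS

/-- The size of the squared gain, relative to the pilot power. -/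
def Link.gainTrace (L : Link N) : ℝ := (L.R * L.gram⁻¹ * L.R).trace.re

theorem Link.pUT_nonneg (L : Link N) : 0 ≤ L.pUT := by unfold Link.pUT; positivity

variable {L : Link N}

theorem Link.Admissible.pUT_pos (h : L.Admissible) : 0 < L.pUT := by
  have := norm_pos_iff.2 h.d_ne_zero
  unfold Link.pUT; positivity

/-- With `norm_inv_le_of_le` this gives `‖gram⁻¹‖ ≤ ‖S⁻¹‖`, uniformly in the pilot power. -/
theorem Link.Admissible.gram_sub (h : L.Admissible) : (L.gram - L.S).PosSemidef := by
  rw [Link.gram, add_sub_cancel_right]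
  have hq := L.pUT_nonneg
  have hκt := h.κtUT_nonneg
  have hκr := h.κrBS_nonneg
  refine (h.R_posSemidef.smul ?_).add (Matrix.PosSemidef.smul (Matrix.PosSemidef.diagonal ?_) ?_)
  · exact Complex.zero_le_real.2 (by positivity)
  · exact fun i => h.R_posSemidef.diag_nonneg
  · exact Complex.zero_le_real.2 (by positivity)

theorem Link.Admissible.gram_posDef (h : L.Admissible) : L.gram.PosDef := by
  simpa using Matrix.PosDef.posSemidef_add h.gram_sub h.S_posDef

theorem Link.Admissible.isUnit_gram_det (h : L.Admissible) : IsUnit L.gram.det :=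
  (Matrix.isUnit_iff_isUnit_det _).1 h.gram_posDef.isUnit

theorem Link.Admissible.trace_eq (h : L.Admissible) :
    (L.R * L.gram⁻¹ * L.R).trace = (L.gainTrace : ℂ) := by
  have h1 : (L.R * L.gram⁻¹ * L.R).PosSemidef := by
    have := h.gram_posDef.inv.posSemidef.mul_mul_conjTranspose_same L.R
    rwa [h.R_posSemidef.isHermitian.eq] at this
  exact (Complex.eq_re_of_ofReal_le (r := 0) (by simpa using h1.trace_nonneg))

/-- Factor `R = gram^{1/2} Z` with `Z = gram^{1/2} gram⁻¹ R`; then `Zᴴ Z = R gram⁻¹ R`, so the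
squared Frobenius norm of `Z` is the gain trace. -/
theorem Link.Admissible.frobSq_le (h : L.Admissible) :
    frobSq L.R ≤ ‖L.gram‖ * L.gainTrace := by
  have hg := h.gram_posDef.posSemidef
  set Z := CFC.sqrt L.gram * (L.gram⁻¹ * L.R) with hZ
  have h1 : CFC.sqrt L.gram * Z = L.R := by
    rw [hZ, ← Matrix.mul_assoc, sqrt_mul_sqrt hg, ← Matrix.mul_assoc,
      Matrix.mul_nonsing_inv _ h.isUnit_gram_det, Matrix.one_mul]
  have h2 : Zᴴ * Z = L.R * L.gram⁻¹ * L.R := by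
    have : Zᴴ = L.R * L.gram⁻¹ * CFC.sqrt L.gram := by
      rw [hZ, Matrix.conjTranspose_mul, Matrix.conjTranspose_mul, conjTranspose_sqrt,
        h.R_posSemidef.isHermitian.eq, h.gram_posDef.inv.isHermitian.eq]
    rw [this, Matrix.mul_assoc, h1]
  have h3 : frobSq Z = L.gainTrace := by
    have := trace_conjTranspose_mul_self Z
    rw [h2, h.trace_eq] at this
    exact_mod_cast this.symm
  calc frobSq L.R = frobSq (CFC.sqrt L.gram * Z) := by rw [h1]
    _ ≤ ‖CFC.sqrt L.gram‖ ^ 2 * frobSq Z := frobSq_mul_le _ _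
    _ = _ := by rw [norm_sqrt_sq hg, h3]

theorem Link.Admissible.norm_gram_le (h : L.Admissible) :
    ‖L.gram‖ ≤ L.pUT * (1 + L.κtUT + L.κrBS) * ‖L.R‖ + ‖L.S‖ := by
  have hq := L.pUT_nonneg
  have hκt := h.κtUT_nonneg
  have hκr := h.κrBS_nonneg
  refine (norm_add₃_le).trans ?_
  rw [norm_smul, norm_smul, Complex.norm_real, Complex.norm_real, Real.norm_eq_abs,
    Real.norm_eq_abs, abs_of_nonneg (by positivity), abs_of_nonneg (by positivity)]
  have := mul_le_mul_of_nonneg_left (norm_diagonal_diag_le L.R)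
    (by positivity : 0 ≤ L.pUT * L.κrBS)
  linarith

/-- A single constant has to serve the square roots, of norm at most `1 + b`, and `R gram⁻¹`, of
norm at most `b * b`. -/
theorem Link.Admissible.bounded (h : L.Admissible) {b : ℝ} (hR : ‖L.R‖ ≤ b) (hS : ‖L.S‖ ≤ b)
    (hSi : ‖L.S⁻¹‖ ≤ b) : L.white.Bounded (1 + b + b * b) := by
  have hb : 0 ≤ b := (norm_nonneg _).trans hR
  refine ⟨?_, ?_, ?_, h.κtUT_nonneg, h.κrBS_nonneg⟩
  · exact (norm_sqrt_le h.R_posSemidef).trans (by nlinarith)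
  · exact (norm_sqrt_le h.S_posDef.posSemidef).trans (by nlinarith)
  · have h1 := norm_inv_le_of_le h.S_posDef h.gram_sub
    calc ‖L.R * L.gram⁻¹‖ ≤ ‖L.R‖ * ‖L.gram⁻¹‖ := norm_mul_le _ _
      _ ≤ b * b := mul_le_mul hR (h1.trans hSi) (norm_nonneg _) hb
      _ ≤ _ := by linarith

/-- The first trace is an instance of cyclicity. For the second, `B gram Bᴴ = R gram⁻¹ R` has trace
exactly `T`, and `gram - S` carries a factor `pUT`; each of its two summands, conjugated by `B`, has
trace at most `N b⁵` apart from its scalar coefficient. -/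
theorem Link.Admissible.calibrated (h : L.Admissible) {b : ℝ} (hR : ‖L.R‖ ≤ b)
    (hSi : ‖L.S⁻¹‖ ≤ b) :
    L.white.Calibrated L.gainTrace (b ^ 5 * (1 + L.κtUT + L.κrBS)) := by
  have hq := L.pUT_nonneg
  have hκt := h.κtUT_nonneg
  have hκr := h.κrBS_nonneg
  have hb : 0 ≤ b := (norm_nonneg _).trans hR
  have hRh := h.R_posSemidef.isHermitian.eq
  have hgh := h.gram_posDef.inv.isHermitian.eq
  set B := L.R * L.gram⁻¹ with hB
  have hBh : Bᴴ = L.gram⁻¹ * L.R := by rw [hB, Matrix.conjTranspose_mul, hRh, hgh]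
  constructor
  · change ((CFC.sqrt L.R)ᴴ * Bᴴ * CFC.sqrt L.R).trace = _
    rw [conjTranspose_sqrt, Matrix.trace_mul_cycle, sqrt_mul_sqrt h.R_posSemidef, hBh,
      ← Matrix.mul_assoc, h.trace_eq]
  · change |((B * CFC.sqrt L.S)ᴴ * (B * CFC.sqrt L.S)).trace.re - L.gainTrace| ≤
      L.pUT * (b ^ 5 * (1 + L.κtUT + L.κrBS) * N)
    set D := Matrix.diagonal (fun i => L.R i i) with hD
    have h1 : ((B * CFC.sqrt L.S)ᴴ * (B * CFC.sqrt L.S)).trace = (B * L.S * Bᴴ).trace := by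
      rw [Matrix.trace_mul_comm, Matrix.conjTranspose_mul, conjTranspose_sqrt]
      congr 1
      rw [Matrix.mul_assoc, ← Matrix.mul_assoc (CFC.sqrt L.S), sqrt_mul_sqrt h.S_posDef.posSemidef]
      simp only [hB, Matrix.mul_assoc]
    have h2 : B * L.gram * Bᴴ = L.R * L.gram⁻¹ * L.R := by
      rw [hBh, hB, Matrix.nonsing_inv_mul_cancel_right _ _ h.isUnit_gram_det, Matrix.mul_assoc]
    have h3 : B * L.gram * Bᴴ = ((L.pUT * (1 + L.κtUT) : ℝ) : ℂ) • (B * L.R * Bᴴ)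
        + ((L.pUT * L.κrBS : ℝ) : ℂ) • (B * D * Bᴴ) + B * L.S * Bᴴ := by
      rw [Link.gram]
      simp only [Matrix.mul_add, Matrix.add_mul, Matrix.mul_smul, Matrix.smul_mul]
      rfl
    have h4 : (B * L.S * Bᴴ).trace - L.gainTrace =
        -(((L.pUT * (1 + L.κtUT) : ℝ) : ℂ) * (B * L.R * Bᴴ).trace
        + ((L.pUT * L.κrBS : ℝ) : ℂ) * (B * D * Bᴴ).trace) := by
      have := congrArg Matrix.trace (h2.symm.trans h3)
      rw [h.trace_eq, Matrix.trace_add, Matrix.trace_add, Matrix.trace_smul, Matrix.trace_smul,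
        smul_eq_mul, smul_eq_mul] at this
      rw [this]; ring
    have hBn : ‖B‖ ≤ b ^ 2 := by
      have h1 := norm_inv_le_of_le h.S_posDef h.gram_sub
      rw [sq]
      exact (norm_mul_le _ _).trans (mul_le_mul hR (h1.trans hSi) (norm_nonneg _) hb)
    have h5 (Q : Matrix (Fin N) (Fin N) ℂ) (hQ : ‖Q‖ ≤ b) :
        ‖(B * Q * Bᴴ).trace‖ ≤ N * b ^ 5 := by
      refine (norm_trace_le _).trans ?_
      refine mul_le_mul_of_nonneg_left ?_ (Nat.cast_nonneg N)
      calc ‖B * Q * Bᴴ‖ ≤ ‖B * Q‖ * ‖Bᴴ‖ := norm_mul_le _ _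
        _ ≤ (‖B‖ * ‖Q‖) * ‖B‖ := by
          rw [norm_conjTranspose]
          exact mul_le_mul_of_nonneg_right (norm_mul_le _ _) (norm_nonneg _)
        _ ≤ (b ^ 2 * b) * b ^ 2 := by gcongr
        _ = b ^ 5 := by ring
    have h6 := h5 L.R hR
    have h7 := h5 D ((norm_diagonal_diag_le L.R).trans hR)
    have h8 : |(B * L.S * Bᴴ).trace.re - L.gainTrace| ≤
        ‖(B * L.S * Bᴴ).trace - (L.gainTrace : ℂ)‖ := by
      have := Complex.abs_re_le_norm ((B * L.S * Bᴴ).trace - (L.gainTrace : ℂ))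
      simpa using this
    rw [h1]
    refine h8.trans ?_
    rw [h4, norm_neg]
    refine (norm_add_le _ _).trans ?_
    rw [norm_mul, norm_mul, Complex.norm_real, Complex.norm_real, Real.norm_eq_abs,
      Real.norm_eq_abs, abs_of_nonneg (by positivity), abs_of_nonneg (by positivity)]
    have h9 := mul_le_mul_of_nonneg_left h6 (by positivity : 0 ≤ L.pUT * (1 + L.κtUT))
    have h10 := mul_le_mul_of_nonneg_left h7 (by positivity : 0 ≤ L.pUT * L.κrBS)
    linarith

/-! ### Transport of the uplink law -/

/-- The primitive uplink quantities as functions of the white noises. -/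
def Link.colour (L : Link N) (ω : WhiteUplink.Sample N) : WhiteUplink.Sample N :=
  (CFC.sqrt L.R *ᵥ ω.1, (Real.sqrt (L.κtUT * L.pUT) : ℂ) * ω.2.1, CFC.sqrt L.S *ᵥ ω.2.2.1,
    ω.2.2.2)

@[fun_prop]
theorem Link.tame_colour (L : Link N) : Tame L.colour := by unfold Link.colour; fun_prop

/-- A product of image measures is the image of the product, so all uplink expectations can be
computed over white noise. -/
theorem Link.uplink_eq_map (L : Link N) : L.uplink = (white4 N).map L.colour := by
  have m1 : Measurable fun g : Fin N → ℂ => CFC.sqrt L.R *ᵥ g :=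
    (by fun_prop : Tame fun g : Fin N → ℂ => CFC.sqrt L.R *ᵥ g).measurable
  have m2 : Measurable fun z : ℂ => (Real.sqrt (L.κtUT * L.pUT) : ℂ) * z := by fun_prop
  have m3 : Measurable fun g : Fin N → ℂ => CFC.sqrt L.S *ᵥ g :=
    (by fun_prop : Tame fun g : Fin N → ℂ => CFC.sqrt L.S *ᵥ g).measurable
  have h3 : (vectorCN L.S).prod (whiteCN N) =
      ((whiteCN N).prod (whiteCN N)).map (Prod.map (fun g => CFC.sqrt L.S *ᵥ g) id) := by
    rw [← Measure.map_prod_map _ _ m3 measurable_id, Measure.map_id]; rfl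
  rw [Link.uplink, h3, scalarCN,
    Measure.map_prod_map _ _ m2 (m3.prodMap measurable_id), vectorCN,
    Measure.map_prod_map _ _ m1 (m2.prodMap (m3.prodMap measurable_id))]
  rfl

instance : HasMoments L.uplink := by rw [L.uplink_eq_map]; exact HasMoments.map L.tame_colour

instance : IsProbabilityMeasure L.uplink := HasMoments.isProb

theorem Link.received_colour (L : Link N) (ω : WhiteUplink.Sample N) :
    (L.R * L.gram⁻¹) *ᵥ L.received (L.colour ω) = L.white.est ω := by
  have h : L.received (L.colour ω) =
      L.white.pilot ω • L.white.chan ω + CFC.sqrt L.S *ᵥ ω.2.2.1 + L.white.dist ω := by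
    ext i
    simp only [Link.received, Pi.add_apply, Pi.smul_apply, smul_eq_mul]
    rw [mul_comm (L.white.pilot ω)]
    rfl
  rw [h, Matrix.mulVec_add, Matrix.mulVec_add, Matrix.mulVec_smul, Matrix.mulVec_mulVec]
  change _ = _ • _ + _ + _
  rw [add_right_comm]
  rfl

theorem Link.estimate_colour (L : Link N) (ω : WhiteUplink.Sample N) :
    L.estimate (L.colour ω) = star L.d • L.white.est ω := by
  rw [← L.received_colour, ← Matrix.smul_mulVec]
  rfl

theorem l2norm_smul (c : ℂ) (x : Fin N → ℂ) : l2norm (c • x) = ‖c‖ * l2norm x := by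
  rw [l2norm, l2norm, WithLp.toLp_smul, norm_smul]

/-- The scalar `d*` of the estimator survives normalization only as a phase: conjugation in `mrt`
turns it into `d`, and the norm contributes `‖d‖`. This is the form chosen for `WhiteUplink.gain`.
-/
theorem Link.mrtGain_colour (L : Link N) (ω : WhiteUplink.Sample N) :
    L.mrtGain (L.colour ω) = L.white.gain ω := by
  rw [Link.mrtGain, effective, L.estimate_colour, WhiteUplink.gain, dotProduct, Finset.mul_sum,
    Finset.sum_div]
  refine Finset.sum_congr rfl fun i _ => ?_
  simp only [mrt, l2norm_smul, Pi.smul_apply, smul_eq_mul, star_mul', star_star, Pi.star_apply,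
    norm_star, mul_div_assoc']
  change (CFC.sqrt L.R *ᵥ ω.1) i * _ / _ = L.d * (_ * (CFC.sqrt L.R *ᵥ ω.1) i) / _
  congr 1
  ring

theorem Link.integral_uplink {G : Type*} [NormedAddCommGroup G] [NormedSpace ℝ G]
    [MeasurableSpace G] [BorelSpace G] [SecondCountableTopology G]
    {f : WhiteUplink.Sample N → G} (hf : Measurable f) :
    ∫ u, f u ∂L.uplink = ∫ ω, f (L.colour ω) ∂white4 N := by
  rw [L.uplink_eq_map]
  exact integral_map L.tame_colour.measurable.aemeasurable hf.aestronglyMeasurable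

end

section

variable {N : ℕ}

/-! ### A variational lower bound on the Kullback–Leibler divergence -/

theorem ofReal_integral_le_lintegral {α : Type*} [MeasurableSpace α] {μ : Measure α} {f : α → ℝ}
    (hf : Integrable f μ) : ENNReal.ofReal (∫ x, f x ∂μ) ≤ ∫⁻ x, ENNReal.ofReal (f x) ∂μ := by
  rw [integral_eq_lintegral_pos_part_sub_lintegral_neg_part hf]
  refine (ENNReal.ofReal_le_ofReal (sub_le_self _ ENNReal.toReal_nonneg)).trans ?_
  exact ENNReal.ofReal_toReal_le

/-- Fenchel–Young: `exp t - 1` is the convex conjugate of `x log x + 1 - x`. It reduces to `u + 1 ≤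
exp u` at `u = t - log x`. -/
theorem klFun_fenchel {x : ℝ} (hx : 0 ≤ x) (t : ℝ) :
    x * t - Real.exp t + 1 ≤ InformationTheory.klFun x := by
  rw [InformationTheory.klFun]
  rcases hx.eq_or_lt with rfl | hx
  · simp [(Real.exp_pos t).le]
  · have h1 := Real.add_one_le_exp (t - Real.log x)
    rw [Real.exp_sub, Real.exp_log hx, le_div_iff₀ hx] at h1
    linarith

/-- Integrate `klFun_fenchel` at `x = dP/dQ` and `t = φ`; the hypothesis on `exp φ` compensates the
constant `1`. Without absolute continuity the divergence is infinite. -/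
theorem ofReal_integral_le_klDiv {α : Type*} [MeasurableSpace α] {P Q : Measure α}
    [IsProbabilityMeasure P] [IsProbabilityMeasure Q] {φ : α → ℝ} (hm : Measurable φ)
    (hφ : Integrable φ P) (hexp : ∫⁻ x, ENNReal.ofReal (Real.exp (φ x)) ∂Q ≤ 1) :
    ENNReal.ofReal (∫ x, φ x ∂P) ≤ InformationTheory.klDiv P Q := by
  by_cases hac : P ≪ Q
  swap
  · rw [InformationTheory.klDiv_of_not_ac hac]; exact le_top
  rw [InformationTheory.klDiv_eq_lintegral_klFun_of_ac hac]
  have hexpi : Integrable (fun x => Real.exp (φ x)) Q := by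
    refine ⟨(Real.measurable_exp.comp hm).aestronglyMeasurable, ?_⟩
    rw [hasFiniteIntegral_iff_ofReal (.of_forall fun x => (Real.exp_pos _).le)]
    exact hexp.trans_lt ENNReal.one_lt_top
  have hrφ : Integrable (fun x => (P.rnDeriv Q x).toReal * φ x) Q := by
    simpa using (integrable_rnDeriv_smul_iff hac).2 hφ
  have hexp1 : ∫ x, Real.exp (φ x) ∂Q ≤ 1 := by
    rw [integral_eq_lintegral_of_nonneg_ae (.of_forall fun x => (Real.exp_pos _).le)
      hexpi.aestronglyMeasurable]
    exact ENNReal.toReal_le_of_le_ofReal zero_le_one (by simpa using hexp)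
  have heq : ∫ x, (P.rnDeriv Q x).toReal * φ x ∂Q = ∫ x, φ x ∂P := by
    simpa using integral_rnDeriv_smul (f := φ) hac
  calc ENNReal.ofReal (∫ x, φ x ∂P)
      ≤ ENNReal.ofReal (∫ x, ((P.rnDeriv Q x).toReal * φ x - Real.exp (φ x) + 1) ∂Q) := by
        refine ENNReal.ofReal_le_ofReal ?_
        have hsub : Integrable (fun x => (P.rnDeriv Q x).toReal * φ x - Real.exp (φ x)) Q :=
          hrφ.sub hexpi
        rw [integral_add hsub (integrable_const _), integral_sub hrφ hexpi, heq]
        simp only [integral_const, probReal_univ, one_smul]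
        linarith
    _ ≤ ∫⁻ x, ENNReal.ofReal ((P.rnDeriv Q x).toReal * φ x - Real.exp (φ x) + 1) ∂Q :=
        ofReal_integral_le_lintegral ((hrφ.sub hexpi).add (integrable_const _))
    _ ≤ _ := lintegral_mono fun x =>
        ENNReal.ofReal_le_ofReal (klFun_fenchel ENNReal.toReal_nonneg _)

/-! ### The Gaussian test channel -/

/-- Completing the square turns the density of `N(0, 1/2)` times the tilt into the density of
`N(b/√p, t/(2p))`. -/
theorem lintegral_gaussian_tilt {p t : ℝ} (hp : 0 < p) (ht : 0 < t) (b : ℝ) :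
    ∫⁻ x, ENNReal.ofReal (Real.sqrt (p / t) * Real.exp (-(Real.sqrt p * x - b) ^ 2 / t + x ^ 2))
      ∂gaussianReal 0 (1 / 2) = 1 := by
  have hsp : 0 < Real.sqrt p := Real.sqrt_pos.2 hp
  let v : NNReal := ⟨t / (2 * p), by positivity⟩
  have hv : v ≠ 0 := by
    intro h
    have : (t / (2 * p)) = 0 := congrArg NNReal.toReal h
    have : 0 < t / (2 * p) := by positivity
    linarith
  rw [gaussianReal_of_var_ne_zero _ (by norm_num),
    lintegral_withDensity_eq_lintegral_mul _ (measurable_gaussianPDF _ _) (by fun_prop),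
    ← lintegral_gaussianPDF_eq_one (b / Real.sqrt p) hv]
  refine lintegral_congr fun x => ?_
  rw [Pi.mul_apply, gaussianPDF, gaussianPDF, ← ENNReal.ofReal_mul (gaussianPDFReal_nonneg _ _ _)]
  congr 1
  rw [gaussianPDFReal, gaussianPDFReal]
  have hvr : (v : ℝ) = t / (2 * p) := rfl
  have hE : Real.exp (-(x - 0) ^ 2 / (2 * ((1 / 2 : NNReal) : ℝ)))
      * Real.exp (-(Real.sqrt p * x - b) ^ 2 / t + x ^ 2)
      = Real.exp (-(x - b / Real.sqrt p) ^ 2 / (2 * (v : ℝ))) := by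
    rw [← Real.exp_add, hvr]
    congr 1
    have hs : p = Real.sqrt p ^ 2 := (Real.sq_sqrt hp.le).symm
    push_cast
    have h1 : (Real.sqrt p * x - b) ^ 2 = p * (x - b / Real.sqrt p) ^ 2 := by
      nth_rewrite 2 [hs]
      rw [← mul_pow, mul_sub, mul_div_cancel₀ _ hsp.ne']
    rw [h1]
    field_simp
    ring
  have hC : (Real.sqrt (2 * Real.pi * ((1 / 2 : NNReal) : ℝ)))⁻¹ * Real.sqrt (p / t)
      = (Real.sqrt (2 * Real.pi * (v : ℝ)))⁻¹ := by
    rw [hvr, ← Real.sqrt_inv, ← Real.sqrt_inv, ← Real.sqrt_mul (by positivity)]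
    congr 1
    push_cast
    field_simp
  rw [← hE, ← hC]
  ring

/-- The integrand is the likelihood ratio of `CN(b, t)` to `CN(0, p)`. Since `b` is arbitrary, it
may later be a function of the received signal, with no knowledge of that signal's law. -/
theorem lintegral_scalarCN_tilt {p t : ℝ} (hp : 0 < p) (ht : 0 < t) (b : ℂ) :
    ∫⁻ s, ENNReal.ofReal (Real.exp (Real.log (p / t) - ‖s - b‖ ^ 2 / t + ‖s‖ ^ 2 / p))
      ∂scalarCN p = 1 := by
  have hpt : 0 < p / t := by positivity
  rw [scalarCN, lintegral_map (by fun_prop) (by fun_prop), stdCN,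
    lintegral_map (by fun_prop) tame_complexMk.measurable]
  have h (x : ℝ × ℝ) : ENNReal.ofReal (Real.exp (Real.log (p / t)
      - ‖(Real.sqrt p : ℂ) * (⟨x.1, x.2⟩ : ℂ) - b‖ ^ 2 / t
      + ‖(Real.sqrt p : ℂ) * (⟨x.1, x.2⟩ : ℂ)‖ ^ 2 / p)) =
      ENNReal.ofReal (Real.sqrt (p / t)
        * Real.exp (-(Real.sqrt p * x.1 - b.re) ^ 2 / t + x.1 ^ 2)) *
      ENNReal.ofReal (Real.sqrt (p / t)
        * Real.exp (-(Real.sqrt p * x.2 - b.im) ^ 2 / t + x.2 ^ 2)) := by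
    rw [← ENNReal.ofReal_mul (by positivity)]
    congr 1
    have hs : p = Real.sqrt p * Real.sqrt p := (Real.mul_self_sqrt hp.le).symm
    have e1 : ‖(Real.sqrt p : ℂ) * (⟨x.1, x.2⟩ : ℂ) - b‖ ^ 2 =
        (Real.sqrt p * x.1 - b.re) ^ 2 + (Real.sqrt p * x.2 - b.im) ^ 2 := by
      rw [← Complex.normSq_eq_norm_sq, Complex.normSq_apply]
      simp
      ring
    have e2 : ‖(Real.sqrt p : ℂ) * (⟨x.1, x.2⟩ : ℂ)‖ ^ 2 / p = x.1 ^ 2 + x.2 ^ 2 := by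
      rw [← Complex.normSq_eq_norm_sq, Complex.normSq_apply, div_eq_iff hp.ne']
      simp
      nth_rewrite 5 [hs]
      ring
    have e3 : p / t = Real.sqrt (p / t) * Real.sqrt (p / t) := (Real.mul_self_sqrt hpt.le).symm
    rw [e1, e2, add_comm_sub, Real.exp_add, Real.exp_log hpt]
    nth_rewrite 1 [e3]
    rw [mul_mul_mul_comm, ← Real.exp_add]
    congr 2
    ring
  simp_rw [h]
  rw [lintegral_prod_mul (f := fun x : ℝ => ENNReal.ofReal (Real.sqrt (p / t)
        * Real.exp (-(Real.sqrt p * x - b.re) ^ 2 / t + x ^ 2)))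
      (g := fun x : ℝ => ENNReal.ofReal (Real.sqrt (p / t)
        * Real.exp (-(Real.sqrt p * x - b.im) ^ 2 / t + x ^ 2)))
      (by fun_prop) (by fun_prop), lintegral_gaussian_tilt hp ht,
    lintegral_gaussian_tilt hp ht, one_mul]

instance (v : ℝ) : HasMoments (scalarCN v) := HasMoments.map (by fun_prop)

instance (v : ℝ) : IsProbabilityMeasure (scalarCN v) := HasMoments.isProb

theorem integral_scalarCN_norm_sq {p : ℝ} (hp : 0 ≤ p) : ∫ s, ‖s‖ ^ 2 ∂scalarCN p = p := by
  rw [scalarCN, integral_map (by fun_prop) (by fun_prop)]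
  simp only [norm_mul, mul_pow, Complex.norm_real, Real.norm_eq_abs,
    abs_of_nonneg (Real.sqrt_nonneg _), Real.sq_sqrt hp]
  rw [integral_const_mul, integral_stdCN_norm_sq, mul_one]

theorem scalarCN_mem_signalLaws {p : ℝ} (hp : 0 ≤ p) : scalarCN p ∈ signalLaws p := by
  refine ⟨inferInstance, le_of_eq ?_⟩
  have h : ∫⁻ s, ENNReal.ofReal (‖s‖ ^ 2) ∂scalarCN p = ENNReal.ofReal p := by
    rw [← ofReal_integral_eq_lintegral_ofReal (Tame.integrable (by fun_prop))
      (.of_forall fun s => by positivity), integral_scalarCN_norm_sq hp]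
  rw [← h]
  refine lintegral_congr fun s => ?_
  rw [ENNReal.ofReal_pow (norm_nonneg _), ofReal_norm]

/-! ### The mean square error of a linear receiver -/

theorem integral_prod_norm_sq_add {E F : Type*} [NormedAddCommGroup E] [MeasurableSpace E]
    [BorelSpace E] [SecondCountableTopology E] [NormedAddCommGroup F] [MeasurableSpace F]
    [BorelSpace F] [SecondCountableTopology F] {μ : Measure E} {ν : Measure F} [HasMoments μ]
    [HasMoments ν] {u : E → ℂ} {v : F → ℂ} (hu : Tame u) (hv : Tame v) (h0 : ∫ y, v y ∂ν = 0) :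
    ∫ p, ‖u p.1 + v p.2‖ ^ 2 ∂μ.prod ν = ∫ x, ‖u x‖ ^ 2 ∂μ + ∫ y, ‖v y‖ ^ 2 ∂ν := by
  have h (p : E × F) : ‖u p.1 + v p.2‖ ^ 2 =
      ‖u p.1‖ ^ 2 + 2 * (star (u p.1) * v p.2).re + ‖v p.2‖ ^ 2 := by
    simp only [← Complex.normSq_eq_norm_sq, Complex.normSq_apply, Complex.star_def,
      Complex.mul_re, Complex.conj_re, Complex.conj_im, Complex.add_re, Complex.add_im]
    ring
  have htame : Tame fun p : E × F => star (u p.1) * v p.2 := by fun_prop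
  have hre : Tame fun p : E × F => (star (u p.1) * v p.2).re := Tame.re htame
  have hz : ∫ p, (star (u p.1) * v p.2).re ∂μ.prod ν = 0 := by
    have h1 := integral_re (𝕜 := ℂ) (htame.integrable (μ := μ.prod ν))
    have h2 := integral_prod_mul (μ := μ) (ν := ν) (fun x => star (u x)) v
    rw [h0, mul_zero] at h2
    rw [h2] at h1
    simpa using h1
  simp_rw [h]
  have t1 : Tame fun p : E × F => 2 * (star (u p.1) * v p.2).re := (tame_const 2).mul hre
  rw [integral_add ((Tame.add (by fun_prop) t1).integrable) (Tame.integrable (by fun_prop)),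
    integral_add (Tame.integrable (by fun_prop)) t1.integrable, integral_const_mul, hz,
    integral_fun_fst (f := fun x => ‖u x‖ ^ 2), integral_fun_snd (f := fun y => ‖v y‖ ^ 2)]
  simp

instance : BorelSpace ((Fin N → ℂ) × ℂ × ℂ) := Prod.borelSpace

instance (N : ℕ) : HasMoments (downlinkNoise N) :=
  HasMoments.prod (μ := whiteCN N) (ν := stdCN.prod stdCN)

instance (N : ℕ) : IsProbabilityMeasure (downlinkNoise N) := HasMoments.isProb

/-- The mean square error, relative to the signal power, of the linear receiver `y ↦ a y`, given
the channel `h` and the beamforming vector `w`. -/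
def Link.mse (L : Link N) (a : ℂ) (h w : Fin N → ℂ) : ℝ :=
  ‖1 - a * effective h w‖ ^ 2 + ‖a‖ ^ 2 * (L.κtBS * (∑ i, ‖h i‖ ^ 2 * ‖w i‖ ^ 2)
    + L.noiseUT / L.pBS + L.κrUT * ‖effective h w‖ ^ 2)

/-- The error is `(1 - a g) s` plus three independent centred noises, so the second moments add. -/
theorem Link.integral_receiver_error (L : Link N) (hp : 0 < L.pBS) (hσ : 0 ≤ L.noiseUT)
    (hκt : 0 ≤ L.κtBS) (hκr : 0 ≤ L.κrUT) (a : ℂ) (h w : Fin N → ℂ) :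
    ∫ x : ℂ × ((Fin N → ℂ) × ℂ × ℂ), ‖x.1 - a * L.downlinkSignal h w x.1 x.2‖ ^ 2
      ∂(scalarCN L.pBS).prod (downlinkNoise N) = L.pBS * L.mse a h w := by
  set g := effective h w with hg
  set c : Fin N → ℂ := fun i => -a * h i * ((Real.sqrt (L.κtBS * L.pBS) * ‖w i‖ : ℝ) : ℂ) with hc
  set β : ℂ := -a * (Real.sqrt L.noiseUT : ℂ) with hβ
  set γ : ℂ := -a * ((Real.sqrt (L.κrUT * L.pBS) * ‖g‖ : ℝ) : ℂ) with hγ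
  have hpt (x : ℂ × ((Fin N → ℂ) × ℂ × ℂ)) : x.1 - a * L.downlinkSignal h w x.1 x.2 =
      (1 - a * g) * x.1 + (c ⬝ᵥ x.2.1 + (β * x.2.2.1 + γ * x.2.2.2)) := by
    have e1 : ∑ i, h i * (w i * x.1
        + ((Real.sqrt (L.κtBS * L.pBS) * ‖w i‖ : ℝ) : ℂ) * x.2.1 i) = g * x.1
        + ∑ i, h i * (((Real.sqrt (L.κtBS * L.pBS) * ‖w i‖ : ℝ) : ℂ) * x.2.1 i) := by
      rw [hg, effective, Finset.sum_mul, ← Finset.sum_add_distrib]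
      exact Finset.sum_congr rfl fun i _ => by ring
    have e2 : c ⬝ᵥ x.2.1 = -a * ∑ i, h i
        * (((Real.sqrt (L.κtBS * L.pBS) * ‖w i‖ : ℝ) : ℂ) * x.2.1 i) := by
      rw [dotProduct, Finset.mul_sum]
      exact Finset.sum_congr rfl fun i _ => by simp only [hc]; ring
    rw [Link.downlinkSignal, e1, e2, ← hg, hβ, hγ]
    ring
  have tc := tame_dotProduct c
  have i0 : ∫ z, γ * z ∂stdCN = 0 := by rw [integral_const_mul, integral_stdCN_id, mul_zero]
  have i1 : ∫ z : ℂ × ℂ, (β * z.1 + γ * z.2) ∂stdCN.prod stdCN = 0 := by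
    rw [integral_add (Tame.integrable (by fun_prop)) (Tame.integrable (by fun_prop)),
      integral_fun_fst (f := fun z => β * z), integral_fun_snd (f := fun z => γ * z), i0,
      integral_const_mul, integral_stdCN_id]
    simp
  have i2 : ∫ e : (Fin N → ℂ) × ℂ × ℂ, (c ⬝ᵥ e.1 + (β * e.2.1 + γ * e.2.2)) ∂downlinkNoise N
      = 0 := by
    rw [integral_add (Tame.integrable (by fun_prop)) (Tame.integrable (by fun_prop)),
      downlinkNoise, integral_fun_fst (f := fun e => c ⬝ᵥ e),
      integral_fun_snd (f := fun z : ℂ × ℂ => β * z.1 + γ * z.2), i1, integral_dotProduct]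
    simp
  simp_rw [hpt]
  have j0 (δ : ℂ) : ∫ z, ‖δ * z‖ ^ 2 ∂stdCN = ‖δ‖ ^ 2 := by
    simp only [norm_mul, mul_pow]
    rw [integral_const_mul, integral_stdCN_norm_sq, mul_one]
  have j1 : ∫ s, ‖(1 - a * g) * s‖ ^ 2 ∂scalarCN L.pBS = ‖1 - a * g‖ ^ 2 * L.pBS := by
    simp only [norm_mul, mul_pow]
    rw [integral_const_mul, integral_scalarCN_norm_sq hp.le]
  have j2 : nsq c = ‖a‖ ^ 2 * (L.κtBS * L.pBS * ∑ i, ‖h i‖ ^ 2 * ‖w i‖ ^ 2) := by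
    rw [nsq, Finset.mul_sum, Finset.mul_sum]
    refine Finset.sum_congr rfl fun i _ => ?_
    rw [hc, norm_mul, norm_mul, norm_neg, Complex.norm_real, Real.norm_eq_abs,
      abs_of_nonneg (by positivity), mul_pow, mul_pow, mul_pow, Real.sq_sqrt (by positivity)]
    ring
  have j3 : ‖β‖ ^ 2 = ‖a‖ ^ 2 * L.noiseUT := by
    rw [hβ, norm_mul, norm_neg, Complex.norm_real, Real.norm_eq_abs,
      abs_of_nonneg (by positivity), mul_pow, Real.sq_sqrt hσ]
  have j4 : ‖γ‖ ^ 2 = ‖a‖ ^ 2 * (L.κrUT * L.pBS * ‖g‖ ^ 2) := by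
    rw [hγ, norm_mul, norm_neg, Complex.norm_real, Real.norm_eq_abs,
      abs_of_nonneg (by positivity), mul_pow, mul_pow, Real.sq_sqrt (by positivity)]
  rw [integral_prod_norm_sq_add (u := fun s => (1 - a * g) * s)
      (v := fun e : (Fin N → ℂ) × ℂ × ℂ => c ⬝ᵥ e.1 + (β * e.2.1 + γ * e.2.2))
      (by fun_prop) (by fun_prop) i2, downlinkNoise,
    integral_prod_norm_sq_add (u := fun e => c ⬝ᵥ e)
      (v := fun z : ℂ × ℂ => β * z.1 + γ * z.2) tc (by fun_prop) i1,
    integral_prod_norm_sq_add (u := fun z => β * z)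
      (v := fun z => γ * z) (by fun_prop) (by fun_prop) i0, j1, j0, j0,
    integral_norm_sq_dotProduct, j2, j3, j4, Link.mse]
  field_simp
  ring

end

section

variable {N : ℕ} {L : Link N}

/-! ### A lower bound on the rate of a Gaussian signal -/

theorem measurable_effective : Measurable fun c : (Fin N → ℂ) × (Fin N → ℂ) => effective c.1 c.2 := by
  unfold effective; fun_prop

theorem Link.measurable_mse (L : Link N) (a : ℂ) :
    Measurable fun c : (Fin N → ℂ) × (Fin N → ℂ) => L.mse a c.1 c.2 := by
  have := measurable_effective (N := N)
  unfold Link.mse; fun_prop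

theorem Link.mse_nonneg (L : Link N) (hL : L.Admissible) (a : ℂ) (h w : Fin N → ℂ) :
    0 ≤ L.mse a h w := by
  have h1 := hL.κtBS_nonneg
  have h2 := hL.κrUT_nonneg
  have h3 := hL.pBS_pos
  have h4 := hL.noiseUT_pos
  unfold Link.mse; positivity

theorem Link.measurable_downlinkSignal (L : Link N) (w : Beamformer N) :
    Measurable fun x : ℂ × ((Fin N → ℂ) × (Fin N → ℂ)) × ((Fin N → ℂ) × ℂ × ℂ) =>
      L.downlinkSignal x.2.1.1 (w.toFun x.2.1.2) x.1 x.2.2 := by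
  have h1 : Measurable fun x : ℂ × ((Fin N → ℂ) × (Fin N → ℂ)) × ((Fin N → ℂ) × ℂ × ℂ) =>
      w.toFun x.2.1.2 := w.measurable_toFun.comp (by fun_prop)
  have h2 : Measurable fun x : ℂ × ((Fin N → ℂ) × (Fin N → ℂ)) × ((Fin N → ℂ) × ℂ × ℂ) =>
      effective x.2.1.1 (w.toFun x.2.1.2) :=
    measurable_effective.comp ((by fun_prop : Measurable fun x :
      ℂ × ((Fin N → ℂ) × (Fin N → ℂ)) × ((Fin N → ℂ) × ℂ × ℂ) => x.2.1.1).prodMk h1)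
  have h3 (i : Fin N) : Measurable fun x :
      ℂ × ((Fin N → ℂ) × (Fin N → ℂ)) × ((Fin N → ℂ) × ℂ × ℂ) => w.toFun x.2.1.2 i :=
    (measurable_pi_apply i).comp h1
  unfold Link.downlinkSignal
  fun_prop

/-- Tonelli, arranged so that `(h, ĥ)` is frozen while signal and noises are integrated. -/
theorem lintegral_prod_prod_middle {A B C : Type*} [MeasurableSpace A] [MeasurableSpace B]
    [MeasurableSpace C] {μ : Measure A} {ρ : Measure B} {ν : Measure C} [SFinite μ] [SFinite ρ]
    [SFinite ν] {F : A × B × C → ℝ≥0∞} (hF : Measurable F) :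
    ∫⁻ x, F x ∂μ.prod (ρ.prod ν) = ∫⁻ b, ∫⁻ x, F (x.1, b, x.2) ∂μ.prod ν ∂ρ := by
  have h1 (a : A) : ∫⁻ x, F (a, x) ∂ρ.prod ν = ∫⁻ b, ∫⁻ c, F (a, b, c) ∂ν ∂ρ :=
    lintegral_prod _ (hF.comp measurable_prodMk_left).aemeasurable
  have h2 (b : B) : ∫⁻ x, F (x.1, b, x.2) ∂μ.prod ν = ∫⁻ a, ∫⁻ c, F (a, b, c) ∂ν ∂μ :=
    lintegral_prod (fun x : A × C => F (x.1, b, x.2)) (by fun_prop)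
  rw [lintegral_prod _ hF.aemeasurable]
  simp only [h1, h2]
  have h3 : Measurable fun x : (A × B) × C => F (x.1.1, x.1.2, x.2) := by fun_prop
  exact lintegral_lintegral_swap h3.lintegral_prod_right'.aemeasurable

theorem lintegral_receiver_error (hL : L.Admissible) (w : Beamformer N) (a : ℂ)
    (ρ : Measure ((Fin N → ℂ) × (Fin N → ℂ))) [IsProbabilityMeasure ρ] :
    ∫⁻ x, ENNReal.ofReal (‖x.1 - a * x.2‖ ^ 2) ∂L.signalLaw w (scalarCN L.pBS) ρ =
      ∫⁻ c, ENNReal.ofReal (L.pBS * L.mse a c.1 (w.toFun c.2)) ∂ρ := by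
  have hm := L.measurable_downlinkSignal w
  have hF : Measurable fun x : ℂ × ((Fin N → ℂ) × (Fin N → ℂ)) × ((Fin N → ℂ) × ℂ × ℂ) =>
      ENNReal.ofReal (‖x.1 - a * L.downlinkSignal x.2.1.1 (w.toFun x.2.1.2) x.1 x.2.2‖ ^ 2) :=
    ENNReal.measurable_ofReal.comp (((measurable_fst.sub (hm.const_mul a)).norm).pow_const 2)
  rw [Link.signalLaw, lintegral_map (by fun_prop) (measurable_fst.prodMk hm)]
  refine (lintegral_prod_prod_middle hF).trans (lintegral_congr fun c => ?_)
  rw [← L.integral_receiver_error hL.pBS_pos hL.noiseUT_pos.le hL.κtBS_nonneg hL.κrUT_nonneg a c.1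
      (w.toFun c.2)]
  refine (ofReal_integral_eq_lintegral_ofReal (Tame.integrable ?_)
    (.of_forall fun _ => by positivity)).symm
  unfold Link.downlinkSignal
  dsimp only
  generalize w.toFun c.2 = v
  fun_prop

instance (w : Beamformer N) (f : Measure ℂ) [IsProbabilityMeasure f]
    (ρ : Measure ((Fin N → ℂ) × (Fin N → ℂ))) [IsProbabilityMeasure ρ] :
    IsProbabilityMeasure (L.signalLaw w f ρ) :=
  Measure.isProbabilityMeasure_map
    (measurable_fst.prodMk (L.measurable_downlinkSignal w)).aemeasurable

theorem Link.signalLaw_fst (w : Beamformer N) (f : Measure ℂ) [IsProbabilityMeasure f]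
    (ρ : Measure ((Fin N → ℂ) × (Fin N → ℂ))) [IsProbabilityMeasure ρ] :
    (L.signalLaw w f ρ).fst = f := by
  rw [Link.signalLaw, Measure.fst_map_prodMk (L.measurable_downlinkSignal w)]
  exact measurePreserving_fst.map_eq

/-- The information that a Gaussian signal conveys is at least what an additive Gaussian test
channel with receiver gain `a` and error level `t` predicts. -/
theorem Link.le_mutualInfo (hL : L.Admissible) (w : Beamformer N) (a : ℂ) {t : ℝ} (ht : 0 < t)
    (ρ : Measure ((Fin N → ℂ) × (Fin N → ℂ))) [IsProbabilityMeasure ρ]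
    (hint : Integrable (fun c => L.mse a c.1 (w.toFun c.2)) ρ) :
    ENNReal.ofReal ((Real.log (1 / t) - (∫ c, L.mse a c.1 (w.toFun c.2) ∂ρ) / t + 1) / Real.log 2)
      ≤ mutualInfo (L.signalLaw w (scalarCN L.pBS) ρ) := by
  have hp := hL.pBS_pos
  set p := L.pBS with hpdef
  set P := L.signalLaw w (scalarCN p) ρ with hP
  have htp : 0 < p * t := by positivity
  -- The log-likelihood ratio of the test channel `CN(a y, p t)` to the prior `CN(0, p)`; the level
  -- is `p t` because `mse` is measured relative to `p`.
  let φ : ℂ × ℂ → ℝ := fun x =>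
    Real.log (p / (p * t)) - ‖x.1 - a * x.2‖ ^ 2 / (p * t) + ‖x.1‖ ^ 2 / p
  have hφm : Measurable φ := by fun_prop
  have hfst : P.fst = scalarCN p := Link.signalLaw_fst w _ ρ
  have herr := lintegral_receiver_error hL w a ρ
  rw [← hpdef, ← hP] at herr
  have hmn : 0 ≤ᵐ[ρ] fun c => p * L.mse a c.1 (w.toFun c.2) :=
    .of_forall fun c => mul_nonneg hp.le (L.mse_nonneg hL a _ _)
  have hmi := hint.const_mul p
  rw [← ofReal_integral_eq_lintegral_ofReal hmi hmn] at herr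
  have hI1 : Integrable (fun x : ℂ × ℂ => ‖x.1 - a * x.2‖ ^ 2) P := by
    refine ⟨by fun_prop, ?_⟩
    rw [hasFiniteIntegral_iff_ofReal (.of_forall fun x => by positivity), herr]
    exact ENNReal.ofReal_lt_top
  have hE1 : ∫ x, ‖x.1 - a * x.2‖ ^ 2 ∂P = p * ∫ c, L.mse a c.1 (w.toFun c.2) ∂ρ := by
    rw [integral_eq_lintegral_of_nonneg_ae (.of_forall fun x => by positivity)
      hI1.aestronglyMeasurable, herr, ENNReal.toReal_ofReal (integral_nonneg_of_ae hmn),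
      integral_const_mul]
  have hs : Integrable (fun s : ℂ => ‖s‖ ^ 2) P.fst := by
    rw [hfst]; exact Tame.integrable (by fun_prop)
  have hI2 : Integrable (fun x : ℂ × ℂ => ‖x.1‖ ^ 2) P := hs.comp_measurable measurable_fst
  have hE2 : ∫ x, ‖x.1‖ ^ 2 ∂P = p := by
    rw [← integral_scalarCN_norm_sq hp.le, ← hfst, Measure.fst,
      integral_map measurable_fst.aemeasurable (by fun_prop)]
  have hφi : Integrable φ P :=
    ((integrable_const _).sub (hI1.div_const _)).add (hI2.div_const _)
  have hφE : ∫ x, φ x ∂P =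
      Real.log (1 / t) - (∫ c, L.mse a c.1 (w.toFun c.2) ∂ρ) / t + 1 := by
    have hsub : Integrable (fun x : ℂ × ℂ =>
      Real.log (p / (p * t)) - ‖x.1 - a * x.2‖ ^ 2 / (p * t)) P :=
      (integrable_const _).sub (hI1.div_const _)
    simp only [φ]
    rw [integral_add hsub (hI2.div_const _), integral_sub (integrable_const _) (hI1.div_const _),
      integral_div, integral_div, hE1, hE2]
    simp only [integral_const, probReal_univ, one_smul]
    have : p / (p * t) = 1 / t := by field_simp
    rw [this]
    field_simp
  have hexp : ∫⁻ x, ENNReal.ofReal (Real.exp (φ x)) ∂(P.fst.prod P.snd) ≤ 1 := by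
    rw [hfst, lintegral_prod_symm _ (by fun_prop)]
    simp only [φ, lintegral_scalarCN_tilt hp htp]
    simp
  have hkl := ofReal_integral_le_klDiv hφm hφi hexp
  rw [hφE] at hkl
  rw [mutualInfo, ENNReal.ofReal_div_of_pos (Real.log_pos one_lt_two)]
  exact ENNReal.div_le_div_right hkl _

/-- The averaged rate of a Gaussian signal is at least the rate predicted by the mean square error
of any linear receiver, whatever the terminal knows. -/
theorem Link.le_rate (hL : L.Admissible) {𝒢 : Type*} [MeasurableSpace 𝒢]
    (csi : TerminalCSI 𝒢 L.channelLaw) (w : Beamformer N) (a : ℂ)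
    (hint : Integrable (fun c => L.mse a c.1 (w.toFun c.2)) L.channelLaw)
    (hpos : 0 < ∫ c, L.mse a c.1 (w.toFun c.2) ∂L.channelLaw) :
    ENNReal.ofReal (Real.logb 2 (1 / ∫ c, L.mse a c.1 (w.toFun c.2) ∂L.channelLaw)) ≤
      L.rate csi w (scalarCN L.pBS) := by
  have := csi.isProbability
  have := csi.isMarkov
  set t := ∫ c, L.mse a c.1 (w.toFun c.2) ∂L.channelLaw with ht
  have havg := csi.average
  rw [Measure.comp_eq_comp_const_apply] at havg
  rw [← havg] at hint
  have hae : ∀ᵐ γ ∂csi.law, Integrable (fun c => L.mse a c.1 (w.toFun c.2)) (csi.posterior γ) :=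
    hint.ae_of_comp
  have hI : Integrable (fun γ => ∫ c, L.mse a c.1 (w.toFun c.2) ∂csi.posterior γ) csi.law :=
    hint.integral_comp
  have hE : ∫ γ, ∫ c, L.mse a c.1 (w.toFun c.2) ∂csi.posterior γ ∂csi.law = t := by
    have h := Kernel.integral_comp hint
    rw [havg] at h
    exact h.symm
  -- The same `a` and `t` are used for every posterior, so the bound is affine in the conditional
  -- error and its average is exactly `log(1/t)`. It may be negative for some blocks, whence
  -- `ofReal_integral_le_lintegral` when passing to the extended nonnegative integral.
  have hJ : Integrable (fun γ => (Real.log (1 / t)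
      - (∫ c, L.mse a c.1 (w.toFun c.2) ∂csi.posterior γ) / t + 1) / Real.log 2) csi.law :=
    (((integrable_const _).sub (hI.div_const _)).add (integrable_const _)).div_const _
  have hJE : ∫ γ, (Real.log (1 / t)
      - (∫ c, L.mse a c.1 (w.toFun c.2) ∂csi.posterior γ) / t + 1) / Real.log 2 ∂csi.law
      = Real.logb 2 (1 / t) := by
    have hsub : Integrable (fun γ => Real.log (1 / t)
      - (∫ c, L.mse a c.1 (w.toFun c.2) ∂csi.posterior γ) / t) csi.law :=
      (integrable_const _).sub (hI.div_const _)
    rw [integral_div, integral_add hsub (integrable_const _),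
      integral_sub (integrable_const _) (hI.div_const _), integral_div, hE, div_self hpos.ne']
    simp [Real.logb]
  rw [← hJE]
  refine (ofReal_integral_le_lintegral hJ).trans (lintegral_mono_ae ?_)
  filter_upwards [hae] with γ hγ
  exact Link.le_mutualInfo hL w a hpos _ hγ

end

section

variable {N : ℕ} {L : Link N}

/-! ### The estimate is almost surely nonzero -/

theorem stdCN_singleton (z : ℂ) : stdCN {z} = 0 := by
  rw [stdCN, Measure.map_apply tame_complexMk.measurable (measurableSet_singleton z)]
  refine measure_mono_null (t := {z.re} ×ˢ Set.univ) ?_ ?_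
  · rintro x hx
    have hx' : (⟨x.1, x.2⟩ : ℂ) = z := hx
    exact ⟨congrArg Complex.re hx', trivial⟩
  · have := nullSingletonClass_gaussianReal (μ := 0) (v := 1 / 2) (by norm_num)
    rw [Measure.prod_prod, measure_singleton, zero_mul]

/-- Once all coordinates but one with `c k ≠ 0` are fixed, the equation determines the last one, and
`stdCN` has no atoms. -/
theorem whiteCN_hyperplane {c : Fin N → ℂ} (hc : c ≠ 0) (b : ℂ) :
    whiteCN N {g | c ⬝ᵥ g = b} = 0 := by
  obtain ⟨k, hk⟩ := Function.ne_iff.1 hc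
  cases N with
  | zero => exact k.elim0
  | succ n =>
    have hmp := measurePreserving_piFinSuccAbove (fun _ : Fin (n + 1) => stdCN) k
    let s : Set (ℂ × (Fin n → ℂ)) := {x | c k * x.1 + ∑ j, c (k.succAbove j) * x.2 j = b}
    have hs : MeasurableSet s := measurableSet_eq_fun (by fun_prop) measurable_const
    have hpre : {g : Fin (n + 1) → ℂ | c ⬝ᵥ g = b} =
        MeasurableEquiv.piFinSuccAbove (fun _ => ℂ) k ⁻¹' s := by
      ext g
      simp only [Set.mem_ofPred_eq, Set.mem_preimage, s, dotProduct, Fin.sum_univ_succAbove _ k]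
      rfl
    rw [hpre, whiteCN, hmp.measure_preimage hs.nullMeasurableSet, Measure.prod_apply_symm hs]
    refine (lintegral_congr fun y => ?_).trans lintegral_zero
    refine measure_mono_null (t := {(b - ∑ j, c (k.succAbove j) * y j) / c k}) ?_
      (stdCN_singleton _)
    intro z hz
    have hz' : c k * z + ∑ j, c (k.succAbove j) * y j = b := hz
    rw [Set.mem_singleton_iff, eq_div_iff hk, ← hz']
    ring

/-- Given the other noises, vanishing of one suitable coordinate of the estimate confines the
thermal noise to a hyperplane. The result is needed because `mrt 0 = 0` is not a unit vector: the
admissible strategy differs from `mrt` there, on a null event. -/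
theorem WhiteUplink.ae_est_ne_zero (P : WhiteUplink N) (hBK : P.B * P.K ≠ 0) :
    ∀ᵐ ω ∂white4 N, P.est ω ≠ 0 := by
  obtain ⟨i, hi⟩ := Function.ne_iff.1 hBK
  let s : Set (Sample N) := {ω | P.sig ω i + (P.B * P.K) i ⬝ᵥ ω.2.2.1 = 0}
  have hs : MeasurableSet s := by
    refine measurableSet_eq_fun ?_ measurable_const
    exact (by fun_prop : Tame fun ω => P.sig ω i + (P.B * P.K) i ⬝ᵥ ω.2.2.1).measurable
  have h0 : white4 N s = 0 := by
    rw [white4, Measure.measure_prod_null hs]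
    refine .of_forall fun g => ?_
    have hs1 : MeasurableSet (Prod.mk g ⁻¹' s) := hs.preimage measurable_prodMk_left
    refine (Measure.measure_prod_null hs1).2 (.of_forall fun z => ?_)
    have hs2 : MeasurableSet (Prod.mk z ⁻¹' (Prod.mk g ⁻¹' s)) :=
      hs1.preimage measurable_prodMk_left
    change ((whiteCN N).prod (whiteCN N)) (Prod.mk z ⁻¹' (Prod.mk g ⁻¹' s)) = 0
    rw [Measure.prod_apply_symm hs2]
    refine (lintegral_congr fun e => ?_).trans lintegral_zero
    refine measure_mono_null ?_ (whiteCN_hyperplane hi (-P.sig (g, z, 0, e) i))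
    intro g' hg'
    have h1 : P.sig (g, z, 0, e) i + (P.B * P.K) i ⬝ᵥ g' = 0 := hg'
    exact eq_neg_of_add_eq_zero_right h1
  refine measure_mono_null (fun ω hω => ?_) h0
  have h1 : P.est ω = 0 := not_not.1 hω
  exact congrFun h1 i

theorem Link.Admissible.ae_estimate_ne_zero (h : L.Admissible) (hR : L.R ≠ 0) :
    ∀ᵐ u ∂L.uplink, L.estimate u ≠ 0 := by
  have hK : IsUnit (CFC.sqrt L.S) := by
    have h1 : IsUnit (CFC.sqrt L.S * CFC.sqrt L.S) := by
      rw [sqrt_mul_sqrt h.S_posDef.posSemidef]; exact h.S_posDef.isUnit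
    rw [Matrix.isUnit_iff_isUnit_det, Matrix.det_mul] at h1
    exact (Matrix.isUnit_iff_isUnit_det _).2 (isUnit_of_mul_isUnit_left h1)
  have hBK : L.white.B * L.white.K ≠ 0 := by
    change L.R * L.gram⁻¹ * CFC.sqrt L.S ≠ 0
    rw [Ne, hK.mul_left_eq_zero, h.gram_posDef.inv.isUnit.mul_left_eq_zero]
    exact hR
  have hm : Measurable L.estimate := by
    have h2 : Tame L.received := by unfold Link.received; fun_prop
    exact (by unfold Link.estimate; fun_prop : Tame L.estimate).measurable
  have hset : MeasurableSet {u | L.estimate u ≠ 0} := hm (measurableSet_singleton 0).compl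
  rw [L.uplink_eq_map, ae_map_iff L.tame_colour.measurable.aemeasurable hset]
  filter_upwards [L.white.ae_est_ne_zero hBK] with ω hω
  rw [L.estimate_colour]
  exact smul_ne_zero (star_ne_zero.2 h.d_ne_zero) hω

/-! ### Maximum ratio transmission -/

theorem l2norm_mrt {x : Fin N → ℂ} (hx : x ≠ 0) : l2norm (mrt x) = 1 := by
  have hn : l2norm x ≠ 0 := fun h => hx (l2norm_eq_zero.1 h)
  have h : mrt x = ((l2norm x)⁻¹ : ℂ) • star x := by
    ext i; simp only [mrt, Pi.smul_apply, Pi.star_apply, smul_eq_mul]; field_simp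
  have hs : l2norm (star x) = l2norm x := by
    have := nsq_star x
    rw [← l2norm_sq, ← l2norm_sq] at this
    exact (pow_left_inj₀ (l2norm_nonneg _) (l2norm_nonneg _) two_ne_zero).1 this
  rw [h, l2norm_smul, hs, norm_inv, Complex.norm_real, Real.norm_eq_abs,
    abs_of_nonneg (l2norm_nonneg _), inv_mul_cancel₀ hn]

theorem nsq_mrt_le (x : Fin N → ℂ) : nsq (mrt x) ≤ 1 := by
  by_cases hx : x = 0
  · have : mrt x = 0 := by ext i; simp [mrt, hx]
    rw [this]; simp [nsq]
  · rw [← l2norm_sq, l2norm_mrt hx, one_pow]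

theorem measurable_mrt : Measurable (mrt : (Fin N → ℂ) → Fin N → ℂ) := by
  refine measurable_pi_lambda _ fun i => ?_
  have h1 : Tame fun x : Fin N → ℂ => (l2norm x : ℂ) := by fun_prop
  have h2 : Tame fun x : Fin N → ℂ => star (x i) := by fun_prop
  exact h2.measurable.div h1.measurable

theorem norm_mrt_apply_le (x : Fin N → ℂ) (i : Fin N) : ‖mrt x i‖ ≤ 1 := by
  have h : ‖mrt x i‖ ^ 2 ≤ 1 :=
    (Finset.single_le_sum (f := fun i => ‖mrt x i‖ ^ 2) (fun _ _ => by positivity)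
      (Finset.mem_univ i)).trans (nsq_mrt_le x)
  exact (sq_le_one_iff₀ (norm_nonneg _)).1 h

@[fun_prop]
theorem tame_mrt : Tame (mrt : (Fin N → ℂ) → Fin N → ℂ) := by
  refine Tame.of_le measurable_mrt 1 0 fun x => ?_
  rw [pow_zero, mul_one]
  exact (pi_norm_le_iff_of_nonneg zero_le_one).2 fun i => norm_mrt_apply_le x i

@[fun_prop]
theorem Link.tame_estimate (L : Link N) : Tame L.estimate := by
  unfold Link.estimate Link.received; fun_prop

@[fun_prop]
theorem Link.tame_mrtGain (L : Link N) : Tame L.mrtGain := by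
  unfold Link.mrtGain effective; fun_prop

/-- Maximum ratio transmission as a strategy, with an arbitrary unit vector for a zero estimate. -/
def mrtBeamformer (i : Fin N) : Beamformer N where
  toFun x := if x = 0 then Pi.single i 1 else mrt x
  measurable_toFun := Measurable.ite (measurableSet_singleton 0) measurable_const measurable_mrt
  unit_norm x := by
    split_ifs with hx
    · have h1 : nsq (Pi.single i (1 : ℂ) : Fin N → ℂ) = 1 := by
        rw [nsq, Finset.sum_eq_single i] <;> simp +contextual
      rw [← l2norm_sq] at h1
      exact (pow_eq_one_iff_of_nonneg (l2norm_nonneg _) two_ne_zero).1 h1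
    · exact l2norm_mrt hx

/-- The power of the received signal, relative to the signal power. -/
def Link.mrtPower (L : Link N) : ℝ :=
  (1 + L.κrUT) * (∫ u, ‖L.mrtGain u‖ ^ 2 ∂L.uplink)
    + L.κtBS * (∑ i, ∫ u, ‖u.1 i‖ ^ 2 * ‖mrt (L.estimate u) i‖ ^ 2 ∂L.uplink)
    + L.noiseUT / L.pBS

theorem Link.mrtSINR_eq (L : Link N) : L.mrtSINR = ‖∫ u, L.mrtGain u ∂L.uplink‖ ^ 2 /
    (L.mrtPower - ‖∫ u, L.mrtGain u ∂L.uplink‖ ^ 2) := by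
  rw [Link.mrtSINR, Link.mrtPower]
  congr 1
  ring

theorem norm_integral_sq_le {E : Type*} [NormedAddCommGroup E] [MeasurableSpace E] [BorelSpace E]
    {μ : Measure E} [HasMoments μ] {f : E → ℂ} (hf : Tame f) :
    ‖∫ x, f x ∂μ‖ ^ 2 ≤ ∫ x, ‖f x‖ ^ 2 ∂μ := by
  set m := ∫ x, ‖f x‖ ∂μ with hm
  have h1 : ‖∫ x, f x ∂μ‖ ≤ m := norm_integral_le_integral_norm _
  have h2 : 0 ≤ ∫ x, (‖f x‖ - m) ^ 2 ∂μ := integral_nonneg fun x => sq_nonneg _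
  have h3 : ∫ x, (‖f x‖ - m) ^ 2 ∂μ = (∫ x, ‖f x‖ ^ 2 ∂μ) - m ^ 2 := by
    have h (x : E) : (‖f x‖ - m) ^ 2 = ‖f x‖ ^ 2 - 2 * m * ‖f x‖ + m ^ 2 := by ring
    simp_rw [h]
    rw [integral_add (Tame.integrable (by fun_prop)) (Tame.integrable (by fun_prop)),
      integral_sub (Tame.integrable (by fun_prop)) (Tame.integrable (by fun_prop)),
      integral_const_mul, ← hm]
    simp only [integral_const, probReal_univ, one_smul]
    ring
  have h4 := pow_le_pow_left₀ (norm_nonneg _) h1 2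
  linarith

/-- Strictness comes from the thermal noise term `noiseUT / pBS`; the rest is Jensen's inequality.
-/
theorem Link.Admissible.lt_mrtPower (h : L.Admissible) :
    ‖∫ u, L.mrtGain u ∂L.uplink‖ ^ 2 < L.mrtPower := by
  have h1 := norm_integral_sq_le (μ := L.uplink) L.tame_mrtGain
  have h2 : 0 ≤ ∫ u, ‖L.mrtGain u‖ ^ 2 ∂L.uplink := integral_nonneg fun u => by positivity
  have h3 : 0 ≤ ∑ i, ∫ u, ‖u.1 i‖ ^ 2 * ‖mrt (L.estimate u) i‖ ^ 2 ∂L.uplink :=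
    Finset.sum_nonneg fun i _ => integral_nonneg fun u => by positivity
  have h4 : 0 < L.noiseUT / L.pBS := div_pos h.noiseUT_pos h.pBS_pos
  have h5 := mul_nonneg h.κrUT_nonneg h2
  have h6 := mul_nonneg h.κtBS_nonneg h3
  rw [Link.mrtPower]
  linarith

theorem tame_mse_mrt (L : Link N) (a : ℂ) :
    Tame fun u : WhiteUplink.Sample N => L.mse a u.1 (mrt (L.estimate u)) := by
  unfold Link.mse effective; fun_prop

/-- The mean square error is a quadratic function of the receiver coefficient `a`, determined by the
mean gain and the received power alone. -/
theorem integral_mse_mrt (L : Link N) (a : ℂ) :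
    ∫ u, L.mse a u.1 (mrt (L.estimate u)) ∂L.uplink =
      1 - 2 * (a * ∫ u, L.mrtGain u ∂L.uplink).re + ‖a‖ ^ 2 * L.mrtPower := by
  have hpt (u : WhiteUplink.Sample N) : L.mse a u.1 (mrt (L.estimate u)) =
      1 - 2 * (a * L.mrtGain u).re + ‖a‖ ^ 2 * ((1 + L.κrUT) * ‖L.mrtGain u‖ ^ 2
        + L.κtBS * (∑ i, ‖u.1 i‖ ^ 2 * ‖mrt (L.estimate u) i‖ ^ 2) + L.noiseUT / L.pBS) := by
    have h1 : ‖1 - a * L.mrtGain u‖ ^ 2 = 1 - 2 * (a * L.mrtGain u).re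
        + ‖a‖ ^ 2 * ‖L.mrtGain u‖ ^ 2 := by
      rw [← mul_pow, ← norm_mul]
      generalize a * L.mrtGain u = w
      simp only [← Complex.normSq_eq_norm_sq, Complex.normSq_apply, Complex.sub_re,
        Complex.sub_im, Complex.one_re, Complex.one_im]
      ring
    change ‖1 - a * L.mrtGain u‖ ^ 2 + ‖a‖ ^ 2 * (L.κtBS * (∑ i, ‖u.1 i‖ ^ 2
      * ‖mrt (L.estimate u) i‖ ^ 2) + L.noiseUT / L.pBS + L.κrUT * ‖L.mrtGain u‖ ^ 2) = _
    rw [h1]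
    ring
  have t0 : Tame fun u => a * L.mrtGain u := by fun_prop
  have t1 : Tame fun u => 2 * (a * L.mrtGain u).re := (tame_const 2).mul (Tame.re t0)
  have t2 : Tame fun u => 1 - 2 * (a * L.mrtGain u).re := (tame_const 1).sub t1
  have hre : ∫ u, (a * L.mrtGain u).re ∂L.uplink = (a * ∫ u, L.mrtGain u ∂L.uplink).re := by
    rw [← integral_const_mul]
    exact integral_re (𝕜 := ℂ) (t0.integrable (μ := L.uplink))
  simp_rw [hpt]
  rw [integral_add t2.integrable (Tame.integrable (by fun_prop)),
    integral_sub (Tame.integrable (by fun_prop)) t1.integrable, integral_const_mul, hre,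
    integral_const_mul,
    integral_add (Tame.integrable (by fun_prop)) (Tame.integrable (by fun_prop)),
    integral_add (Tame.integrable (by fun_prop)) (Tame.integrable (by fun_prop)),
    integral_const_mul, integral_const_mul,
    integral_finsetSum _ fun i _ => Tame.integrable (by fun_prop)]
  simp only [integral_const, probReal_univ, one_smul]
  rfl

/-- The rate of maximum ratio transmission with a receiver that knows only the statistics of the
effective channel is a lower bound on the capacity. -/
theorem Link.Admissible.mrtLower_le_capacity (h : L.Admissible) (hN : 1 ≤ N) {𝒢 : Type*}
    [MeasurableSpace 𝒢] (csi : Beamformer N → TerminalCSI 𝒢 L.channelLaw) :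
    L.mrtLower ≤ L.capacity csi := by
  -- For `R = 0` the estimate vanishes identically and is not almost surely nonzero, but then the
  -- SINR is `0` and the bound is trivial.
  by_cases hR : L.R = 0
  · have hB : L.lmmse = 0 := by rw [Link.lmmse, hR]; simp
    have hg (u : WhiteUplink.Sample N) : L.mrtGain u = 0 := by
      rw [Link.mrtGain, Link.estimate, hB, effective]
      refine Finset.sum_eq_zero fun i _ => ?_
      simp [mrt]
    have : L.mrtSINR = 0 := by rw [Link.mrtSINR_eq]; simp [hg]
    rw [Link.mrtLower, this]
    simp
  · obtain ⟨w, hw⟩ : ∃ w : Beamformer N, ∀ x, x ≠ 0 → w.toFun x = mrt x :=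
      ⟨mrtBeamformer ⟨0, hN⟩, fun x hx => if_neg hx⟩
    set m := ∫ u, L.mrtGain u ∂L.uplink with hm
    set D := L.mrtPower with hD
    have hlt : ‖m‖ ^ 2 < D := h.lt_mrtPower
    have hD0 : 0 < D := lt_of_le_of_lt (by positivity) hlt
    -- The minimizer of the quadratic in `integral_mse_mrt`; the minimum `(D - ‖m‖²) / D` is the
    -- inverse of `1 + SINR`.
    set a : ℂ := star m / (D : ℂ) with ha
    have hmeas : Measurable fun u : WhiteUplink.Sample N => (u.1, L.estimate u) :=
      measurable_fst.prodMk L.tame_estimate.measurable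
    have hpair : Measurable fun c : (Fin N → ℂ) × (Fin N → ℂ) => (c.1, w.toFun c.2) :=
      measurable_fst.prodMk (w.measurable_toFun.comp measurable_snd)
    have hmm : Measurable fun c : (Fin N → ℂ) × (Fin N → ℂ) => L.mse a c.1 (w.toFun c.2) := by
      have hcomp := (L.measurable_mse a).comp hpair
      exact hcomp
    have hae : (fun u => L.mse a u.1 (w.toFun (L.estimate u))) =ᵐ[L.uplink]
        fun u => L.mse a u.1 (mrt (L.estimate u)) := by
      filter_upwards [h.ae_estimate_ne_zero hR] with u hu
      rw [hw _ hu]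
    have hint : Integrable (fun c => L.mse a c.1 (w.toFun c.2)) L.channelLaw := by
      rw [Link.channelLaw, integrable_map_measure hmm.aestronglyMeasurable hmeas.aemeasurable]
      exact ((tame_mse_mrt L a).integrable).congr hae.symm
    have hval : ∫ c, L.mse a c.1 (w.toFun c.2) ∂L.channelLaw = (D - ‖m‖ ^ 2) / D := by
      rw [Link.channelLaw, integral_map hmeas.aemeasurable hmm.aestronglyMeasurable,
        integral_congr_ae hae, integral_mse_mrt, ← hm, ← hD]
      have h1 : a * m = ((‖m‖ ^ 2 / D : ℝ) : ℂ) := by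
        rw [ha, div_mul_eq_mul_div, mul_comm, Complex.star_def, Complex.mul_conj,
          Complex.normSq_eq_norm_sq]
        push_cast; rfl
      have h2 : ‖a‖ ^ 2 = ‖m‖ ^ 2 / D ^ 2 := by
        rw [ha, norm_div, norm_star, Complex.norm_real, Real.norm_eq_abs, abs_of_pos hD0, div_pow]
      rw [h1, h2, Complex.ofReal_re]
      field_simp
      ring
    have hpos : 0 < (D - ‖m‖ ^ 2) / D := div_pos (by linarith) hD0
    have hrate := Link.le_rate h (csi w) w a hint (by rw [hval]; exact hpos)
    rw [hval] at hrate
    have hS : 1 + L.mrtSINR = 1 / ((D - ‖m‖ ^ 2) / D) := by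
      have : D - ‖m‖ ^ 2 ≠ 0 := by linarith
      rw [Link.mrtSINR_eq, ← hm, ← hD]
      field_simp
      ring
    rw [Link.mrtLower, hS]
    exact hrate.trans (le_iSup_of_le w (le_iSup₂_of_le (scalarCN L.pBS)
      (scalarCN_mem_signalLaws h.pBS_pos.le) le_rfl))

end

section

variable {N : ℕ} {L : Link N}

/-! ### The SINR in terms of the normalized gain -/

/-- The power of the transmitter distortion and the thermal noise, in units of the signal gain. -/
def Link.residual (L : Link N) : ℝ :=
  (L.κtBS * (∑ i, ∫ u, ‖u.1 i‖ ^ 2 * ‖mrt (L.estimate u) i‖ ^ 2 ∂L.uplink)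
    + L.noiseUT / L.pBS) / (L.pUT * L.gainTrace)

/-- The mean of the normalized gain. -/
def Link.gainMean (L : Link N) : ℂ := ∫ ω, L.white.normalizedGain L.gainTrace ω ∂white4 N

/-- The mean square of the normalized gain. -/
def Link.gainPower (L : Link N) : ℝ := ∫ ω, ‖L.white.normalizedGain L.gainTrace ω‖ ^ 2 ∂white4 N

/-- The mean square distance of the normalized gain from its limit. -/
def Link.gainError (L : Link N) : ℝ :=
  ∫ ω, ‖L.white.normalizedGain L.gainTrace ω - L.white.amp ω‖ ^ 2 ∂white4 N

theorem Link.Admissible.normalizedGain_eq (h : L.Admissible) (hT : 0 < L.gainTrace)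
    (ω : WhiteUplink.Sample N) :
    L.mrtGain (L.colour ω) =
      (‖L.d‖ * Real.sqrt L.gainTrace : ℝ) * L.white.normalizedGain L.gainTrace ω := by
  have h1 : ((‖L.d‖ * Real.sqrt L.gainTrace : ℝ) : ℂ) ≠ 0 :=
    Complex.ofReal_ne_zero.2 (mul_pos (norm_pos_iff.2 h.d_ne_zero) (Real.sqrt_pos.2 hT)).ne'
  rw [L.mrtGain_colour]
  exact (mul_div_cancel₀ _ h1).symm

theorem Link.Admissible.norm_sq_integral_mrtGain (h : L.Admissible) (hT : 0 < L.gainTrace) :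
    ‖∫ u, L.mrtGain u ∂L.uplink‖ ^ 2 = L.pUT * L.gainTrace * ‖L.gainMean‖ ^ 2 := by
  rw [L.integral_uplink L.tame_mrtGain.measurable]
  simp_rw [h.normalizedGain_eq hT]
  rw [integral_const_mul, ← Link.gainMean, norm_mul, Complex.norm_real, Real.norm_eq_abs,
    abs_of_nonneg (by positivity), mul_pow, mul_pow, Real.sq_sqrt hT.le, Link.pUT]

theorem Link.Admissible.integral_norm_sq_mrtGain (h : L.Admissible) (hT : 0 < L.gainTrace) :
    ∫ u, ‖L.mrtGain u‖ ^ 2 ∂L.uplink = L.pUT * L.gainTrace * L.gainPower := by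
  rw [L.integral_uplink (L.tame_mrtGain.norm.pow 2).measurable]
  simp_rw [h.normalizedGain_eq hT, norm_mul, mul_pow]
  rw [integral_const_mul, ← Link.gainPower, Complex.norm_real, Real.norm_eq_abs,
    abs_of_nonneg (by positivity), mul_pow, Real.sq_sqrt hT.le, Link.pUT]

theorem Link.Admissible.mrtPower_sub_eq (h : L.Admissible) (hT : 0 < L.gainTrace) :
    L.mrtPower - ‖∫ u, L.mrtGain u ∂L.uplink‖ ^ 2 = L.pUT * L.gainTrace *
      ((1 + L.κrUT) * L.gainPower - ‖L.gainMean‖ ^ 2 + L.residual) := by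
  have hq := h.pUT_pos
  rw [h.norm_sq_integral_mrtGain hT, Link.mrtPower, h.integral_norm_sq_mrtGain hT, Link.residual]
  field_simp
  ring

theorem Link.Admissible.denominator_pos (h : L.Admissible) (hT : 0 < L.gainTrace) :
    0 < (1 + L.κrUT) * L.gainPower - ‖L.gainMean‖ ^ 2 + L.residual := by
  have h1 := h.lt_mrtPower
  rw [← sub_pos, h.mrtPower_sub_eq hT] at h1
  exact pos_of_mul_pos_right h1 (mul_pos h.pUT_pos hT).le

theorem Link.Admissible.mrtSINR_eq_div (h : L.Admissible) (hT : 0 < L.gainTrace) :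
    L.mrtSINR = ‖L.gainMean‖ ^ 2 /
      ((1 + L.κrUT) * L.gainPower - ‖L.gainMean‖ ^ 2 + L.residual) := by
  rw [Link.mrtSINR_eq, h.mrtPower_sub_eq hT, h.norm_sq_integral_mrtGain hT,
    mul_div_mul_left _ _ (mul_pos h.pUT_pos hT).ne']

theorem Link.norm_sq_gainMean_sub_one_le (L : Link N) : ‖L.gainMean - 1‖ ^ 2 ≤ L.gainError := by
  have h1 : L.gainMean - 1 =
      ∫ ω, (L.white.normalizedGain L.gainTrace ω - L.white.amp ω) ∂white4 N := by
    rw [integral_sub (Tame.integrable (by fun_prop)) (Tame.integrable (by fun_prop)),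
      WhiteUplink.integral_amp]
    rfl
  rw [h1]
  exact norm_integral_sq_le (by fun_prop)

/-- Young's inequality on the cross term. The free `ε` lets a small mean square distance be
converted into closeness of the second moments. -/
theorem abs_norm_sq_sub_le {ε : ℝ} (hε : 0 < ε) (x a : ℂ) :
    |‖x‖ ^ 2 - ‖a‖ ^ 2| ≤ (1 + 1 / ε) * ‖x - a‖ ^ 2 + ε * ‖a‖ ^ 2 := by
  have h1 : |‖x‖ - ‖a‖| ≤ ‖x - a‖ := abs_norm_sub_norm_le x a
  have h2 : ‖x‖ ≤ ‖a‖ + ‖x - a‖ := norm_le_norm_add_norm_sub' x a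
  have h3 : 2 * ‖a‖ * ‖x - a‖ ≤ 1 / ε * ‖x - a‖ ^ 2 + ε * ‖a‖ ^ 2 := by
    have : 1 / ε * ‖x - a‖ ^ 2 + ε * ‖a‖ ^ 2 - 2 * ‖a‖ * ‖x - a‖ =
        (‖x - a‖ - ε * ‖a‖) ^ 2 / ε := by field_simp; ring
    have : 0 ≤ (‖x - a‖ - ε * ‖a‖) ^ 2 / ε := by positivity
    linarith
  rw [sq_sub_sq, abs_mul, abs_of_nonneg (by positivity : 0 ≤ ‖x‖ + ‖a‖)]
  calc (‖x‖ + ‖a‖) * |‖x‖ - ‖a‖| ≤ (2 * ‖a‖ + ‖x - a‖) * ‖x - a‖ := by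
        exact mul_le_mul (by linarith) h1 (abs_nonneg _) (by positivity)
    _ ≤ _ := by linarith

theorem Link.Admissible.abs_gainPower_sub_le (h : L.Admissible) {ε : ℝ} (hε : 0 < ε) :
    |L.gainPower - (1 + L.κtUT)| ≤ (1 + 1 / ε) * L.gainError + ε * (1 + L.κtUT) := by
  have h0 := WhiteUplink.integral_norm_sq_amp (P := L.white) h.κtUT_nonneg h.d_ne_zero
  have h1 : L.gainPower - (1 + L.κtUT) =
      ∫ ω, (‖L.white.normalizedGain L.gainTrace ω‖ ^ 2 - ‖L.white.amp ω‖ ^ 2) ∂white4 N := by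
    rw [integral_sub (Tame.integrable (by fun_prop)) (Tame.integrable (by fun_prop)), h0]
    rfl
  rw [h1, ← Real.norm_eq_abs]
  refine (norm_integral_le_integral_norm _).trans ?_
  have h2 : Tame fun ω =>
      ‖L.white.normalizedGain L.gainTrace ω‖ ^ 2 - ‖L.white.amp ω‖ ^ 2 := by fun_prop
  refine (white4_mono h2.norm (by fun_prop : Tame fun ω =>
    (1 + 1 / ε) * ‖L.white.normalizedGain L.gainTrace ω - L.white.amp ω‖ ^ 2
      + ε * ‖L.white.amp ω‖ ^ 2) fun ω => abs_norm_sq_sub_le hε _ _).trans (le_of_eq ?_)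
  rw [integral_add (Tame.integrable (by fun_prop)) (Tame.integrable (by fun_prop)),
    integral_const_mul, integral_const_mul, h0]
  rfl

/-- `sum_norm_sq_mul_le` with `a = √N` balances `∑ |h i|⁴`, of mean `O(N)`, against the constraint
on the beamforming vector. The rate `√N` is what later requires `tUT < 1/2`. -/
theorem Link.sum_integral_distortion_le (L : Link N) {b : ℝ} (hb : L.white.Bounded b)
    (hN : 1 ≤ N) :
    ∑ i, ∫ u, ‖u.1 i‖ ^ 2 * ‖mrt (L.estimate u) i‖ ^ 2 ∂L.uplink ≤
      Real.sqrt N * (2 * (2 + stdMoment 4) * b ^ 4 + 1) := by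
  have hn : (0 : ℝ) < N := by exact_mod_cast hN
  have hs : 0 < Real.sqrt N := Real.sqrt_pos.2 hn
  have h0 : Tame fun u : WhiteUplink.Sample N =>
      ∑ i, ‖u.1 i‖ ^ 2 * ‖mrt (L.estimate u) i‖ ^ 2 := by fun_prop
  rw [← integral_finsetSum _ fun i _ => Tame.integrable (by fun_prop),
    L.integral_uplink h0.measurable]
  have h1 : ∫ ω, ∑ i, ‖(L.colour ω).1 i‖ ^ 2 * ‖mrt (L.estimate (L.colour ω)) i‖ ^ 2 ∂white4 N ≤
      ∫ ω, ((∑ i, ‖L.white.chan ω i‖ ^ 4) / Real.sqrt N + Real.sqrt N) ∂white4 N := by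
    refine white4_mono (by fun_prop) ?_ fun ω =>
      WhiteUplink.sum_norm_sq_mul_le hs (L.colour ω).1 _ (nsq_mrt_le _)
    simp only [div_eq_mul_inv]
    fun_prop
  refine h1.trans ?_
  rw [integral_add ((Tame.integrable (by fun_prop)).div_const _) (integrable_const _),
    integral_div]
  simp only [integral_const, probReal_univ, one_smul]
  have h2 := WhiteUplink.integral_sum_norm_four_chan_le hb
  have h3 : (N : ℝ) = Real.sqrt N * Real.sqrt N := (Real.mul_self_sqrt hn.le).symm
  have h4 : (∫ ω, ∑ i, ‖L.white.chan ω i‖ ^ 4 ∂white4 N) / Real.sqrt N ≤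
      Real.sqrt N * (2 * (2 + stdMoment 4) * b ^ 4) := by
    rw [div_le_iff₀ hs]
    refine h2.trans (le_of_eq ?_)
    nth_rewrite 1 [h3]
    ring
  linarith

/-- The chain is `(cN)² ≤ (tr R)² ≤ N · frobSq R ≤ N ‖gram‖ T`. Dividing by `G + 1` instead of `G`
avoids a degenerate denominator. -/
theorem Link.Admissible.le_gainTrace (h : L.Admissible) (hN : 1 ≤ N) {c G : ℝ} (hc : 0 < c)
    (htr : c * N ≤ L.R.trace.re) (hG : ‖L.gram‖ ≤ G) : c ^ 2 / (G + 1) * N ≤ L.gainTrace := by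
  have hn : (0 : ℝ) < N := by exact_mod_cast hN
  have hG0 : 0 ≤ G := (norm_nonneg _).trans hG
  have h1 : (c * N) ^ 2 ≤ N * (‖L.gram‖ * L.gainTrace) :=
    (pow_le_pow_left₀ (by positivity) htr 2).trans ((sq_trace_re_le _).trans
      (mul_le_mul_of_nonneg_left h.frobSq_le hn.le))
  have hT : 0 ≤ L.gainTrace := by
    by_contra hneg
    push Not at hneg
    have h2 : ‖L.gram‖ * L.gainTrace ≤ 0 :=
      mul_nonpos_of_nonneg_of_nonpos (norm_nonneg _) hneg.le
    have h3 : 0 < (c * N) ^ 2 := by positivity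
    nlinarith
  have h2 : ‖L.gram‖ * L.gainTrace ≤ (G + 1) * L.gainTrace :=
    mul_le_mul_of_nonneg_right (by linarith) hT
  have h3 : c ^ 2 * N ≤ (G + 1) * L.gainTrace := by
    have : N * (c ^ 2 * N) ≤ N * ((G + 1) * L.gainTrace) := by nlinarith
    exact le_of_mul_le_mul_left this hn
  rw [div_mul_eq_mul_div, div_le_iff₀ (by linarith)]
  linarith

/-! ### Limits -/

theorem tendsto_ofReal_logb_atTop {α : Type*} {l : Filter α} {f : α → ℝ} (hf : Tendsto f l atTop) :
    Tendsto (fun x => ENNReal.ofReal (Real.logb 2 (1 + f x))) l (𝓝 ⊤) :=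
  ENNReal.tendsto_ofReal_atTop.comp ((Real.tendsto_logb_atTop one_lt_two).comp
    (tendsto_atTop_add_const_left _ 1 hf))

theorem tendsto_ofReal_logb {α : Type*} {l : Filter α} {f : α → ℝ} {y : ℝ} (hy : 0 ≤ y)
    (hf : Tendsto f l (𝓝 y)) :
    Tendsto (fun x => ENNReal.ofReal (Real.logb 2 (1 + f x))) l
      (𝓝 (ENNReal.ofReal (Real.logb 2 (1 + y)))) := by
  refine ENNReal.tendsto_ofReal ?_
  have h1 : (1 + y) ≠ 0 := by positivity
  simp only [Real.logb]
  exact ((hf.const_add 1).log h1).div_const _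

theorem ceiling_pos {κ : ℝ} (hκ : 0 ≤ κ) : ceiling κ ≠ 0 := by
  unfold ceiling
  split_ifs with h
  · simp
  · have hκ' : 0 < κ := lt_of_le_of_ne hκ (Ne.symm h)
    have h1 : 0 < 1 / κ := by positivity
    have h2 : 0 < Real.logb 2 (1 + 1 / κ) := Real.logb_pos one_lt_two (by linarith)
    simpa using h2

/-- The limit of the MRT bound, from the limits of the moments of the normalized gain. -/
theorem tendsto_mrtLower {L : (N : ℕ) → Link N} {κrUT κtUT : ℝ} (hκr : 0 ≤ κrUT) (hκt : 0 ≤ κtUT)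
    (hadm : ∀ᶠ N in atTop, (L N).Admissible) (hκ : ∀ N, (L N).κrUT = κrUT)
    (hT : ∀ᶠ N in atTop, 0 < (L N).gainTrace)
    (hmean : Tendsto (fun N => ‖(L N).gainMean‖ ^ 2) atTop (𝓝 1))
    (hpow : Tendsto (fun N => (L N).gainPower) atTop (𝓝 (1 + κtUT)))
    (hres : Tendsto (fun N => (L N).residual) atTop (𝓝 0)) :
    Tendsto (fun N => (L N).mrtLower) atTop (𝓝 (ceiling (κrUT + κtUT + κrUT * κtUT))) := by
  set κ := κrUT + κtUT + κrUT * κtUT with hκdef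
  have hκ0 : 0 ≤ κ := by positivity
  have hden : Tendsto (fun N => (1 + (L N).κrUT) * (L N).gainPower - ‖(L N).gainMean‖ ^ 2
      + (L N).residual) atTop (𝓝 κ) := by
    simp only [hκ]
    have := ((hpow.const_mul (1 + κrUT)).sub hmean).add hres
    refine this.congr' (.of_forall fun _ => rfl) |>.trans (le_of_eq ?_)
    congr 1
    rw [hκdef]; ring
  -- Positivity matters when `κ = 0`: the denominator then tends to `0`, and the quotient tends to
  -- `+∞` only because it does so from above.
  have hdpos : ∀ᶠ N in atTop, 0 < (1 + (L N).κrUT) * (L N).gainPower - ‖(L N).gainMean‖ ^ 2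
      + (L N).residual := by
    filter_upwards [hadm, hT] with N h1 h2 using h1.denominator_pos h2
  have hS : ∀ᶠ N in atTop, ‖(L N).gainMean‖ ^ 2 / ((1 + (L N).κrUT) * (L N).gainPower
      - ‖(L N).gainMean‖ ^ 2 + (L N).residual) = (L N).mrtSINR := by
    filter_upwards [hadm, hT] with N h1 h2 using (h1.mrtSINR_eq_div h2).symm
  by_cases h0 : κ = 0
  · rw [ceiling, if_pos h0]
    refine tendsto_ofReal_logb_atTop ?_
    refine Tendsto.congr' hS ?_
    rw [h0] at hden
    have h1 : Tendsto (fun N => ((1 + (L N).κrUT) * (L N).gainPower - ‖(L N).gainMean‖ ^ 2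
      + (L N).residual)⁻¹) atTop atTop :=
      tendsto_inv_nhdsGT_zero.comp (tendsto_nhdsWithin_iff.2 ⟨hden, hdpos⟩)
    exact Tendsto.pos_mul_atTop one_pos hmean h1
  · rw [ceiling, if_neg h0]
    refine tendsto_ofReal_logb (by positivity) ?_
    exact Tendsto.congr' hS (hmean.div hden h0)

theorem tendsto_natCast_rpow_neg {s : ℝ} (hs : 0 < s) :
    Tendsto (fun N : ℕ => (N : ℝ) ^ (-s)) atTop (𝓝 0) :=
  (tendsto_rpow_neg_atTop hs).comp tendsto_natCast_atTop_atTop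

end

end MISO

end

/-! ### Power scaling and conclusion -/

theorem corollary4
    -- impairment levels and noise variance at the terminal
    (κtBS κrBS κtUT κrUT noiseUT : ℝ)
    (hκtBS : 0 ≤ κtBS) (hκrBS : 0 ≤ κrBS) (hκtUT : 0 ≤ κtUT) (hκrUT : 0 ≤ κrUT)
    (hnoise : 0 < noiseUT)
    -- channel and noise covariance matrices, with spectral norms bounded uniformly in `N`
    (R S : (N : ℕ) → Matrix (Fin N) (Fin N) ℂ)
    (hR : ∀ N, (R N).PosSemidef) (hS : ∀ N, (S N).PosDef)
    (hRbdd : ∃ b : ℝ, ∀ N, ‖R N‖ ≤ b) (hSbdd : ∃ b : ℝ, ∀ N, ‖S N‖ ≤ b)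
    -- the channel gain per antenna and the noise eigenvalues are bounded away from zero
    (hRtr : ∃ c : ℝ, 0 < c ∧ ∀ᶠ N : ℕ in atTop, c * N ≤ (R N).trace.re)
    (hSinv : ∃ b : ℝ, ∀ N, ‖(S N)⁻¹‖ ≤ b)
    -- power scaling
    (tBS tUT cBS cUT : ℝ) (hcBS : 0 < cBS) (hcUT : 0 < cUT)
    (htBS : 0 ≤ tBS) (htUT : 0 < tUT) (htUT' : tUT < 1 / 2) (ht : tBS + tUT < 1)
    (d : ℕ → ℂ) (hd : ∀ N : ℕ, 1 ≤ N → ‖d N‖ ^ 2 = cUT / (N : ℝ) ^ tUT)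
    -- the link with `N` antennas
    (L : (N : ℕ) → MISO.Link N)
    (hL : ∀ N, L N =
      { R := R N, S := S N, d := d N, pBS := cBS / (N : ℝ) ^ tBS, noiseUT := noiseUT,
        κtBS := κtBS, κrBS := κrBS, κtUT := κtUT, κrUT := κrUT })
    -- arbitrary channel state information at the terminal
    (𝒢 : ℕ → Type*) [∀ N, MeasurableSpace (𝒢 N)]
    (csi : (N : ℕ) → MISO.Beamformer N → MISO.TerminalCSI (𝒢 N) (L N).channelLaw) :
    -- the MRT bound is a lower bound on the capacity
    (∀ N, 1 ≤ N → (L N).mrtLower ≤ (L N).capacity (csi N)) ∧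
    -- its limit, and the resulting asymptotic lower bound on the capacity
    Tendsto (fun N => (L N).mrtLower) atTop (𝓝 (MISO.ceiling (κrUT + κtUT + κrUT * κtUT))) ∧
    MISO.ceiling (κrUT + κtUT + κrUT * κtUT) ≤
      liminf (fun N => (L N).capacity (csi N)) atTop ∧
    -- the energy efficiency is unbounded if both powers are reduced
    (0 < tBS → ∀ α₁ α₂ : ℝ, 0 ≤ α₁ → 0 ≤ α₂ →
      Tendsto (fun N => (L N).energyEfficiency (csi N) α₁ α₂) atTop (𝓝 ⊤)) := by
  obtain ⟨b₁, hb₁⟩ := hRbdd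
  obtain ⟨b₂, hb₂⟩ := hSbdd
  obtain ⟨b₃, hb₃⟩ := hSinv
  obtain ⟨c, hc, htr⟩ := hRtr
  have eR (N) : (L N).R = R N := by rw [hL]
  have eS (N) : (L N).S = S N := by rw [hL]
  have ed (N) : (L N).d = d N := by rw [hL]
  have epBS (N) : (L N).pBS = cBS / (N : ℝ) ^ tBS := by rw [hL]
  have enoise (N) : (L N).noiseUT = noiseUT := by rw [hL]
  have eκtBS (N) : (L N).κtBS = κtBS := by rw [hL]
  have eκrBS (N) : (L N).κrBS = κrBS := by rw [hL]
  have eκtUT (N) : (L N).κtUT = κtUT := by rw [hL]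
  have eκrUT (N) : (L N).κrUT = κrUT := by rw [hL]
  have epUT (N : ℕ) (hN : 1 ≤ N) : (L N).pUT = cUT / (N : ℝ) ^ tUT := by
    rw [MISO.Link.pUT, ed, hd N hN]
  clear hL
  have hpos (N : ℕ) (hN : 1 ≤ N) : (0 : ℝ) < N := by exact_mod_cast hN
  have hadm (N : ℕ) (hN : 1 ≤ N) : (L N).Admissible := by
    have hn := hpos N hN
    refine ⟨eR N ▸ hR N, eS N ▸ hS N, ?_, ?_, enoise N ▸ hnoise, eκtBS N ▸ hκtBS, eκrBS N ▸ hκrBS,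
      eκtUT N ▸ hκtUT, eκrUT N ▸ hκrUT⟩
    · intro h0
      have h1 := epUT N hN
      rw [MISO.Link.pUT, h0, norm_zero] at h1
      have : 0 < cUT / (N : ℝ) ^ tUT := by positivity
      norm_num at h1
      linarith
    · rw [epBS]; positivity
  have hadm' : ∀ᶠ N in atTop, (L N).Admissible :=
    (eventually_ge_atTop 1).mono hadm
  have hcap (N : ℕ) (hN : 1 ≤ N) : (L N).mrtLower ≤ (L N).capacity (csi N) :=
    (hadm N hN).mrtLower_le_capacity hN (csi N)
  set b := max b₁ (max b₂ b₃) with hb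
  have hRb (N) : ‖(L N).R‖ ≤ b := by rw [eR]; exact (hb₁ N).trans (le_max_left _ _)
  have hSb (N) : ‖(L N).S‖ ≤ b := by
    rw [eS]; exact (hb₂ N).trans ((le_max_left _ _).trans (le_max_right _ _))
  have hSib (N) : ‖(L N).S⁻¹‖ ≤ b := by
    rw [eS]; exact (hb₃ N).trans ((le_max_right _ _).trans (le_max_right _ _))
  have hb0 : 0 ≤ b := (norm_nonneg _).trans (hRb 0)
  have hq_le (N : ℕ) (hN : 1 ≤ N) : (L N).pUT ≤ cUT := by
    rw [epUT N hN]
    exact div_le_self hcUT.le (Real.one_le_rpow (by exact_mod_cast hN) htUT.le)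
  -- A bound on `‖gram‖` uniform in `N`, from `norm_gram_le` and `pUT ≤ cUT`.
  set G := cUT * (1 + κtUT + κrBS) * b + b with hG
  have hG0 : 0 ≤ G := by positivity
  set τ := c ^ 2 / (G + 1) with hτ
  have hτ0 : 0 < τ := by positivity
  have hT : ∀ᶠ N : ℕ in atTop, τ * N ≤ (L N).gainTrace := by
    filter_upwards [htr, eventually_ge_atTop 1] with N h1 hN
    refine (hadm N hN).le_gainTrace hN hc (by rw [eR]; exact h1) ?_
    refine (hadm N hN).norm_gram_le.trans ?_
    rw [eκtUT, eκrBS]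
    have := hq_le N hN
    have := hRb N
    have := hSb N
    have := (L N).pUT_nonneg
    rw [hG]
    gcongr
  have hT0 : ∀ᶠ N : ℕ in atTop, 0 < (L N).gainTrace := by
    filter_upwards [hT, eventually_ge_atTop 1] with N h1 hN
    have := hpos N hN
    exact lt_of_lt_of_le (by positivity) h1
  -- the mean square error of the gain
  obtain ⟨C, hC⟩ := MISO.WhiteUplink.exists_integral_norm_sq_normalizedGain_sub_amp_le
    (1 + b + b * b) (b ^ 5 * (1 + κtUT + κrBS)) τ κtUT κrBS hτ0
  -- The error bound at `q = cUT N^(-tUT)`: its three summands are `1/N`, `1/(qN)` and `q`. The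
  -- factor `|C| + 1` keeps `β` strictly positive, since `√β` is a divisor below.
  let β : ℕ → ℝ := fun N => (|C| + 1) * ((N : ℝ) ^ (-1 : ℝ) + 1 / cUT * (N : ℝ) ^ (-(1 - tUT))
    + cUT * (N : ℝ) ^ (-tUT))
  have hβ : Tendsto β atTop (𝓝 0) := by
    have h1 := ((MISO.tendsto_natCast_rpow_neg one_pos).add
      ((MISO.tendsto_natCast_rpow_neg (by linarith : 0 < 1 - tUT)).const_mul (1 / cUT))).add
      ((MISO.tendsto_natCast_rpow_neg htUT).const_mul cUT)
    have h2 := h1.const_mul (|C| + 1)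
    simp only [add_zero, mul_zero] at h2
    exact h2
  have hβpos (N : ℕ) (hN : 1 ≤ N) : 0 < β N := by
    have := hpos N hN
    positivity
  have herr : ∀ᶠ N : ℕ in atTop, (L N).gainError ≤ β N := by
    filter_upwards [hT, eventually_ge_atTop 1] with N h1 hN
    have hn := hpos N hN
    have h2 := hC N (L N).white (L N).gainTrace hN
      ((hadm N hN).bounded (hRb N) (hSb N) (hSib N))
      (by
        have := (hadm N hN).calibrated (hRb N) (hSib N)
        rwa [eκtUT, eκrBS] at this)
      (hadm N hN).d_ne_zero (eκtUT N) (eκrBS N) h1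
    refine h2.trans ?_
    have h3 : ‖(L N).white.d‖ ^ 2 = cUT * (N : ℝ) ^ (-tUT) := by
      rw [Real.rpow_neg hn.le, ← div_eq_mul_inv]
      exact epUT N hN
    have h4 : 1 / (cUT * (N : ℝ) ^ (-tUT) * N) = 1 / cUT * (N : ℝ) ^ (-(1 - tUT)) := by
      have : (N : ℝ) ^ (-(1 - tUT)) = ((N : ℝ) ^ (-tUT) * N)⁻¹ := by
        rw [Real.rpow_neg hn.le, sub_eq_add_neg, Real.rpow_add hn, Real.rpow_one, mul_comm]
      rw [this]
      field_simp
    have h6 : 1 / (N : ℝ) = (N : ℝ) ^ (-1 : ℝ) := by rw [Real.rpow_neg_one, one_div]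
    rw [h3, h4, h6]
    have h5 : 0 ≤ (N : ℝ) ^ (-1 : ℝ) + 1 / cUT * (N : ℝ) ^ (-(1 - tUT))
      + cUT * (N : ℝ) ^ (-tUT) := by positivity
    exact mul_le_mul_of_nonneg_right ((le_abs_self C).trans (by linarith)) h5
  have hmean : Tendsto (fun N => ‖(L N).gainMean‖ ^ 2) atTop (𝓝 1) := by
    have h1 : Tendsto (fun N => ‖(L N).gainMean - 1‖ ^ 2) atTop (𝓝 0) :=
      squeeze_zero' (.of_forall fun _ => by positivity)
        (herr.mono fun N h => ((L N).norm_sq_gainMean_sub_one_le).trans h) hβ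
    have h2 : Tendsto (fun N => ‖(L N).gainMean - 1‖) atTop (𝓝 0) := by
      have := h1.sqrt
      simpa [Real.sqrt_sq] using this
    have h3 : Tendsto (fun N => (L N).gainMean) atTop (𝓝 1) :=
      tendsto_iff_norm_sub_tendsto_zero.2 h2
    simpa using h3.norm.pow 2
  have hpow : Tendsto (fun N => (L N).gainPower) atTop (𝓝 (1 + κtUT)) := by
    rw [tendsto_iff_norm_sub_tendsto_zero]
    have h1 : Tendsto (fun N => β N + Real.sqrt (β N) + Real.sqrt (β N) * (1 + κtUT)) atTop
        (𝓝 0) := by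
      have h2 : Tendsto (fun N => Real.sqrt (β N)) atTop (𝓝 0) := by simpa using hβ.sqrt
      simpa using (hβ.add h2).add (h2.mul_const (1 + κtUT))
    refine squeeze_zero' (.of_forall fun _ => norm_nonneg _) ?_ h1
    filter_upwards [herr, eventually_ge_atTop 1] with N h2 hN
    -- The choice `ε = √β` balances `(1 + 1/ε) β` with `ε (1 + κtUT)`; both tend to `0`.
    have hs : 0 < Real.sqrt (β N) := Real.sqrt_pos.2 (hβpos N hN)
    have h3 := (hadm N hN).abs_gainPower_sub_le hs
    rw [eκtUT] at h3
    rw [Real.norm_eq_abs]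
    refine h3.trans ?_
    have h4 : (1 + 1 / Real.sqrt (β N)) * (L N).gainError ≤
        (1 + 1 / Real.sqrt (β N)) * β N := mul_le_mul_of_nonneg_left h2 (by positivity)
    have h5 : 1 / Real.sqrt (β N) * β N = Real.sqrt (β N) := by
      rw [one_div_mul_eq_div, Real.div_sqrt]
    linarith
  have hres : Tendsto (fun N => (L N).residual) atTop (𝓝 0) := by
    set D := κtBS * (2 * (2 + MISO.stdMoment 4) * (1 + b + b * b) ^ 4 + 1) with hD
    have hm := MISO.stdMoment_nonneg 4
    -- The first term is the BS distortion `√N / (qN)`, which decays because `tUT < 1/2`; the second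
    -- is the noise `N^tBS / (qN)`, which decays because `tBS + tUT < 1`.
    have h1 : Tendsto (fun N : ℕ => D / (cUT * τ) * (N : ℝ) ^ (-(1 / 2 - tUT))
        + noiseUT / cBS / (cUT * τ) * (N : ℝ) ^ (-(1 - tBS - tUT))) atTop (𝓝 0) := by
      simpa using ((MISO.tendsto_natCast_rpow_neg (by linarith : 0 < 1 / 2 - tUT)).const_mul
        (D / (cUT * τ))).add ((MISO.tendsto_natCast_rpow_neg
          (by linarith : 0 < 1 - tBS - tUT)).const_mul (noiseUT / cBS / (cUT * τ)))
    refine squeeze_zero' ?_ ?_ h1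
    · filter_upwards [hT0, eventually_ge_atTop 1] with N h2 hN
      have h := hadm N hN
      refine div_nonneg (add_nonneg (mul_nonneg h.κtBS_nonneg (Finset.sum_nonneg fun i _ =>
        integral_nonneg fun u => by positivity)) ?_) (mul_nonneg h.pUT_pos.le h2.le)
      exact div_nonneg h.noiseUT_pos.le h.pBS_pos.le
    · filter_upwards [hT, eventually_ge_atTop 1] with N h2 hN
      have hn := hpos N hN
      have h3 := (L N).sum_integral_distortion_le ((hadm N hN).bounded (hRb N) (hSb N) (hSib N)) hN
      have h4 := mul_le_mul_of_nonneg_left h3 hκtBS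
      have h5 : noiseUT / (cBS / (N : ℝ) ^ tBS) = noiseUT / cBS * (N : ℝ) ^ tBS := by field_simp
      rw [MISO.Link.residual, eκtBS, enoise, epBS, epUT N hN, h5]
      have hq0 : 0 < cUT / (N : ℝ) ^ tUT := by positivity
      have e1 : D / (cUT * τ) * (N : ℝ) ^ (-(1 / 2 - tUT)) =
          D * Real.sqrt N / (cUT / (N : ℝ) ^ tUT * (τ * N)) := by
        have : (N : ℝ) ^ (-(1 / 2 - tUT)) = Real.sqrt N * (N : ℝ) ^ tUT / N := by
          rw [Real.sqrt_eq_rpow, ← Real.rpow_add hn, ← Real.rpow_sub_one hn.ne']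
          congr 1; ring
        rw [this]
        field_simp
      have e2 : noiseUT / cBS / (cUT * τ) * (N : ℝ) ^ (-(1 - tBS - tUT)) =
          noiseUT / cBS * (N : ℝ) ^ tBS / (cUT / (N : ℝ) ^ tUT * (τ * N)) := by
        have : (N : ℝ) ^ (-(1 - tBS - tUT)) = (N : ℝ) ^ tBS * (N : ℝ) ^ tUT / N := by
          rw [← Real.rpow_add hn, ← Real.rpow_sub_one hn.ne']
          congr 1; ring
        rw [this]
        field_simp
      rw [e1, e2, ← add_div]
      refine div_le_div₀ (by positivity) ?_ (by positivity)
        (mul_le_mul_of_nonneg_left h2 hq0.le)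
      linarith
  have hlim := MISO.tendsto_mrtLower hκrUT hκtUT hadm' eκrUT hT0 hmean hpow hres
  refine ⟨hcap, hlim, ?_, ?_⟩
  · rw [← hlim.liminf_eq]
    exact liminf_le_liminf ((eventually_ge_atTop 1).mono hcap)
  · intro htBS' α₁ α₂ hα₁ hα₂
    have h1 : Tendsto (fun N : ℕ => (cBS + α₁ * cBS) * (N : ℝ) ^ (-tBS)
        + α₂ * cUT * (N : ℝ) ^ (-tUT)) atTop (𝓝 0) := by
      simpa using ((MISO.tendsto_natCast_rpow_neg htBS').const_mul (cBS + α₁ * cBS)).add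
        ((MISO.tendsto_natCast_rpow_neg htUT).const_mul (α₂ * cUT))
    have h2 : Tendsto (fun N => ENNReal.ofReal
        ((L N).pBS + α₁ * (L N).pBS + α₂ * (L N).pUT)) atTop (𝓝 0) := by
      rw [← ENNReal.ofReal_zero]
      refine ENNReal.tendsto_ofReal (h1.congr' ?_)
      filter_upwards [eventually_ge_atTop 1] with N hN
      have hn := hpos N hN
      rw [epBS, epUT N hN, Real.rpow_neg hn.le, Real.rpow_neg hn.le]
      ring
    -- The MRT bound has a nonzero limit, possibly `⊤`, while the total power tends to `0`, so the
    -- quotient tends to `⊤` and the energy efficiency lies above it.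
    have h3 := ENNReal.Tendsto.div hlim (Or.inl (MISO.ceiling_pos
      (by positivity : 0 ≤ κrUT + κtUT + κrUT * κtUT))) h2 (Or.inl ENNReal.zero_ne_top)
    rw [ENNReal.div_zero (MISO.ceiling_pos (by positivity))] at h3
    refine tendsto_of_tendsto_of_tendsto_of_le_of_le' h3 tendsto_const_nhds ?_
      (.of_forall fun _ => le_top)
    filter_upwards [eventually_ge_atTop 1] with N hN
    exact ENNReal.div_le_div_right (hcap N hN) _
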